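/- For $n\ge 2$, $\theta\in\mathbb R$ and $\mu\in[0,\infty)^n$, let $\mathbb P_{\theta,\mu}$ (with expectation $\mathbb E_{\theta,\mu}$) be the law of $Y=(Y_1,\dots,Y_n)$, where $Y_i=\theta+\mu_i+\xi_i$ and $\xi_1,\dots,\xi_n$ are i.i.d. $\mathcal N(0,1)$. Let $\mathcal M_k$ be the set of $\mu\in[0,\infty)^n$ with at most $k$ nonzero entries, and let $$\mathcal R[k,n]=\inf_{\widehat\theta}\ \sup_{\theta\in\mathbb R,\ \mu\in\mathcal M_k}\mathbb E_{\theta,\mu}|\widehat\theta-\theta|,\qquad \rho_{n,k}=\frac{\log^2\big(1+\sqrt{k/(n-k)}\big)}{\log^{3/2}\big(1+(k/\sqrt n)^{2/3}\big)},$$ where the infimum is over all estimators (measurable functions of $Y$). *The adaptive estimator.* Write $Y_{(r)}$ for the $r$-th smallest entry of $Y$, $\overline\Phi$ for the standard normal upper tail function, $T_q$ for the Chebyshev polynomial of the first kind of degree $q$, and $\lfloor x\rfloor_{\rm even}$ for the largest even integer not higher than $x$. Let $a=3[1+\log(3+2\sqrt2)]$ and $q_{\max}=\lfloor\frac1{2a}\log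 n\rfloor_{\rm even}-2$. Put $$\widehat\theta_0=Y_{(\lceil n/2\rceil)},\qquad \widehat\theta_{q_{\max}+2}=Y_{(1)}+\overline\Phi^{-1}(1/n),\qquad \widehat\theta_{\rm up}=Y_{(1)}+2\sqrt{\log n}.$$ For even $q$ with $2\le q\le q_{\max}$, let $\widehat\theta_{{\rm low},q}=\widehat\theta_0-\pi^2/(144\,q_{\max}^{3/2})$ if $q\le\frac{3}{10a}\log n$ and $\widehat\theta_{{\rm low},q}=-\infty$ otherwise, let $\lambda_q=\sqrt{2/q}$, write $T_q(2y-1)=\sum_{j=0}^q a_{j,q}y^j$, and define $$\widehat\psi_q(u)=\sum_{j=0}^q a_{j,q}\,\frac1n\sum_{i=1}^n e^{j\lambda_q(u-Y_i)-j^2\lambda_q^2/2},\qquad \widehat\theta_q=\inf\Big\{u\in[\widehat\theta_{{\rm low},q},\widehat\theta_{\rm up}]:\ \widehat\psi_q(u)>1+\frac{e^{aq}}{\sqrt n}\Big\},$$ with $\inf\emptyset=\widehat\theta_{\rm up}$. Let $\delta_q=10\,e^{a(q+2)}/(\sqrt n\,q^{3/2})$ for even $q$ with $2\le q\le q_{\max}-2$,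 $\delta_{q_{\max}}=25/q_{\max}^{3/2}$ and $\delta_{q_{\max}+2}=4\sqrt{2\log n}$. Finally, with $q,q'$ ranging over $\{0,2,4,\dots,q_{\max}+2\}$, let $$\widehat q=\min\big\{q:\ |\widehat\theta_q-\widehat\theta_{q'}|\le\delta_{q'}\ \text{ for all } q'>q\big\},\qquad \widehat\theta_{\rm ad}=\widehat\theta_{\widehat q}.$$ **Theorem.** There exist universal positive constants $c_1,c_2,c_3,c_4$ and $n_0$ such that for every $n\ge n_0$ the map $\widehat\theta_{\rm ad}$ is well defined and measurable and, for every integer $k\in[1,n-1]$, the following holds. For every $\theta\in\mathbb R$ and every $\mu\in\mathcal M_k$, $$\mathbb P_{\theta,\mu}\big[|\widehat\theta_{\rm ad}-\theta|>c_1\rho_{n,k}\big]\le c_2\Big(\frac{\sqrt n}{k\vee\sqrt n}\Big)^{4/3}\log^3\Big(\frac{k\vee(2\sqrt n)}{\sqrt n}\Big)$$ and $$\mathbb E_{\theta,\mu}|\widehat\theta_{\rm ad}-\theta|\le c_3\,\rho_{n,k}<\infty .$$ Moreover $\widehat\theta_{\rm ad}$, which does not depend on $k$, is minimax adaptive: $$\sup_{\theta\in\mathbb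 R,\ \mu\in\mathcal M_k}\mathbb E_{\theta,\mu}|\widehat\theta_{\rm ad}-\theta|\le c_4\,\mathcal R[k,n].$$ -/

import Mathlib

noncomputable section

namespace GOSC

open MeasureTheory ProbabilityTheory

/-! ### The model -/

/-- The law of `Y = (Y₁, …, Yₙ)`, where `Yᵢ = θ + μᵢ + ξᵢ` with `ξᵢ` i.i.d. standard normal: the
`Yᵢ` are independent and `Yᵢ` has law `N(θ + μᵢ, 1)`. -/
def law (n : ℕ) (θ : ℝ) (μ : Fin n → ℝ) : Measure (Fin n → ℝ) :=
  Measure.pi fun i => gaussianReal (θ + μ i) 1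

/-- The contamination effects: `μ ∈ [0, ∞)ⁿ` with at most `k` nonzero entries. -/
def sparse (n k : ℕ) : Set (Fin n → ℝ) :=
  {μ | (∀ i, 0 ≤ μ i) ∧ (Finset.univ.filter fun i => μ i ≠ 0).card ≤ k}

/-- The maximal `L¹` risk of an estimator of `θ` over `θ ∈ ℝ` and `μ ∈ sparse n k`. -/
def maxRisk (n k : ℕ) (est : (Fin n → ℝ) → ℝ) : ENNReal :=
  ⨆ (θ : ℝ) (μ ∈ sparse n k), ∫⁻ Y, ENNReal.ofReal |est Y - θ| ∂(law n θ μ)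

/-- The minimax `L¹` risk: the infimum of the maximal risk over all estimators, that is, over all
measurable functions of the data. -/
def minimaxRisk (n k : ℕ) : ENNReal :=
  ⨅ (est : (Fin n → ℝ) → ℝ) (_ : Measurable est), maxRisk n k est

/-- `log²(1 + √(k/(n-k))) / log^{3/2}(1 + (k/√n)^{2/3})`. -/
def rate (n k : ℕ) : ℝ :=
  Real.log (1 + √((k : ℝ) / ((n : ℝ) - k))) ^ 2 /
    Real.log (1 + ((k : ℝ) / √(n : ℝ)) ^ (2 / 3 : ℝ)) ^ (3 / 2 : ℝ)

/-! ### Quantile estimators -/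

/-- The `r`-th smallest entry of `Y`, counted with multiplicity, for `1 ≤ r ≤ n`: the least `t`
such that at least `r` of the entries are at most `t`. -/
def orderStat {n : ℕ} (Y : Fin n → ℝ) (r : ℕ) : ℝ :=
  sInf {t : ℝ | r ≤ (Finset.univ.filter fun i => Y i ≤ t).card}

/-- The upper tail function of the standard normal distribution. -/
def gaussTail (t : ℝ) : ℝ := (gaussianReal 0 1).real (Set.Ioi t)

/-- The inverse of `gaussTail` on `(0, 1)`. As `gaussTail` is continuous and strictly decreasing
from `1` to `0`, this infimum is the only `t` with `gaussTail t = p`. -/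
def gaussTailInv (p : ℝ) : ℝ := sInf {t : ℝ | gaussTail t ≤ p}

/-- The empirical median, the entry of rank `⌈n/2⌉`. -/
def thetaMed (n : ℕ) (Y : Fin n → ℝ) : ℝ := orderStat Y ⌈(n : ℝ) / 2⌉₊

/-- The debiased minimum. -/
def thetaMin (n : ℕ) (Y : Fin n → ℝ) : ℝ := orderStat Y 1 + gaussTailInv (1 / n)

/-! ### The Chebyshev / Laplace estimators -/

/-- `a = 3 (1 + log (3 + 2√2))`. -/
def a : ℝ := 3 * (1 + Real.log (3 + 2 * √2))

/-- The largest even integer that is not higher than `x`, for `x ≥ 0`. -/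
def floorEven (x : ℝ) : ℕ := 2 * ⌊x / 2⌋₊

/-- `q_max`, the largest even integer not higher than `log n / (2a)`, minus `2`. For all large `n`
this is positive and the truncated subtraction has no effect. -/
def qmax (n : ℕ) : ℕ := floorEven (1 / (2 * a) * Real.log n) - 2

/-- The rough upper estimator. -/
def thetaUp (n : ℕ) (Y : Fin n → ℝ) : ℝ := orderStat Y 1 + 2 * √(Real.log n)

/-- The rough lower estimator: the median minus `π² / (144 q_max^{3/2})` if
`q ≤ 3 log n / (10 a)`, and `-∞` for larger `q`. -/
def thetaLow (n q : ℕ) (Y : Fin n → ℝ) : EReal :=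
  if (q : ℝ) ≤ 3 / (10 * a) * Real.log n then
    ((thetaMed n Y - Real.pi ^ 2 / (144 * (qmax n : ℝ) ^ (3 / 2 : ℝ)) : ℝ) : EReal)
  else ⊥

/-- The coefficient of `y ^ j` in `T_q (2 y - 1)`, where `T_q` is the Chebyshev polynomial of the
first kind of degree `q`; so `T_q (2 eˣ - 1) = ∑ j ≤ q, chebCoeff q j * e ^ (j x)`. -/
def chebCoeff (q j : ℕ) : ℝ :=
  ((Polynomial.Chebyshev.T ℝ (q : ℤ)).comp (2 * Polynomial.X - 1)).coeff j

/-- The empirical Laplace transform `n⁻¹ ∑ᵢ exp (l (u - Yᵢ) - l² / 2)`. -/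
def etaHat (n : ℕ) (l u : ℝ) (Y : Fin n → ℝ) : ℝ :=
  (n : ℝ)⁻¹ * ∑ i, Real.exp (l * (u - Y i) - l ^ 2 / 2)

/-- `∑ j ≤ q, chebCoeff q j * etaHat (j l) u`. -/
def psiHat (n q : ℕ) (l u : ℝ) (Y : Fin n → ℝ) : ℝ :=
  ∑ j ∈ Finset.range (q + 1), chebCoeff q j * etaHat n (j * l) u Y

/-- `λ_q = √(2/q)`. -/
def lam (q : ℕ) : ℝ := √(2 / (q : ℝ))

/-- The points `u` of `[thetaLow, thetaUp]` at which `psiHat` exceeds `1 + e^{a q} / √n`. -/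
def crossing (n q : ℕ) (Y : Fin n → ℝ) : Set ℝ :=
  {u : ℝ | thetaLow n q Y ≤ (u : EReal) ∧ u ≤ thetaUp n Y ∧
    1 + Real.exp (a * q) / √(n : ℝ) < psiHat n q (lam q) u Y}

open Classical in
/-- The estimator `θ̂_q`: the infimum of `crossing`, and `thetaUp` if `crossing` is empty. For even
`q ≥ 2` the set `crossing` is always bounded below, because `psiHat` tends to `1` at `-∞`. -/
def thetaCheb (n q : ℕ) (Y : Fin n → ℝ) : ℝ :=
  if (crossing n q Y).Nonempty then sInf (crossing n q Y) else thetaUp n Y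

/-! ### The selection -/

/-- The candidates, for even `q` with `0 ≤ q ≤ q_max + 2`: the median (`q = 0`), `θ̂_q`
(`2 ≤ q ≤ q_max`) and the debiased minimum (`q = q_max + 2`). -/
def candidate (n q : ℕ) (Y : Fin n → ℝ) : ℝ :=
  if q = 0 then thetaMed n Y
  else if q ≤ qmax n then thetaCheb n q Y
  else thetaMin n Y

/-- The thresholds, for even `q` with `2 ≤ q ≤ q_max + 2`. -/
def delta (n q : ℕ) : ℝ :=
  if q < qmax n then 10 * (Real.exp (a * (q + 2)) / (√(n : ℝ) * (q : ℝ) ^ (3 / 2 : ℝ)))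
  else if q = qmax n then 25 / (qmax n : ℝ) ^ (3 / 2 : ℝ)
  else 4 * √(2 * Real.log n)

/-- The selected index: the least `q ∈ {0, 2, …, q_max + 2}` whose candidate is within
`delta n q'` of every later candidate `q'`. The index `q_max + 2` always qualifies. -/
def qHat (n : ℕ) (Y : Fin n → ℝ) : ℕ :=
  sInf {q : ℕ | Even q ∧ q ≤ qmax n + 2 ∧
    ∀ q' : ℕ, Even q' → q < q' → q' ≤ qmax n + 2 →
      |candidate n q Y - candidate n q' Y| ≤ delta n q'}

/-- The adaptive estimator. -/
def thetaAd (n : ℕ) (Y : Fin n → ℝ) : ℝ := candidate n (qHat n Y) Y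

end GOSC

end

/-!
The upper bound. For `l ≥ 0` the mean of `etaHat n l u` is `n⁻¹ ∑ᵢ exp (l (u - θ - μᵢ))`, so the mean
of `psiHat n q (lam q) u` is the average over `i` of `T_q (2 e ^ (lam q (u - θ - μᵢ)) - 1)`. As `T_q`
is bounded by `1` on `[-1, 1]` and grows fast to the right of `1`, this mean is at most `1` for
`u ≤ θ`, whatever the contaminations `μᵢ ≥ 0` are (`psiMean_le_one`), and the uncontaminated part
makes it exceed `1` soon after `θ` (`le_psiMean`). The observations enter `psiHat` at different `u`
through the same finitely many averages, so that one random variable, `noise n q`, bounds the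
stochastic error for all `u` at once. When it is below the threshold `thr n q`, the first crossing
lies in `[θ, θ + d]` for an explicit `d` (`thetaCheb_mem_Icc`, with the two regimes `excess_of_small`
and `excess_of_large`). The second moment bounds the probability that the noise exceeds its threshold
by `e ^ (-4 a q / 3)` (`noise_tail`).

If all candidates from an index `Q` on are accurate, the selection rule makes the selected one as
accurate as `delta n Q` (`abs_thetaAd_sub_le`). Taking for `Q` the first even index at which
`k / n ≤ thr n Q`, or `qmax n` if there is none, gives the order of the rate (`exists_oracle`). If
the noise is too large at a level `m ≥ Q` and at none above it, the error is still at most of the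
order of `delta n (m + 2)`, and the product of this with `e ^ (-4 a m / 3)` decays geometrically in
`m` and is at most of the order of `1 / √n`, hence of the order of the rate. Summation over `m` gives
the bounds in probability and in expectation (`exists_upper_bounds`). The event that the minimum or
the median is far off contributes a term of smaller order.

The lower bound. Two priors, which draw the means of the observations independently, one with
location `-θ` and one with location `0`, force a risk of order `θ` if the two mixtures have a `χ²`
distance of order at most `1 / n` (`le_minimaxRisk_of_priors`). That distance is
`∑ m, Δ_m² / m!` up to a factor, where `Δ_m` is the difference of the `m`-th moments of the priors.
Extrapolating polynomials of degree at most `q` from the extremal points of the Chebyshev polynomial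
on `[0, M]` to the point `-θ` gives a signed measure that annihilates these polynomials; its positive
and negative parts are two priors with `q` common moments, and the largest `θ` for which they do not
contaminate more than the fraction `k / n` of the data is explicit (`exists_matching_priors`). For
`k ≥ 4 √n`, the choice `q ≈ 2 log (k / √n)`, `M ≈ √q` yields the rate; for smaller `k` the rate is of
order at most `1 / √n`, and two point masses suffice (`exists_lower_bound`).
-/


noncomputable section
namespace GOSC

/-! ### Chebyshev polynomials -/

open Polynomial Polynomial.Chebyshev in
lemma chebCoeff_succ_succ (q j : ℕ) :
    chebCoeff (q + 2) (j + 1) =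
        4 * chebCoeff (q + 1) j - 2 * chebCoeff (q + 1) (j + 1) - chebCoeff q (j + 1) ∧
      chebCoeff (q + 2) 0 = -2 * chebCoeff (q + 1) 0 - chebCoeff q 0 := by
  have h : (T ℝ ((q + 2 : ℕ) : ℤ)).comp (2 * X - 1) =
      C 4 * ((T ℝ ((q + 1 : ℕ) : ℤ)).comp (2 * X - 1) * X)
        - C 2 * (T ℝ ((q + 1 : ℕ) : ℤ)).comp (2 * X - 1) - (T ℝ (q : ℤ)).comp (2 * X - 1) := by
    push_cast
    rw [T_add_two]
    simp only [sub_comp, mul_comp, X_comp, ofNat_comp]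
    simp only [map_ofNat]
    ring
  constructor
  · simp only [chebCoeff, h, coeff_sub, coeff_C_mul, coeff_mul_X]
  · simp only [chebCoeff, h, coeff_sub, mul_coeff_zero, coeff_X_zero, coeff_C_zero]
    ring

/-- The coefficients of `T_q (2 y - 1)` alternate in sign, and grow with `q` in absolute value. -/
lemma chebCoeff_alternating (q : ℕ) :
    ∀ j, 0 ≤ (-1) ^ (q + j) * chebCoeff q j ∧
      (-1) ^ (q + j) * chebCoeff q j ≤ (-1) ^ (q + 1 + j) * chebCoeff (q + 1) j := by
  induction q with
  | zero =>
    intro j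
    rcases j with _ | _ | j
    · simp [chebCoeff]
    · simp [chebCoeff, Polynomial.coeff_one]
    · simp [chebCoeff, Polynomial.coeff_one, Polynomial.coeff_X]
  | succ q ih =>
    intro j
    have h1 := ih j
    refine ⟨h1.1.trans h1.2, ?_⟩
    rcases j with _ | j
    · rw [(chebCoeff_succ_succ q 0).2]
      simp only [add_zero] at *
      have : (-1 : ℝ) ^ (q + 1 + 1) * (-2 * chebCoeff (q + 1) 0 - chebCoeff q 0)
        = 2 * ((-1) ^ (q + 1) * chebCoeff (q + 1) 0) - (-1) ^ q * chebCoeff q 0 := by ring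
      rw [this]; linarith [h1.2]
    · have h2 := ih j
      rw [(chebCoeff_succ_succ q j).1]
      have : (-1 : ℝ) ^ (q + 1 + 1 + (j + 1)) *
          (4 * chebCoeff (q + 1) j - 2 * chebCoeff (q + 1) (j + 1) - chebCoeff q (j + 1))
        = 4 * ((-1) ^ (q + 1 + j) * chebCoeff (q + 1) j)
          + 2 * ((-1) ^ (q + 1 + (j + 1)) * chebCoeff (q + 1) (j + 1))
          - (-1) ^ (q + (j + 1)) * chebCoeff q (j + 1) := by ring
      rw [this]; linarith [h1.1, h1.2, h2.1, h2.2]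

lemma sum_chebCoeff_mul_pow (q : ℕ) (y : ℝ) :
    ∑ j ∈ Finset.range (q + 1), chebCoeff q j * y ^ j =
      (Polynomial.Chebyshev.T ℝ (q : ℤ)).eval (2 * y - 1) := by
  have hd : ((Polynomial.Chebyshev.T ℝ (q : ℤ)).comp (2 * Polynomial.X - 1)).natDegree < q + 1 := by
    have h2 : (2 * Polynomial.X - 1 : Polynomial ℝ).natDegree ≤ 1 := by compute_degree
    calc _ ≤ (Polynomial.Chebyshev.T ℝ (q : ℤ)).natDegree * _ := Polynomial.natDegree_comp_le
      _ ≤ q * 1 := by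
        rw [Polynomial.Chebyshev.natDegree_T]; exact Nat.mul_le_mul (by simp) h2
      _ < q + 1 := by omega
  have := Polynomial.eval_eq_sum_range' hd y
  simp only [Polynomial.eval_comp] at this
  simpa [chebCoeff] using this.symm

lemma chebCoeff_zero_le (q : ℕ) : chebCoeff q 0 ≤ 1 := by
  have h : chebCoeff q 0 = (Polynomial.Chebyshev.T ℝ (q : ℤ)).eval (-1) := by
    have := sum_chebCoeff_mul_pow q 0
    rw [Finset.sum_range_succ'] at this
    simpa using this
  rw [h]
  exact (abs_le.1 (Polynomial.Chebyshev.abs_eval_T_real_le_one q (by simp))).2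

/-- The coefficients alternate, so their absolute values sum to `|T_q (-3)| = T_q 3`, where
`3 = cosh (log (3 + 2√2))`. -/
lemma sum_abs_chebCoeff_le (q : ℕ) :
    ∑ j ∈ Finset.range (q + 1), |chebCoeff q j| ≤ (3 + 2 * √2) ^ q := by
  have h2 : (√2) ^ 2 = (2 : ℝ) := Real.sq_sqrt (by norm_num)
  have hs : 0 < 3 + 2 * √2 := by positivity
  have h1 : ∀ j, |chebCoeff q j| = (-1) ^ q * (chebCoeff q j * (-1) ^ j) := by
    intro j
    have h := (chebCoeff_alternating q j).1
    have e : (-1 : ℝ) ^ q * (chebCoeff q j * (-1) ^ j) = (-1) ^ (q + j) * chebCoeff q j := by ring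
    rw [e, ← abs_of_nonneg h, abs_mul]; simp
  have h3 : Real.cosh (Real.log (3 + 2 * √2)) = 3 := by
    have hi : (3 + 2 * √2)⁻¹ = 3 - 2 * √2 := by
      apply inv_eq_of_mul_eq_one_right
      nlinarith
    rw [Real.cosh_eq, Real.exp_neg, Real.exp_log hs, hi]; ring
  simp only [h1]
  rw [← Finset.mul_sum, sum_chebCoeff_mul_pow]
  have h4 : (2 * (-1) - 1 : ℝ) = -3 := by norm_num
  have h7 := Polynomial.Chebyshev.T_real_cosh (Real.log (3 + 2 * √2)) q
  rw [h3] at h7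
  rw [h4, Polynomial.Chebyshev.T_eval_neg, h7]
  have h5 : ((-1 : ℝ) ^ q) * (((q : ℤ).negOnePow : ℤ) * Real.cosh ((q : ℤ) * Real.log (3 + 2 * √2)))
      = Real.cosh ((q : ℤ) * Real.log (3 + 2 * √2)) := by
    rw [Int.negOnePow_def]
    simp only [zpow_natCast, Units.val_pow_eq_pow_val, Units.val_neg, Units.val_one]
    push_cast
    rw [← mul_assoc, ← mul_pow]; simp
  rw [h5, ← Real.exp_log (pow_pos hs q), Real.log_pow]
  have h6 : 0 ≤ ((q : ℤ) : ℝ) * Real.log (3 + 2 * √2) :=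
    mul_nonneg (by simp) (Real.log_nonneg (by linarith [Real.sqrt_nonneg 2]))
  rw [Real.cosh_eq]
  have := Real.exp_le_exp.2 (neg_le_self h6)
  push_cast at *
  linarith

lemma nat_mul_sinh_le_sinh (q : ℕ) {v : ℝ} (hv : 0 ≤ v) : q * Real.sinh v ≤ Real.sinh (q * v) := by
  induction q with
  | zero => simp
  | succ q ih =>
    push_cast
    rw [add_mul, add_mul, one_mul, one_mul, Real.sinh_add]
    have h1 := Real.one_le_cosh v
    have h2 := Real.one_le_cosh (q * v)
    have h3 : 0 ≤ Real.sinh v := Real.sinh_nonneg_iff.2 hv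
    have h4 : 0 ≤ Real.sinh (q * v) := Real.sinh_nonneg_iff.2 (by positivity)
    nlinarith

/-- With `t = sinh² v`, one has `T_q (1 + 2 t) = cosh (2 q v)`; the two bounds are the behaviour for
small and for large `q v`. -/
lemma le_eval_T_one_add (q : ℕ) {t : ℝ} (ht : 0 ≤ t) :
    1 + 2 * q ^ 2 * t ≤ (Polynomial.Chebyshev.T ℝ (q : ℤ)).eval (1 + 2 * t) ∧
      (1 + 2 * √t) ^ q / 2 ≤ (Polynomial.Chebyshev.T ℝ (q : ℤ)).eval (1 + 2 * t) := by
  set v := Real.arsinh √t with hv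
  have hv0 : 0 ≤ v := Real.arsinh_nonneg_iff.2 (Real.sqrt_nonneg t)
  have hs : Real.sinh v = √t := Real.sinh_arsinh _
  have hsq : Real.sinh v ^ 2 = t := by rw [hs, Real.sq_sqrt ht]
  have hc : 1 + 2 * t = Real.cosh (2 * v) := by
    rw [Real.cosh_two_mul, Real.cosh_sq, hsq]; ring
  have hT : (Polynomial.Chebyshev.T ℝ (q : ℤ)).eval (1 + 2 * t) = Real.cosh (2 * (q * v)) := by
    rw [hc, Polynomial.Chebyshev.T_real_cosh]; congr 1; push_cast; ring
  rw [hT]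
  constructor
  · rw [Real.cosh_two_mul, Real.cosh_sq, ← hsq]
    have h1 := nat_mul_sinh_le_sinh q hv0
    have h3 : 0 ≤ Real.sinh v := Real.sinh_nonneg_iff.2 hv0
    have : (q * Real.sinh v) ^ 2 ≤ Real.sinh (q * v) ^ 2 := by gcongr
    nlinarith
  · have h1 : 1 + 2 * √t ≤ Real.exp (2 * v) := by
      rw [two_mul v, Real.exp_add, ← hs, ← Real.cosh_add_sinh]
      have := Real.one_le_cosh v
      have h3 : 0 ≤ Real.sinh v := Real.sinh_nonneg_iff.2 hv0
      nlinarith [Real.cosh_sq v]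
    have h2 : (1 + 2 * √t) ^ q ≤ Real.exp (2 * v) ^ q := by gcongr
    rw [← Real.exp_nat_mul] at h2
    rw [Real.cosh_eq]
    have h3 : Real.exp (q * (2 * v)) = Real.exp (2 * (q * v)) := by congr 1; ring
    have := Real.exp_pos (-(2 * (q * v)))
    rw [h3] at h2
    linarith

end GOSC
end

noncomputable section
namespace GOSC
open MeasureTheory ProbabilityTheory

/-! ### The empirical Laplace transform and its noise -/

instance (n : ℕ) (θ : ℝ) (μ : Fin n → ℝ) : IsProbabilityMeasure (law n θ μ) := by
  unfold law; infer_instance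

lemma integral_exp_gaussian (m l c : ℝ) :
    Integrable (fun y => Real.exp (l * y + c)) (gaussianReal m 1) ∧
      ∫ y, Real.exp (l * y + c) ∂(gaussianReal m 1) = Real.exp (m * l + l ^ 2 / 2 + c) := by
  have h := congrFun (mgf_id_gaussianReal (μ := m) (v := 1)) l
  simp only [mgf, id] at h
  constructor
  · simp only [Real.exp_add]
    exact (integrable_exp_mul_gaussianReal l).mul_const _
  · simp only [Real.exp_add, integral_mul_const]
    rw [h, ← Real.exp_add, ← Real.exp_add, ← Real.exp_add]
    congr 1; push_cast; ring

/-- One summand of `etaHat`. -/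
def expTerm (l θ y : ℝ) : ℝ := Real.exp (l * (θ - y) - l ^ 2 / 2)

lemma integral_expTerm (l θ m : ℝ) :
    ∫ y, expTerm l θ y ∂(gaussianReal (θ + m) 1) = Real.exp (-(l * m)) := by
  have h := (integral_exp_gaussian (θ + m) (-l) (l * θ - l ^ 2 / 2)).2
  have e : ∀ y, expTerm l θ y = Real.exp (-l * y + (l * θ - l ^ 2 / 2)) := fun y => by
    unfold expTerm; congr 1; ring
  simp only [e]; rw [h]; congr 1; ring

lemma continuous_expTerm (l θ : ℝ) : Continuous (expTerm l θ) := by unfold expTerm; fun_prop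

lemma memLp_expTerm (l θ m : ℝ) : MemLp (expTerm l θ) 2 (gaussianReal (θ + m) 1) := by
  rw [memLp_two_iff_integrable_sq (continuous_expTerm l θ).aestronglyMeasurable]
  have h := (integral_exp_gaussian (θ + m) (-(2 * l)) (2 * (l * θ - l ^ 2 / 2))).1
  refine h.congr (Filter.Eventually.of_forall fun y => ?_)
  simp only [expTerm, ← Real.exp_nat_mul]; congr 1; push_cast; ring

lemma variance_expTerm_le (l θ : ℝ) (hl : 0 ≤ l) {m : ℝ} (hm : 0 ≤ m) :
    Var[expTerm l θ; gaussianReal (θ + m) 1] ≤ Real.exp (l ^ 2) := by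
  refine (variance_le_expectation_sq (continuous_expTerm l θ).aestronglyMeasurable).trans ?_
  have h := (integral_exp_gaussian (θ + m) (-(2 * l)) (2 * (l * θ - l ^ 2 / 2))).2
  have e : ∀ y, expTerm l θ y ^ 2 = Real.exp (-(2 * l) * y + 2 * (l * θ - l ^ 2 / 2)) := fun y => by
    simp only [expTerm, ← Real.exp_nat_mul]; congr 1; push_cast; ring
  simp only [Pi.pow_apply, e]
  rw [h, Real.exp_le_exp]
  nlinarith [mul_nonneg hl hm]

/-- The expectation of `etaHat n l θ` under `law n θ μ`. -/
def etaMean (n : ℕ) (l : ℝ) (μ : Fin n → ℝ) : ℝ := (n : ℝ)⁻¹ * ∑ i, Real.exp (-(l * μ i))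

/-- A sum of independent square integrable variables, one per coordinate of a product space, has
mean square deviation equal to the sum of the variances. -/
lemma integral_sq_sum_sub {n : ℕ} {Ω : Type*} [MeasurableSpace Ω] (P : Fin n → Measure Ω)
    [∀ i, IsProbabilityMeasure (P i)] (f : Fin n → Ω → ℝ) (hf : ∀ i, MemLp (f i) 2 (P i)) :
    Integrable (fun ω => (∑ i, f i (ω i) - ∑ i, ∫ x, f i x ∂(P i)) ^ 2) (Measure.pi P) ∧
      ∫ ω, (∑ i, f i (ω i) - ∑ i, ∫ x, f i x ∂(P i)) ^ 2 ∂(Measure.pi P)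
        = ∑ i, Var[f i; P i] := by
  have hi : ∀ i, MemLp (fun ω : Fin n → Ω => f i (ω i)) 2 (Measure.pi P) := fun i =>
    (hf i).comp_measurePreserving (measurePreserving_eval P i)
  have hm : ∫ ω, (∑ i, fun ω : Fin n → Ω => f i (ω i)) ω ∂(Measure.pi P)
      = ∑ i, ∫ x, f i x ∂(P i) := by
    simp only [Finset.sum_apply]
    rw [integral_finsetSum _ fun i _ => (hi i).integrable (by norm_num)]
    refine Finset.sum_congr rfl fun i _ => ?_
    rw [← (measurePreserving_eval P i).map_eq, integral_map (measurable_pi_apply i).aemeasurable]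
    rw [(measurePreserving_eval P i).map_eq]; exact (hf i).aestronglyMeasurable
  have hs : MemLp (∑ i, fun ω : Fin n → Ω => f i (ω i)) 2 (Measure.pi P) :=
    memLp_finsetSum' _ fun i _ => hi i
  have h := variance_sum_pi hf
  rw [variance_eq_integral hs.aestronglyMeasurable.aemeasurable, hm] at h
  simp only [Finset.sum_apply] at h
  refine ⟨?_, h⟩
  have := (hs.sub (memLp_const (∑ i, ∫ x, f i x ∂(P i)))).integrable_sq
  simpa [Finset.sum_apply] using this

lemma integral_etaHat_sub_sq {n : ℕ} (hn : 0 < n) {l θ : ℝ} (hl : 0 ≤ l) {μ : Fin n → ℝ}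
    (hμ : ∀ i, 0 ≤ μ i) :
    Integrable (fun Y => (etaHat n l θ Y - etaMean n l μ) ^ 2) (law n θ μ) ∧
      ∫ Y, (etaHat n l θ Y - etaMean n l μ) ^ 2 ∂(law n θ μ) ≤ Real.exp (l ^ 2) / n := by
  obtain ⟨h1, h2⟩ := integral_sq_sum_sub (fun i => gaussianReal (θ + μ i) 1)
    (fun _ => expTerm l θ) fun i => memLp_expTerm l θ (μ i)
  simp only [integral_expTerm] at h1 h2
  have e : ∀ Y : Fin n → ℝ, (etaHat n l θ Y - etaMean n l μ) ^ 2 =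
      ((n : ℝ)⁻¹) ^ 2 * (∑ i, expTerm l θ (Y i) - ∑ i, Real.exp (-(l * μ i))) ^ 2 := fun Y => by
    simp only [etaHat, etaMean, expTerm]; ring
  simp only [e]
  refine ⟨h1.const_mul _, ?_⟩
  rw [integral_const_mul]
  unfold law
  rw [h2]
  have h3 : ∑ i, Var[expTerm l θ; gaussianReal (θ + μ i) 1] ≤ n * Real.exp (l ^ 2) := by
    refine (Finset.sum_le_sum fun i _ => variance_expTerm_le l θ hl (hμ i)).trans ?_
    simp
  have hn' : (0 : ℝ) < n := by exact_mod_cast hn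
  calc _ ≤ ((n : ℝ)⁻¹) ^ 2 * (n * Real.exp (l ^ 2)) := by gcongr
    _ = _ := by field_simp

/-- The stochastic error of `psiHat` at `θ`, measured coefficient by coefficient: it controls the
error of `psiHat` at all points simultaneously. -/
def noise (n q : ℕ) (θ : ℝ) (μ : Fin n → ℝ) (Y : Fin n → ℝ) : ℝ :=
  ∑ j ∈ Finset.range (q + 1), |chebCoeff q j| *
    |etaHat n (j * lam q) θ Y - etaMean n (j * lam q) μ|

/-- `e^{a q} / √n`, the threshold for the excess of `psiHat` over `1`. -/
def thr (n q : ℕ) : ℝ := Real.exp (a * q) / √(n : ℝ)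

lemma continuous_etaHat (n : ℕ) (l θ : ℝ) : Continuous (etaHat n l θ) := by
  unfold etaHat; fun_prop

lemma measurable_noise (n q : ℕ) (θ : ℝ) (μ : Fin n → ℝ) : Measurable (noise n q θ μ) := by
  unfold noise
  refine Finset.measurable_fun_sum _ fun j _ => ?_
  have := (continuous_etaHat n (j * lam q) θ).measurable
  exact ((this.sub_const _).abs).const_mul _

lemma lam_sq {q : ℕ} (hq : 0 < q) {j : ℕ} (hj : j ≤ q) : (j * lam q) ^ 2 ≤ 2 * (q : ℝ) := by
  have hq' : (0 : ℝ) < q := by exact_mod_cast hq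
  have hj' : (j : ℝ) ≤ q := by exact_mod_cast hj
  rw [mul_pow, lam, Real.sq_sqrt (by positivity)]
  calc (j : ℝ) ^ 2 * (2 / q) ≤ (q : ℝ) ^ 2 * (2 / q) := by gcongr
    _ = 2 * (q : ℝ) := by field_simp

/-- The constant `a` is chosen so that `e ^ (a q)` is the cube of `√n` times the size of the noise: the factor
`(3 + 2√2) ^ q` bounds the coefficients, and `e ^ q / √n` the standard deviations of the averages. -/
lemma exp_a_mul (q : ℕ) : Real.exp (a * q) = (((3 + 2 * √2) ^ q * Real.exp q) ^ 3) := by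
  have hs : 0 < 3 + 2 * √2 := by positivity
  rw [← Real.exp_log (pow_pos hs q), ← Real.exp_add, ← Real.exp_nat_mul, Real.log_pow, a]
  congr 1; push_cast; ring

/-- Cauchy–Schwarz with the weights `|chebCoeff q j|`, and then Markov's inequality for the weighted
sum of squares. By `exp_a_mul`, the threshold exceeds the size `e ^ (a q / 3) / √n` of the noise by
the factor `e ^ (2 a q / 3)`. -/
lemma noise_tail {n q : ℕ} (hn : 0 < n) (hq : 0 < q) (θ : ℝ) {μ : Fin n → ℝ}
    (hμ : ∀ i, 0 ≤ μ i) :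
    (law n θ μ).real {Y | thr n q < noise n q θ μ Y} ≤ Real.exp (-(4 * a * q / 3)) := by
  have hn' : (0 : ℝ) < n := by exact_mod_cast hn
  set B : ℝ := (3 + 2 * √2) ^ q with hB
  have hB0 : 0 < B := by positivity
  have hi := fun j : ℕ => integral_etaHat_sub_sq (l := j * lam q) (θ := θ) hn
    (by unfold lam; positivity) hμ
  set W : (Fin n → ℝ) → ℝ := fun Y => ∑ j ∈ Finset.range (q + 1), |chebCoeff q j| *
    (etaHat n (j * lam q) θ Y - etaMean n (j * lam q) μ) ^ 2 with hW
  have hWi : Integrable W (law n θ μ) := integrable_finsetSum _ fun j _ => (hi j).1.const_mul _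
  have hW0 : ∀ Y, 0 ≤ W Y := fun Y => Finset.sum_nonneg fun _ _ => by positivity
  have hWb : ∫ Y, W Y ∂(law n θ μ) ≤ B * (Real.exp (2 * q) / n) := by
    rw [integral_finsetSum _ fun j _ => (hi j).1.const_mul _]
    calc _ ≤ ∑ j ∈ Finset.range (q + 1), |chebCoeff q j| * (Real.exp (2 * q) / n) := by
          refine Finset.sum_le_sum fun j hj => ?_
          rw [integral_const_mul]
          refine mul_le_mul_of_nonneg_left ((hi j).2.trans ?_) (abs_nonneg _)
          gcongr
          exact lam_sq hq (by have := Finset.mem_range.1 hj; omega)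
      _ ≤ _ := by
          rw [← Finset.sum_mul]
          gcongr
          exact sum_abs_chebCoeff_le q
  -- the Cauchy–Schwarz step
  have hsq : ∀ Y, noise n q θ μ Y ^ 2 ≤ B * W Y := by
    intro Y
    have h := Finset.sum_sq_le_sum_mul_sum_of_sq_le_mul (Finset.range (q + 1))
      (r := fun j => |chebCoeff q j| * |etaHat n (j * lam q) θ Y - etaMean n (j * lam q) μ|)
      (f := fun j => |chebCoeff q j|)
      (g := fun j => |chebCoeff q j| * (etaHat n (j * lam q) θ Y - etaMean n (j * lam q) μ) ^ 2)
      (fun _ _ => abs_nonneg _) (fun _ _ => by positivity)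
      (fun j _ => by rw [mul_pow, sq_abs (etaHat n _ θ Y - _)]; exact le_of_eq (by ring))
    refine h.trans ?_
    exact mul_le_mul_of_nonneg_right (sum_abs_chebCoeff_le q) (hW0 Y)
  have hthr : 0 < thr n q := by unfold thr; positivity
  have hsub : {Y | thr n q < noise n q θ μ Y} ⊆ {Y | thr n q ^ 2 / B ≤ W Y} := by
    intro Y hY
    simp only [Set.mem_ofPred_eq] at hY ⊢
    rw [div_le_iff₀ hB0]
    have : thr n q ^ 2 ≤ noise n q θ μ Y ^ 2 := by gcongr
    linarith [hsq Y]
  have hmk := mul_meas_ge_le_integral_of_nonneg (μ := law n θ μ)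
    (Filter.Eventually.of_forall hW0) hWi (thr n q ^ 2 / B)
  have h1 := measureReal_mono (μ := law n θ μ) hsub
  set p := (law n θ μ).real {Y | thr n q ^ 2 / B ≤ W Y}
  have h2 : thr n q ^ 2 / B * p ≤ B * (Real.exp (2 * q) / n) := hmk.trans hWb
  refine h1.trans ?_
  -- in terms of `B = (3 + 2√2) ^ q` and `E = e ^ q`, the claim is `p ≤ (B E) ^ (-4)`
  set E := Real.exp q with hE
  have hE0 : 0 < E := Real.exp_pos _
  have h3 : thr n q ^ 2 = (B * E) ^ 6 / n := by
    rw [thr, div_pow, Real.sq_sqrt hn'.le, exp_a_mul]; ring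
  have h4 : Real.exp (2 * q) = E ^ 2 := by rw [hE, ← Real.exp_nat_mul]; push_cast; rfl
  have h5 : Real.exp (-(4 * a * q / 3)) = ((B * E) ^ 4)⁻¹ := by
    have : Real.exp (a * q / 3) = B * E := by
      have h6 : (Real.exp (a * q / 3)) ^ 3 = (B * E) ^ 3 := by
        rw [← Real.exp_nat_mul, hB, hE, ← exp_a_mul]; congr 1; push_cast; ring
      exact (pow_left_inj₀ (Real.exp_pos _).le (by positivity) (by norm_num)).1 h6
    rw [← this, ← Real.exp_nat_mul, ← Real.exp_neg]; congr 1; push_cast; ring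
  rw [h5]
  rw [h3, h4] at h2
  rw [← one_div, le_div_iff₀ (by positivity)]
  have h7 : (B * E) ^ 6 / n / B * p = p * (B * E) ^ 4 * (B * E ^ 2 / n) := by
    field_simp
  rw [h7] at h2
  have h8 : B * (E ^ 2 / n) = 1 * (B * E ^ 2 / n) := by ring
  rw [h8] at h2
  exact le_of_mul_le_mul_right h2 (by positivity)

end GOSC
end

noncomputable section
namespace GOSC
open MeasureTheory ProbabilityTheory

/-! ### The crossing points of `psiHat` -/

lemma etaHat_shift (n : ℕ) (l u θ : ℝ) (Y : Fin n → ℝ) :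
    etaHat n l u Y = Real.exp (l * (u - θ)) * etaHat n l θ Y := by
  unfold etaHat
  rw [mul_left_comm]
  congr 1
  rw [Finset.mul_sum]
  refine Finset.sum_congr rfl fun i _ => ?_
  rw [← Real.exp_add]
  congr 1; ring

/-- The expectation of `psiHat n q (lam q) u`. -/
def psiMean (n q : ℕ) (u θ : ℝ) (μ : Fin n → ℝ) : ℝ :=
  ∑ j ∈ Finset.range (q + 1),
    chebCoeff q j * (Real.exp (j * lam q * (u - θ)) * etaMean n (j * lam q) μ)

lemma psiMean_eq (n q : ℕ) (u θ : ℝ) (μ : Fin n → ℝ) :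
    psiMean n q u θ μ = (n : ℝ)⁻¹ * ∑ i, (Polynomial.Chebyshev.T ℝ (q : ℤ)).eval
      (2 * Real.exp (lam q * (u - θ - μ i)) - 1) := by
  simp only [← sum_chebCoeff_mul_pow, psiMean, etaMean]
  rw [Finset.sum_comm]
  simp only [Finset.mul_sum]
  refine Finset.sum_congr rfl fun j _ => Finset.sum_congr rfl fun i _ => ?_
  rw [← Real.exp_nat_mul]
  have : Real.exp (j * (lam q * (u - θ - μ i))) =
    Real.exp (j * lam q * (u - θ)) * Real.exp (-(j * lam q * μ i)) := by
    rw [← Real.exp_add]; congr 1; ring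
  rw [this]; ring

lemma lam_nonneg (q : ℕ) : 0 ≤ lam q := Real.sqrt_nonneg _

/-- As `u` enters `etaHat` only through a deterministic factor, the error at `θ` controls the error
at every `u`. -/
lemma abs_psiHat_sub_psiMean_le {n q : ℕ} (u θ : ℝ) (μ Y : Fin n → ℝ) {d : ℝ} (hd : 0 ≤ d)
    (hud : u - θ ≤ d) :
    |psiHat n q (lam q) u Y - psiMean n q u θ μ| ≤ Real.exp (q * lam q * d) * noise n q θ μ Y := by
  unfold psiHat psiMean noise
  rw [← Finset.sum_sub_distrib, Finset.mul_sum]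
  refine (Finset.abs_sum_le_sum_abs _ _).trans (Finset.sum_le_sum fun j hj => ?_)
  rw [etaHat_shift n _ u θ, ← mul_sub, ← mul_sub, abs_mul, abs_mul, Real.abs_exp]
  have hj : (j : ℝ) ≤ q := by
    have := Finset.mem_range.1 hj
    exact_mod_cast (by omega : j ≤ q)
  have h0 := lam_nonneg q
  have : Real.exp (j * lam q * (u - θ)) ≤ Real.exp (q * lam q * d) := by
    rw [Real.exp_le_exp]
    calc j * lam q * (u - θ) ≤ j * lam q * d := by gcongr
      _ ≤ q * lam q * d := by gcongr
  rw [mul_left_comm]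
  gcongr

lemma psiMean_le_one {n : ℕ} (q : ℕ) {u θ : ℝ} (hu : u ≤ θ) {μ : Fin n → ℝ} (hμ : ∀ i, 0 ≤ μ i) :
    psiMean n q u θ μ ≤ 1 := by
  rw [psiMean_eq]
  have h : ∀ i, (Polynomial.Chebyshev.T ℝ (q : ℤ)).eval
      (2 * Real.exp (lam q * (u - θ - μ i)) - 1) ≤ 1 := by
    intro i
    have h1 : Real.exp (lam q * (u - θ - μ i)) ≤ 1 := by
      rw [Real.exp_le_one_iff]
      exact mul_nonpos_of_nonneg_of_nonpos (lam_nonneg q) (by linarith [hμ i])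
    have h2 := Real.exp_pos (lam q * (u - θ - μ i))
    exact (abs_le.1 (Polynomial.Chebyshev.abs_eval_T_real_le_one q
      (abs_le.2 ⟨by linarith, by linarith⟩))).2
  rw [inv_mul_eq_div]
  refine div_le_one_of_le₀ ((Finset.sum_le_sum fun i _ => h i).trans ?_) (by positivity)
  simp

/-- The uncontaminated observations contribute `T_q` at a point above `1`, the others at least
`-1`. -/
lemma le_psiMean {n k : ℕ} (q : ℕ) {d θ : ℝ} (hn : 0 < n) (hd : 0 ≤ d) {μ : Fin n → ℝ}
    (hμ : μ ∈ sparse n k) :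
    ((n : ℝ) - k) / n * (Polynomial.Chebyshev.T ℝ (q : ℤ)).eval (2 * Real.exp (lam q * d) - 1)
      - k / n ≤ psiMean n q (θ + d) θ μ := by
  rw [psiMean_eq]
  set Tv := (Polynomial.Chebyshev.T ℝ (q : ℤ)).eval (2 * Real.exp (lam q * d) - 1) with hTv
  have hn' : (0 : ℝ) < n := by exact_mod_cast hn
  have hT1 : 1 ≤ Tv := by
    refine Polynomial.Chebyshev.one_le_eval_T_real _ ?_
    have := Real.one_le_exp (mul_nonneg (lam_nonneg q) hd)
    linarith
  have h : ∀ i, (if μ i ≠ 0 then -1 - Tv else 0) + Tv ≤ (Polynomial.Chebyshev.T ℝ (q : ℤ)).eval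
      (2 * Real.exp (lam q * (θ + d - θ - μ i)) - 1) := by
    intro i
    split_ifs with h0
    · have h2 := Real.exp_pos (lam q * (θ + d - θ - μ i))
      rcases le_total (2 * Real.exp (lam q * (θ + d - θ - μ i)) - 1) 1 with h3 | h3
      · have := (abs_le.1 (Polynomial.Chebyshev.abs_eval_T_real_le_one q
          (abs_le.2 ⟨by linarith, h3⟩))).1
        linarith
      · have := Polynomial.Chebyshev.one_le_eval_T_real q h3
        linarith
    · push Not at h0
      rw [h0, hTv]; simp
  have hsum := Finset.sum_le_sum fun i (_ : i ∈ Finset.univ) => h i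
  rw [Finset.sum_add_distrib, ← Finset.sum_filter, Finset.sum_const, Finset.sum_const] at hsum
  simp only [nsmul_eq_mul, Finset.card_univ, Fintype.card_fin] at hsum
  have hc : (((Finset.univ.filter fun i => μ i ≠ 0).card : ℕ) : ℝ) ≤ k := by exact_mod_cast hμ.2
  rw [inv_mul_eq_div, le_div_iff₀ hn']
  refine le_trans ?_ hsum
  have e : (((n : ℝ) - k) / n * Tv - k / n) * n = (n - k) * Tv - k := by field_simp
  rw [e]
  nlinarith

/-- The noise being below the threshold, no point to the left of `θ` is a crossing, and `θ + d` is
one as soon as the expected excess there is large enough. -/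
lemma thetaCheb_mem_Icc {n k q : ℕ} {θ d : ℝ} (hn : 0 < n) (hd : 0 ≤ d) {μ Y : Fin n → ℝ}
    (hμ : μ ∈ sparse n k) (hnoise : noise n q θ μ Y ≤ thr n q)
    (hlow : thetaLow n q Y ≤ ((θ + d : ℝ) : EReal)) (hup : θ + d ≤ thetaUp n Y)
    (hT : 1 + thr n q * (1 + Real.exp (q * lam q * d)) <
      ((n : ℝ) - k) / n * (Polynomial.Chebyshev.T ℝ (q : ℤ)).eval (2 * Real.exp (lam q * d) - 1)
      - k / n) :
    θ ≤ thetaCheb n q Y ∧ thetaCheb n q Y ≤ θ + d := by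
  have hcross : ∀ u ∈ crossing n q Y, θ ≤ u := by
    intro u hu
    by_contra! hlt
    have h1 := abs_le.1 (abs_psiHat_sub_psiMean_le (q := q) u θ μ Y le_rfl (by linarith))
    have h2 := psiMean_le_one q hlt.le hμ.1
    have h3 := hu.2.2
    rw [mul_zero, Real.exp_zero, one_mul] at h1
    unfold thr at hnoise
    linarith [h1.2]
  have hmem : θ + d ∈ crossing n q Y := by
    refine ⟨hlow, hup, ?_⟩
    have h1 := abs_le.1 (abs_psiHat_sub_psiMean_le (q := q) (θ + d) θ μ Y hd (by linarith))
    have h2 := le_psiMean q (θ := θ) hn hd hμ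
    have h3 := mul_le_mul_of_nonneg_left hnoise (Real.exp_pos (q * lam q * d)).le
    change 1 + thr n q < _
    linarith [h1.1]
  rw [thetaCheb, if_pos ⟨_, hmem⟩]
  exact ⟨le_csInf ⟨_, hmem⟩ hcross, csInf_le ⟨θ, hcross⟩ hmem⟩

/-! ### Selection -/

/-- The index `qmax n + 2` always qualifies, so the selected index has the defining property and is
minimal with it. -/
lemma qHat_spec (n : ℕ) (Y : Fin n → ℝ) (hq : Even (qmax n)) :
    Even (qHat n Y) ∧ qHat n Y ≤ qmax n + 2 ∧
    (∀ q' : ℕ, Even q' → qHat n Y < q' → q' ≤ qmax n + 2 →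
      |candidate n (qHat n Y) Y - candidate n q' Y| ≤ delta n q') ∧
    ∀ q : ℕ, Even q → q ≤ qmax n + 2 → (∀ q' : ℕ, Even q' → q < q' → q' ≤ qmax n + 2 →
      |candidate n q Y - candidate n q' Y| ≤ delta n q') → qHat n Y ≤ q := by
  have hne : {q : ℕ | Even q ∧ q ≤ qmax n + 2 ∧
    ∀ q' : ℕ, Even q' → q < q' → q' ≤ qmax n + 2 →
      |candidate n q Y - candidate n q' Y| ≤ delta n q'}.Nonempty :=
    ⟨qmax n + 2, by simpa [parity_simps] using hq, le_rfl, fun q' _ h1 h2 => absurd h1 (by omega)⟩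
  have h := Nat.sInf_mem hne
  exact ⟨h.1, h.2.1, h.2.2, fun q h1 h2 h3 => Nat.sInf_le ⟨h1, h2, h3⟩⟩

lemma floorEven_even (x : ℝ) : Even (floorEven x) := by simp [floorEven]

lemma qmax_even (n : ℕ) : Even (qmax n) := by
  unfold qmax
  rcases floorEven_even (1 / (2 * a) * Real.log n) with ⟨m, hm⟩
  exact ⟨m - 1, by omega⟩

/-- If the errors of all candidates from `Q` on are under control, then `Q` qualifies for the
selection. The selected index is therefore at most `Q`, and its candidate has passed the comparison
with the candidate `Q`. -/
lemma abs_thetaAd_sub_le {n Q : ℕ} {θ : ℝ} {Y : Fin n → ℝ} (hQe : Even Q) (hQ : Q ≤ qmax n + 2)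
    (e : ℕ → ℝ) (hδ : 0 ≤ delta n Q)
    (herr : ∀ q', Even q' → Q ≤ q' → q' ≤ qmax n + 2 → |candidate n q' Y - θ| ≤ e q')
    (hde : ∀ q', Even q' → Q < q' → q' ≤ qmax n + 2 → e Q + e q' ≤ delta n q') :
    |thetaAd n Y - θ| ≤ delta n Q + e Q := by
  obtain ⟨h1, h2, h3, h4⟩ := qHat_spec n Y (qmax_even n)
  have h5 : qHat n Y ≤ Q := by
    refine h4 Q hQe hQ fun q' a1 a2 a3 => ?_
    have b1 := abs_le.1 (herr Q hQe le_rfl hQ)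
    have b2 := abs_le.1 (herr q' a1 a2.le a3)
    have b3 := hde q' a1 a2 a3
    exact abs_le.2 ⟨by linarith [b1.1, b2.2], by linarith [b1.2, b2.1]⟩
  have h6 := abs_le.1 (herr Q hQe le_rfl hQ)
  rcases h5.eq_or_lt with h | h
  · rw [thetaAd, h]
    linarith [herr Q hQe le_rfl hQ]
  · have h7 := abs_le.1 (h3 Q hQe h hQ)
    rw [thetaAd]
    exact abs_le.2 ⟨by linarith [h6.1, h7.1], by linarith [h6.2, h7.2]⟩

/-- The selected candidate is always compared with the last one. This bounds the error even where
nothing else is known. -/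
lemma abs_thetaAd_sub_thetaMin_le {n : ℕ} (Y : Fin n → ℝ) :
    |thetaAd n Y - thetaMin n Y| ≤ 4 * √(2 * Real.log n) := by
  obtain ⟨h1, h2, h3, -⟩ := qHat_spec n Y (qmax_even n)
  have hc : candidate n (qmax n + 2) Y = thetaMin n Y := by simp [candidate]
  have hd : delta n (qmax n + 2) = 4 * √(2 * Real.log n) := by simp [delta]
  rcases h2.eq_or_lt with h | h
  · rw [thetaAd, h, hc]; simp
  · rw [← hc, ← hd]
    exact h3 _ (by simpa [parity_simps] using qmax_even n) h le_rfl

end GOSC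
end

noncomputable section
namespace GOSC
open MeasureTheory ProbabilityTheory

/-! ### Order statistics and measurability -/

/-- The set in the definition of `orderStat` is closed and bounded below, so that its infimum is
attained. -/
lemma orderStat_le_iff {n r : ℕ} (Y : Fin n → ℝ) (h1 : 1 ≤ r) (hr : r ≤ n) (t : ℝ) :
    orderStat Y r ≤ t ↔ r ≤ (Finset.univ.filter fun i => Y i ≤ t).card := by
  set S : Set ℝ := {t : ℝ | r ≤ (Finset.univ.filter fun i => Y i ≤ t).card} with hS
  have hne : S.Nonempty := by
    refine ⟨∑ i, |Y i|, ?_⟩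
    have : (Finset.univ.filter fun i => Y i ≤ ∑ i, |Y i|) = Finset.univ := by
      refine Finset.filter_true_of_mem fun i _ => (le_abs_self _).trans ?_
      exact Finset.single_le_sum (f := fun i => |Y i|) (fun _ _ => abs_nonneg _) (Finset.mem_univ i)
    simpa [hS, this] using hr
  have hbdd : BddBelow S := by
    refine ⟨-∑ i, |Y i|, fun t ht => ?_⟩
    have hpos : 0 < (Finset.univ.filter fun i => Y i ≤ t).card := lt_of_lt_of_le h1 ht
    obtain ⟨i, hi⟩ := Finset.card_pos.1 hpos
    have h2 := Finset.single_le_sum (f := fun i => |Y i|) (fun _ _ => abs_nonneg _)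
      (Finset.mem_univ i)
    have h3 := neg_abs_le (Y i)
    have h4 := (Finset.mem_filter.1 hi).2
    linarith
  have hcl : IsClosed S := by
    have : S = ⋃ A ∈ Finset.univ.filter (fun A : Finset (Fin n) => r ≤ A.card),
        ⋂ i ∈ A, Set.Ici (Y i) := by
      ext t
      simp only [hS, Set.mem_ofPred_eq, Finset.mem_filter, Finset.mem_univ, true_and,
        Set.mem_iUnion, Set.mem_iInter, Set.mem_Ici, exists_prop]
      constructor
      · intro h
        exact ⟨_, h, fun i hi => (Finset.mem_filter.1 hi).2⟩
      · rintro ⟨A, hA, h⟩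
        exact hA.trans (Finset.card_le_card fun i hi =>
          Finset.mem_filter.2 ⟨Finset.mem_univ i, h i hi⟩)
    rw [this]
    exact isClosed_biUnion_finset fun A _ => isClosed_biInter fun i _ => isClosed_Ici
  constructor
  · intro h
    have h0 : orderStat Y r ∈ S := hcl.csInf_mem hne hbdd
    exact le_trans h0 (Finset.card_le_card (Finset.monotone_filter_right _ fun i _ hi => hi.trans h))
  · intro h
    exact csInf_le hbdd h

lemma orderStat_one_le_iff {n : ℕ} (Y : Fin n → ℝ) (hn : 1 ≤ n) (t : ℝ) :
    orderStat Y 1 ≤ t ↔ ∃ i, Y i ≤ t := by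
  rw [orderStat_le_iff Y le_rfl hn, Nat.succ_le_iff, Finset.card_pos]
  simp [Finset.Nonempty]

lemma measurable_orderStat {n r : ℕ} (h1 : 1 ≤ r) (hr : r ≤ n) :
    Measurable fun Y : Fin n → ℝ => orderStat Y r := by
  refine measurable_of_Iic fun t => ?_
  have : (fun Y : Fin n → ℝ => orderStat Y r) ⁻¹' Set.Iic t =
      {Y | r ≤ ∑ i, if Y i ≤ t then 1 else 0} := by
    ext Y
    simp [orderStat_le_iff Y h1 hr]
  rw [this]
  refine measurableSet_le measurable_const (Finset.measurable_fun_sum _ fun i _ => ?_)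
  exact Measurable.ite (measurableSet_le (measurable_pi_apply i) measurable_const)
    measurable_const measurable_const

lemma ceil_half_mem {n : ℕ} (hn : 1 ≤ n) : 1 ≤ ⌈(n : ℝ) / 2⌉₊ ∧ ⌈(n : ℝ) / 2⌉₊ ≤ n := by
  have hn' : (1 : ℝ) ≤ n := by exact_mod_cast hn
  exact ⟨Nat.one_le_ceil_iff.2 (by positivity), Nat.ceil_le.2 (by linarith)⟩

lemma measurable_thetaMed {n : ℕ} (hn : 1 ≤ n) : Measurable (thetaMed n) :=
  measurable_orderStat (ceil_half_mem hn).1 (ceil_half_mem hn).2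

lemma measurable_thetaUp {n : ℕ} (hn : 1 ≤ n) : Measurable (thetaUp n) :=
  (measurable_orderStat le_rfl hn).add_const _

lemma measurable_thetaMin {n : ℕ} (hn : 1 ≤ n) : Measurable (thetaMin n) :=
  (measurable_orderStat le_rfl hn).add_const _

lemma measurable_thetaLow {n : ℕ} (hn : 1 ≤ n) (q : ℕ) : Measurable (thetaLow n q) := by
  unfold thetaLow
  split_ifs
  · exact ((measurable_thetaMed hn).sub_const _).coe_real_ereal
  · exact measurable_const

lemma measurable_psiHat {n : ℕ} (q : ℕ) (l : ℝ) {w : (Fin n → ℝ) → ℝ} (hw : Measurable w) :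
    Measurable fun Y => psiHat n q l (w Y) Y := by
  unfold psiHat etaHat
  fun_prop

lemma continuous_psiHat {n : ℕ} (q : ℕ) (l : ℝ) (Y : Fin n → ℝ) :
    Continuous fun u => psiHat n q l u Y := by
  unfold psiHat etaHat
  fun_prop

lemma tendsto_psiHat_atBot {n : ℕ} (hn : 1 ≤ n) (q : ℕ) {l : ℝ} (hl : 0 < l) (Y : Fin n → ℝ) :
    Filter.Tendsto (fun u => psiHat n q l u Y) Filter.atBot (nhds (chebCoeff q 0)) := by
  have hn' : (n : ℝ) ≠ 0 := by positivity
  have h0 : chebCoeff q 0 = ∑ j ∈ Finset.range (q + 1), chebCoeff q j * if j = 0 then 1 else 0 := by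
    simp
  rw [h0]
  refine tendsto_finsetSum _ fun j _ => Filter.Tendsto.const_mul _ ?_
  split_ifs with hj
  · subst hj
    have e : ∀ u, etaHat n ((0 : ℕ) * l) u Y = 1 := fun u => by
      unfold etaHat
      simp only [Nat.cast_zero, zero_mul, Real.exp_zero, ne_eq, OfNat.ofNat_ne_zero,
        not_false_eq_true, zero_pow, zero_div, sub_zero, Finset.sum_const, Finset.card_univ,
        Fintype.card_fin, nsmul_eq_mul, mul_one]
      exact inv_mul_cancel₀ hn'
    simp only [e]
    exact tendsto_const_nhds
  · have e : ∀ u, etaHat n (j * l) u Y = Real.exp (j * l * u) * etaHat n (j * l) 0 Y := fun u => by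
      rw [etaHat_shift n _ u 0, sub_zero]
    refine (Filter.tendsto_congr e).2 ?_
    suffices h : Filter.Tendsto (fun u => Real.exp (j * l * u)) Filter.atBot (nhds 0) by
      simpa using h.mul_const (etaHat n (j * l) 0 Y)
    refine Real.tendsto_exp_atBot.comp ?_
    have : 0 < (j : ℝ) * l := by positivity
    exact Filter.tendsto_id.const_mul_atBot this

/-- At `-∞` the function `psiHat` tends to `chebCoeff q 0 ≤ 1`, which is below the threshold. Hence the
infimum that defines `thetaCheb` is a genuine one. -/
lemma bddBelow_crossing {n q : ℕ} (hn : 1 ≤ n) (hq : 0 < q) (Y : Fin n → ℝ) :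
    BddBelow (crossing n q Y) := by
  have hl : 0 < lam q := by unfold lam; positivity
  have hlt : chebCoeff q 0 < 1 + Real.exp (a * q) / √(n : ℝ) := by
    have : 0 < Real.exp (a * q) / √(n : ℝ) := by positivity
    linarith [chebCoeff_zero_le q]
  obtain ⟨b, hb⟩ := Filter.eventually_atBot.1
    ((tendsto_psiHat_atBot hn q hl Y).eventually_lt_const hlt)
  refine ⟨b, fun u hu => ?_⟩
  by_contra! h
  exact lt_asymm (hb u h.le) hu.2.2

/-- By continuity, a crossing below `c` can be moved to a rational one, unless it is an endpoint of the
interval. -/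
lemma measurableSet_exists_crossing_lt {n : ℕ} (hn : 1 ≤ n) (q : ℕ) (c : ℝ) :
    MeasurableSet {Y : Fin n → ℝ | ∃ u ∈ crossing n q Y, u < c} := by
  have hw : ∀ w : (Fin n → ℝ) → ℝ, Measurable w →
      MeasurableSet {Y : Fin n → ℝ | w Y ∈ crossing n q Y ∧ w Y < c} := by
    intro w hw
    refine MeasurableSet.inter (MeasurableSet.inter ?_ (MeasurableSet.inter ?_ ?_)) ?_
    · exact measurableSet_le (measurable_thetaLow hn q) hw.coe_real_ereal
    · exact measurableSet_le hw (measurable_thetaUp hn)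
    · exact measurableSet_lt measurable_const (measurable_psiHat q _ hw)
    · exact measurableSet_lt hw measurable_const
  have : {Y : Fin n → ℝ | ∃ u ∈ crossing n q Y, u < c} =
      (⋃ r : ℚ, {Y : Fin n → ℝ | (r : ℝ) ∈ crossing n q Y ∧ (r : ℝ) < c}) ∪
      ({Y : Fin n → ℝ | thetaUp n Y ∈ crossing n q Y ∧ thetaUp n Y < c} ∪
       {Y : Fin n → ℝ | (thetaLow n q Y).toReal ∈ crossing n q Y ∧ (thetaLow n q Y).toReal < c}) := by
    ext Y
    simp only [Set.mem_union, Set.mem_iUnion, Set.mem_ofPred_eq]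
    constructor
    · rintro ⟨u, hu, huc⟩
      rcases hu.1.eq_or_lt with h | h
      · right; right; rw [h]; exact ⟨hu, huc⟩
      rcases hu.2.1.eq_or_lt with h' | h'
      · right; left; rw [← h']; exact ⟨hu, huc⟩
      left
      have hopen : IsOpen {v : ℝ | thetaLow n q Y < (v : EReal) ∧ v < thetaUp n Y ∧
          1 + Real.exp (a * q) / √(n : ℝ) < psiHat n q (lam q) v Y ∧ v < c} := by
        refine IsOpen.inter (isOpen_lt continuous_const continuous_coe_real_ereal) <|
          IsOpen.inter (isOpen_lt continuous_id continuous_const) <|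
          IsOpen.inter (isOpen_lt continuous_const (continuous_psiHat q _ Y)) <|
          isOpen_lt continuous_id continuous_const
      obtain ⟨v, hv, r, rfl⟩ := Rat.denseRange_cast.exists_mem_open hopen ⟨u, h, h', hu.2.2, huc⟩ |>.imp
        fun r hr => (⟨hr, r, rfl⟩ : _ ∧ ∃ r' : ℚ, r' = r)
      exact ⟨_, ⟨hv.1.le, hv.2.1.le, hv.2.2.1⟩, hv.2.2.2⟩
    · rintro (⟨r, h⟩ | h | h)
      · exact ⟨_, h⟩
      · exact ⟨_, h⟩
      · exact ⟨_, h⟩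
  rw [this]
  exact (MeasurableSet.iUnion fun r => hw _ measurable_const).union
    ((hw _ (measurable_thetaUp hn)).union (hw _ (measurable_thetaLow hn q).ereal_toReal))

lemma measurable_thetaCheb {n q : ℕ} (hn : 1 ≤ n) (hq : 0 < q) : Measurable (thetaCheb n q) := by
  have hne : MeasurableSet {Y : Fin n → ℝ | (crossing n q Y).Nonempty} := by
    have : {Y : Fin n → ℝ | (crossing n q Y).Nonempty} =
        ⋃ N : ℕ, {Y : Fin n → ℝ | ∃ u ∈ crossing n q Y, u < N} := by
      ext Y
      simp only [Set.mem_ofPred_eq, Set.mem_iUnion]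
      constructor
      · rintro ⟨u, hu⟩
        obtain ⟨N, hN⟩ := exists_nat_gt u
        exact ⟨N, u, hu, hN⟩
      · rintro ⟨N, u, hu, -⟩
        exact ⟨u, hu⟩
    rw [this]
    exact MeasurableSet.iUnion fun N => measurableSet_exists_crossing_lt hn q N
  refine measurable_of_Iio fun c => ?_
  have : thetaCheb n q ⁻¹' Set.Iio c =
      {Y : Fin n → ℝ | ∃ u ∈ crossing n q Y, u < c} ∪
        ({Y : Fin n → ℝ | (crossing n q Y).Nonempty}ᶜ ∩ {Y | thetaUp n Y < c}) := by
    ext Y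
    by_cases h : (crossing n q Y).Nonempty
    · simp [thetaCheb, h, csInf_lt_iff (bddBelow_crossing hn hq Y) h]
    · have h2 : ¬ ∃ u ∈ crossing n q Y, u < c := fun ⟨u, hu, _⟩ => h ⟨u, hu⟩
      simp [thetaCheb, h, h2]
  rw [this]
  exact (measurableSet_exists_crossing_lt hn q c).union
    (hne.compl.inter (measurableSet_lt (measurable_thetaUp hn) measurable_const))

lemma measurable_candidate {n : ℕ} (hn : 1 ≤ n) (q : ℕ) : Measurable (candidate n q) := by
  unfold candidate
  split_ifs with h1 h2
  · exact measurable_thetaMed hn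
  · exact measurable_thetaCheb hn (Nat.pos_of_ne_zero h1)
  · exact measurable_thetaMin hn

lemma measurable_qHat {n : ℕ} (hn : 1 ≤ n) : Measurable (qHat n) := by
  set P : ℕ → (Fin n → ℝ) → Prop := fun q Y => Even q ∧ q ≤ qmax n + 2 ∧
    ∀ q' : ℕ, Even q' → q < q' → q' ≤ qmax n + 2 →
      |candidate n q Y - candidate n q' Y| ≤ delta n q' with hP
  have hPm : ∀ q, MeasurableSet {Y | P q Y} := by
    intro q
    refine (MeasurableSet.const _).inter ((MeasurableSet.const _).inter ?_)
    refine measurableSet_setOfPred.2 (Measurable.forall fun q' => Measurable.imp measurable_const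
      (Measurable.imp measurable_const (Measurable.imp measurable_const ?_)))
    refine measurableSet_setOfPred.1 (measurableSet_le ?_ measurable_const)
    exact ((measurable_candidate hn q).sub (measurable_candidate hn q')).abs
  have hex : ∀ Y, ∃ q, P q Y := fun Y =>
    ⟨qHat n Y, (qHat_spec n Y (qmax_even n)).1, (qHat_spec n Y (qmax_even n)).2.1,
      (qHat_spec n Y (qmax_even n)).2.2.1⟩
  classical
  have : qHat n = fun Y => Nat.find (hex Y) := by
    funext Y
    refine (Nat.sInf_def (hex Y)).trans ?_
    congr
  rw [this]
  exact measurable_find _ hPm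

lemma measurable_thetaAd {n : ℕ} (hn : 1 ≤ n) : Measurable (thetaAd n) := by
  have h : Measurable fun p : ℕ × (Fin n → ℝ) => candidate n p.1 p.2 :=
    measurable_from_prod_countable_right fun q => measurable_candidate hn q
  exact h.comp ((measurable_qHat hn).prodMk measurable_id)

end GOSC
end

noncomputable section
namespace GOSC
open MeasureTheory ProbabilityTheory

/-! ### Gaussian tails, the minimum and the median -/

lemma gaussian_upper_tail (m : ℝ) {t : ℝ} (ht : 0 ≤ t) :
    (gaussianReal m 1).real {y | m + t ≤ y} ≤ Real.exp (-(t ^ 2 / 2)) := by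
  have h := measure_ge_le_exp_mul_mgf (X := id) (μ := gaussianReal m 1) (m + t) ht
    (integrable_exp_mul_gaussianReal t)
  rw [mgf_id_gaussianReal] at h
  refine h.trans (le_of_eq ?_)
  simp only
  rw [← Real.exp_add]; congr 1; push_cast; ring

lemma gaussian_lower_tail (m : ℝ) {t : ℝ} (ht : 0 ≤ t) :
    (gaussianReal m 1).real {y | y ≤ m - t} ≤ Real.exp (-(t ^ 2 / 2)) := by
  have h := measure_le_le_exp_mul_mgf (X := id) (μ := gaussianReal m 1) (m - t) (neg_nonpos.2 ht)
    (integrable_exp_mul_gaussianReal (-t))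
  rw [mgf_id_gaussianReal] at h
  refine h.trans (le_of_eq ?_)
  simp only
  rw [← Real.exp_add]; congr 1; push_cast; ring

/-- The debiasing term of `thetaMin` has at most the order `√(log n)`. -/
lemma gaussTailInv_mem {n : ℕ} (hn : 3 ≤ n) :
    -1 ≤ gaussTailInv (1 / n) ∧ gaussTailInv (1 / n) ≤ √(2 * Real.log n) := by
  have hn' : (3 : ℝ) ≤ n := by exact_mod_cast hn
  have hlog : 0 ≤ Real.log n := Real.log_nonneg (by linarith)
  have hmem : √(2 * Real.log n) ∈ {t : ℝ | gaussTail t ≤ 1 / n} := by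
    have h1 := gaussian_upper_tail 0 (Real.sqrt_nonneg (2 * Real.log n))
    rw [Real.sq_sqrt (by positivity)] at h1
    have h2 : Real.exp (-(2 * Real.log n / 2)) = 1 / n := by
      rw [mul_div_cancel_left₀ _ (by norm_num), Real.exp_neg, Real.exp_log (by linarith), one_div]
    rw [h2] at h1
    refine le_trans (measureReal_mono fun y hy => ?_) h1
    simp only [Set.mem_Ioi] at hy
    simp only [Set.mem_ofPred_eq]
    linarith
  have hlow : ∀ t ∈ {t : ℝ | gaussTail t ≤ 1 / n}, -1 ≤ t := by
    intro t ht
    by_contra! hlt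
    have h1 := gaussian_lower_tail 0 (zero_le_one (α := ℝ))
    have h2 : (gaussianReal 0 1).real (Set.Iic t) ≤ Real.exp (-(1 ^ 2 / 2)) := by
      refine le_trans (measureReal_mono fun y hy => ?_) h1
      simp only [Set.mem_Iic] at hy
      simp only [Set.mem_ofPred_eq]
      linarith
    have h3 : (gaussianReal 0 1).real (Set.Ioi t) = 1 - (gaussianReal 0 1).real (Set.Iic t) := by
      rw [← Set.compl_Iic, probReal_compl_eq_one_sub measurableSet_Iic]
    have h4 : Real.exp (-(1 ^ 2 / 2)) ≤ 0.62 := by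
      have h5 : Real.exp (-(1 ^ 2 / 2)) * Real.exp (-(1 ^ 2 / 2)) = Real.exp (-1) := by
        rw [← Real.exp_add]; norm_num
      have h6 := Real.exp_neg_one_lt_d9
      have h7 := Real.exp_pos (-(1 ^ 2 / 2))
      nlinarith
    have h5 : (1 : ℝ) / n ≤ 1 / 3 := by gcongr
    have h6 : gaussTail t ≤ 1 / n := ht
    unfold gaussTail at h6
    norm_num at h4
    linarith
  exact ⟨le_csInf ⟨_, hmem⟩ hlow, csInf_le ⟨-1, hlow⟩ hmem⟩

lemma law_real_eval {n : ℕ} (θ : ℝ) (μ : Fin n → ℝ) (i : Fin n) {s : Set ℝ}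
    (hs : MeasurableSet s) :
    (law n θ μ).real {Y | Y i ∈ s} = (gaussianReal (θ + μ i) 1).real s := by
  have h := measurePreserving_eval (fun i => gaussianReal (θ + μ i) 1) i
  rw [measureReal_def, measureReal_def, ← h.measure_preimage hs.nullMeasurableSet]
  rfl

lemma law_orderStat_one_lt {n : ℕ} (hn : 1 ≤ n) (θ : ℝ) {μ : Fin n → ℝ} (hμ : ∀ i, 0 ≤ μ i)
    {t : ℝ} (ht : 0 ≤ t) :
    (law n θ μ).real {Y | orderStat Y 1 < θ - t} ≤ n * Real.exp (-(t ^ 2 / 2)) := by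
  have hsub : {Y : Fin n → ℝ | orderStat Y 1 < θ - t} ⊆ ⋃ i, {Y | Y i ∈ Set.Iic (θ - t)} := by
    intro Y hY
    simpa using (orderStat_one_le_iff Y hn _).1 (le_of_lt hY)
  refine (measureReal_mono hsub).trans ((measureReal_iUnion_fintype_le _).trans ?_)
  have h : ∀ i, (law n θ μ).real {Y | Y i ∈ Set.Iic (θ - t)} ≤ Real.exp (-(t ^ 2 / 2)) := by
    intro i
    rw [law_real_eval θ μ i measurableSet_Iic]
    refine le_trans (measureReal_mono fun y hy => ?_) (gaussian_lower_tail (θ + μ i) ht)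
    simp only [Set.mem_Iic] at hy
    simp only [Set.mem_ofPred_eq]
    linarith [hμ i]
  refine (Finset.sum_le_sum fun i _ => h i).trans ?_
  simp

lemma law_lt_orderStat_one {n : ℕ} (hn : 1 ≤ n) (θ : ℝ) {μ : Fin n → ℝ} {i₀ : Fin n}
    (h0 : μ i₀ = 0) {t : ℝ} (ht : 0 ≤ t) :
    (law n θ μ).real {Y | θ + t < orderStat Y 1} ≤ Real.exp (-(t ^ 2 / 2)) := by
  have hsub : {Y : Fin n → ℝ | θ + t < orderStat Y 1} ⊆ {Y | Y i₀ ∈ Set.Ici (θ + t)} := by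
    intro Y hY
    simp only [Set.mem_ofPred_eq, Set.mem_Ici] at hY ⊢
    exact hY.le.trans ((orderStat_one_le_iff Y hn _).2 ⟨i₀, le_rfl⟩)
  refine (measureReal_mono hsub).trans ?_
  rw [law_real_eval θ μ i₀ measurableSet_Ici, h0, add_zero]
  exact gaussian_upper_tail θ ht

/-- A bound for the part of the error of the minimum beyond `t`, with exponential functions in place of
positive parts. The first term concerns underestimation; the second, overestimation, where `i₀` stands
for an uncontaminated observation. -/
def minExcess {n : ℕ} (θ t : ℝ) (i₀ : Fin n) (Y : Fin n → ℝ) : ℝ :=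
  (∑ i, Real.exp (t * (θ - t - Y i))) + Real.exp (t * (Y i₀ - θ - t))

lemma abs_orderStat_one_sub_le {n : ℕ} (hn : 1 ≤ n) (θ : ℝ) {t : ℝ} (ht : 1 ≤ t) (i₀ : Fin n)
    (Y : Fin n → ℝ) : |orderStat Y 1 - θ| ≤ t + minExcess θ t i₀ Y := by
  have hex : ∀ x : ℝ, x ≤ Real.exp (t * x) := by
    intro x
    rcases le_total x 0 with hx | hx
    · exact hx.trans (Real.exp_pos _).le
    · have := Real.add_one_le_exp (t * x)
      nlinarith
  have hs : ∀ i, Real.exp (t * (θ - t - Y i)) ≤ ∑ i, Real.exp (t * (θ - t - Y i)) := fun i =>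
    Finset.single_le_sum (f := fun i => Real.exp (t * (θ - t - Y i)))
      (fun _ _ => (Real.exp_pos _).le) (Finset.mem_univ i)
  have h0 := Real.exp_pos (t * (Y i₀ - θ - t))
  unfold minExcess
  refine abs_le.2 ⟨?_, ?_⟩
  · obtain ⟨i, hi⟩ := (orderStat_one_le_iff Y hn _).1 le_rfl
    have h1 := hex (θ - t - Y i)
    have h2 := hs i
    linarith
  · have h1 := (orderStat_one_le_iff Y hn (Y i₀)).2 ⟨i₀, le_rfl⟩
    have h2 := hex (Y i₀ - θ - t)
    have h3 : 0 ≤ ∑ i, Real.exp (t * (θ - t - Y i)) := Finset.sum_nonneg fun _ _ => by positivity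
    linarith

lemma integral_minExcess {n : ℕ} (θ : ℝ) {μ : Fin n → ℝ} (hμ : ∀ i, 0 ≤ μ i) {i₀ : Fin n}
    (h0 : μ i₀ = 0) {t : ℝ} (ht : 0 ≤ t) :
    Integrable (minExcess θ t i₀) (law n θ μ) ∧
      ∫ Y, minExcess θ t i₀ Y ∂(law n θ μ) ≤ (n + 1) * Real.exp (-(t ^ 2 / 2)) := by
  have hev : ∀ (i : Fin n) (l c : ℝ),
      Integrable (fun Y : Fin n → ℝ => Real.exp (l * Y i + c)) (law n θ μ) ∧
      ∫ Y, Real.exp (l * Y i + c) ∂(law n θ μ) =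
        Real.exp ((θ + μ i) * l + l ^ 2 / 2 + c) := by
    intro i l c
    have hmp := measurePreserving_eval (fun i => gaussianReal (θ + μ i) 1) i
    have hi := integral_exp_gaussian (θ + μ i) l c
    refine ⟨hmp.integrable_comp_of_integrable hi.1, ?_⟩
    rw [← hi.2, ← hmp.map_eq, integral_map hmp.measurable.aemeasurable]
    · rfl
    · exact (by fun_prop : Continuous fun y : ℝ => Real.exp (l * y + c)).aestronglyMeasurable
  have e1 : ∀ (Y : Fin n → ℝ) i, Real.exp (t * (θ - t - Y i)) =
      Real.exp (-t * Y i + t * (θ - t)) := fun Y i => by congr 1; ring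
  have e2 : ∀ (Y : Fin n → ℝ), Real.exp (t * (Y i₀ - θ - t)) =
      Real.exp (t * Y i₀ + -t * (θ + t)) := fun Y => by congr 1; ring
  unfold minExcess
  simp only [e1, e2]
  have hI := integrable_finsetSum Finset.univ fun i _ => (hev i (-t) (t * (θ - t))).1
  refine ⟨hI.add (hev i₀ _ _).1, ?_⟩
  rw [integral_add hI (hev i₀ _ _).1, integral_finsetSum _ fun i _ => (hev i _ _).1, add_mul,
    one_mul]
  refine add_le_add ?_ ?_
  · have h : ∀ i, ∫ Y, Real.exp (-t * Y i + t * (θ - t)) ∂(law n θ μ)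
        ≤ Real.exp (-(t ^ 2 / 2)) := by
      intro i
      rw [(hev i _ _).2, Real.exp_le_exp]
      nlinarith [mul_nonneg ht (hμ i)]
    refine (Finset.sum_le_sum fun i _ => h i).trans ?_
    simp
  · rw [(hev i₀ _ _).2, h0, Real.exp_le_exp]
    apply le_of_eq; ring

/-- The Gaussian density is at least `1 / 5` within distance `1` of the mean. -/
lemma le_gaussian_Iic (m : ℝ) {t : ℝ} (ht0 : 0 ≤ t) (ht1 : t ≤ 1) :
    1 / 2 + t / 5 ≤ (gaussianReal m 1).real (Set.Iic (m + t)) := by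
  have hhalf : 1 / 2 ≤ (gaussianReal m 1).real (Set.Iic m) := by
    have h1 : (gaussianReal m 1).real (Set.Iic m) = (gaussianReal m 1).real (Set.Ici m) := by
      have h := gaussianReal_map_const_sub (μ := m) (v := 1) (2 * m)
      have h2 : 2 * m - m = m := by ring
      rw [h2] at h
      conv_rhs => rw [← h]
      rw [map_measureReal_apply (by fun_prop) measurableSet_Ici]
      congr 1
      ext y
      simp only [Set.mem_Iic, Set.mem_preimage, Set.mem_Ici]
      constructor <;> intro h <;> linarith
    have h2 : (gaussianReal m 1).real (Set.Iic m ∪ Set.Ici m) ≤ _ := measureReal_union_le _ _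
    rw [Set.Iic_union_Ici, probReal_univ] at h2
    linarith
  have hinc : t / 5 ≤ (gaussianReal m 1).real (Set.Ioc m (m + t)) := by
    rw [measureReal_def, gaussianReal_apply_eq_integral m one_ne_zero, ENNReal.toReal_ofReal
      (integral_nonneg fun _ => gaussianPDFReal_nonneg _ _ _)]
    have hc : ∫ _ in Set.Ioc m (m + t), (1 / 5 : ℝ) = t / 5 := by
      rw [setIntegral_const, measureReal_def, Real.volume_Ioc, ENNReal.toReal_ofReal (by linarith)]
      simp; ring
    rw [← hc]
    refine setIntegral_mono_on (integrableOn_const (by simp)) (integrable_gaussianPDFReal m 1).integrableOn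
      measurableSet_Ioc fun y hy => ?_
    have hy2 : (y - m) ^ 2 ≤ 1 := by
      have := hy.1; have := hy.2
      nlinarith
    rw [gaussianPDFReal]
    have h1 : Real.exp (-1 / 2) ≤ Real.exp (-(y - m) ^ 2 / (2 * ((1 : NNReal) : ℝ))) := by
      rw [Real.exp_le_exp]; push_cast; linarith
    have h2 : (0.6 : ℝ) ≤ Real.exp (-1 / 2) := by
      have h5 : Real.exp (-1 / 2) * Real.exp (-1 / 2) = Real.exp (-1) := by
        rw [← Real.exp_add]; norm_num
      have h6 := Real.exp_neg_one_gt_d9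
      have h7 := Real.exp_pos (-1 / 2)
      nlinarith
    have h3 : √(2 * Real.pi * ((1 : NNReal) : ℝ)) ≤ 3 := by
      rw [Real.sqrt_le_left (by norm_num)]
      have := Real.pi_lt_four
      push_cast; linarith
    have h4 : (1 / 3 : ℝ) ≤ (√(2 * Real.pi * ((1 : NNReal) : ℝ)))⁻¹ := by
      rw [one_div]
      have : 0 < √(2 * Real.pi * ((1 : NNReal) : ℝ)) := by
        have := Real.pi_pos
        rw [Real.sqrt_pos]; push_cast; positivity
      gcongr
    calc (1 / 5 : ℝ) = 1 / 3 * 0.6 := by norm_num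
      _ ≤ _ := mul_le_mul h4 (h2.trans h1) (by norm_num) (by positivity)
  have hu : Set.Iic (m + t) = Set.Iic m ∪ Set.Ioc m (m + t) :=
    (Set.Iic_union_Ioc_eq_Iic (by linarith)).symm
  rw [hu, measureReal_union (Set.Iic_disjoint_Ioc le_rfl) measurableSet_Ioc]
  linarith

/-- Chebyshev's inequality: the number of observations below `θ + t` has mean at least
`n / 2 + n t / 10` and variance at most `n`. -/
lemma law_lt_thetaMed {n k : ℕ} (hn : 1 ≤ n) (θ : ℝ) {μ : Fin n → ℝ} (hμ : μ ∈ sparse n k)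
    {t : ℝ} (ht0 : 0 < t) (ht1 : t ≤ 1) (hk : (k : ℝ) ≤ n * t / 10) :
    (law n θ μ).real {Y | θ + t < thetaMed n Y} ≤ 100 / (n * t ^ 2) := by
  have hn' : (1 : ℝ) ≤ n := by exact_mod_cast hn
  set f : ℝ → ℝ := Set.indicator (Set.Iic (θ + t)) 1 with hf
  have hfm : Measurable f := measurable_one.indicator measurableSet_Iic
  have hf01 : ∀ y, 0 ≤ f y ∧ f y ≤ 1 := fun y => by
    by_cases h : y ∈ Set.Iic (θ + t)
    · simp [hf, h]
    · simp [hf, h]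
  have hfL : ∀ i, MemLp f 2 (gaussianReal (θ + μ i) 1) := fun i =>
    MemLp.of_bound hfm.aestronglyMeasurable 1 (Filter.Eventually.of_forall fun y => by
      rw [Real.norm_eq_abs, abs_of_nonneg (hf01 y).1]; exact (hf01 y).2)
  obtain ⟨hI, hE⟩ := integral_sq_sum_sub (fun i => gaussianReal (θ + μ i) 1) (fun _ => f) hfL
  have hvar : ∑ i, Var[f; gaussianReal (θ + μ i) 1] ≤ n := by
    have : ∀ i, Var[f; gaussianReal (θ + μ i) 1] ≤ 1 := by
      intro i
      refine (variance_le_expectation_sq hfm.aestronglyMeasurable).trans ?_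
      calc _ ≤ ∫ _, (1 : ℝ) ∂(gaussianReal (θ + μ i) 1) := by
            refine integral_mono (hfL i).integrable_sq (integrable_const _) fun y => ?_
            simp only [Pi.pow_apply]
            have := hf01 y
            nlinarith
        _ = 1 := by simp
    refine (Finset.sum_le_sum fun i _ => this i).trans ?_
    simp
  have hmean : (n : ℝ) / 2 + n * t / 10 ≤ ∑ i, ∫ y, f y ∂(gaussianReal (θ + μ i) 1) := by
    have h1 : ∀ i, (1 / 2 + t / 5) - (if μ i ≠ 0 then 1 else 0)
        ≤ ∫ y, f y ∂(gaussianReal (θ + μ i) 1) := by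
      intro i
      rw [hf, integral_indicator_one measurableSet_Iic]
      split_ifs with h0
      · have : 0 ≤ (gaussianReal (θ + μ i) 1).real (Set.Iic (θ + t)) := measureReal_nonneg
        linarith
      · push Not at h0
        rw [h0, add_zero, sub_zero]
        exact le_gaussian_Iic θ ht0.le ht1
    have h2 := Finset.sum_le_sum fun i (_ : i ∈ Finset.univ) => h1 i
    rw [Finset.sum_sub_distrib, Finset.sum_boole, Finset.sum_const] at h2
    simp only [nsmul_eq_mul, Finset.card_univ, Fintype.card_fin] at h2
    have hc : (((Finset.univ.filter fun i => μ i ≠ 0).card : ℕ) : ℝ) ≤ k := by exact_mod_cast hμ.2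
    linarith
  set S := ∑ i, ∫ y, f y ∂(gaussianReal (θ + μ i) 1) with hS
  have hsub : {Y : Fin n → ℝ | θ + t < thetaMed n Y} ⊆
      {Y | (n * t / 10) ^ 2 ≤ (∑ i, f (Y i) - S) ^ 2} := by
    intro Y hY
    simp only [Set.mem_ofPred_eq] at hY ⊢
    have h1 : ¬ thetaMed n Y ≤ θ + t := not_le.2 hY
    rw [thetaMed, orderStat_le_iff Y (ceil_half_mem hn).1 (ceil_half_mem hn).2, not_le,
      Nat.lt_ceil] at h1
    have h2 : ∑ i, f (Y i) = ((Finset.univ.filter fun i => Y i ≤ θ + t).card : ℝ) := by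
      rw [← Finset.sum_boole]
      refine Finset.sum_congr rfl fun i _ => ?_
      simp [hf, Set.indicator]
    rw [h2]
    have h3 : (n : ℝ) * t / 10 ≤ S - ((Finset.univ.filter fun i => Y i ≤ θ + t).card : ℝ) := by
      linarith
    rw [sub_sq_comm]
    gcongr
  have hmk := mul_meas_ge_le_integral_of_nonneg (μ := law n θ μ)
    (Filter.Eventually.of_forall fun Y => sq_nonneg (∑ i, f (Y i) - S)) hI ((n * t / 10) ^ 2)
  refine (measureReal_mono hsub).trans ?_
  rw [le_div_iff₀ (by positivity)]
  have h4 : ∫ Y, (∑ i, f (Y i) - S) ^ 2 ∂(law n θ μ) ≤ n := hE.trans_le hvar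
  set p := (law n θ μ).real {Y | (n * t / 10) ^ 2 ≤ (∑ i, f (Y i) - S) ^ 2}
  have h5 := hmk.trans h4
  have h6 : (n * t / 10) ^ 2 * p = (p * (n * t ^ 2)) * (n / 100) := by ring
  rw [h6] at h5
  have h7 : (n : ℝ) = 100 * (n / 100) := by ring
  rw [h7] at h5
  exact le_of_mul_le_mul_right (by linarith) (by positivity : (0 : ℝ) < n / 100)

end GOSC
end

noncomputable section
namespace GOSC
open MeasureTheory ProbabilityTheory

/-! ### Deterministic bounds for the tuning constants -/

lemma a_bounds : 8 ≤ a ∧ a ≤ 9 := by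
  have h2 : (1.414 : ℝ) ≤ √2 := by rw [Real.le_sqrt' (by norm_num)]; norm_num
  have h3 : √2 ≤ (1.415 : ℝ) := by rw [Real.sqrt_le_left (by norm_num)]; norm_num
  have hs : 0 < 3 + 2 * √2 := by positivity
  have he1 := Real.exp_one_lt_d9
  have he2 := Real.exp_one_gt_d9
  have h4 : 5 / 3 ≤ Real.log (3 + 2 * √2) := by
    have h5 : (5 : ℝ) ≤ Real.log ((3 + 2 * √2) ^ 3) := by
      rw [Real.le_log_iff_exp_le (by positivity)]
      have : Real.exp 5 = Real.exp 1 ^ 5 := by rw [← Real.exp_nat_mul]; norm_num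
      rw [this]
      calc Real.exp 1 ^ 5 ≤ 2.7183 ^ 5 := by gcongr; linarith
        _ ≤ (3 + 2 * 1.414) ^ 3 := by norm_num
        _ ≤ _ := by gcongr
    rw [Real.log_pow] at h5
    push_cast at h5; linarith
  have h6 : Real.log (3 + 2 * √2) ≤ 2 := by
    rw [Real.log_le_iff_le_exp hs]
    have : Real.exp 2 = Real.exp 1 ^ 2 := by rw [← Real.exp_nat_mul]; norm_num
    rw [this]
    calc 3 + 2 * √2 ≤ 2.7 ^ 2 := by linarith
      _ ≤ _ := by gcongr; linarith
  unfold a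
  constructor <;> linarith

/-- The last bound says that the lower end of the search interval for `q = qmax n` is `-∞`. -/
lemma qmax_bounds {n : ℕ} (hn : 1000 ≤ Real.log n) :
    a * (qmax n + 2) ≤ Real.log n / 2 ∧ Real.log n / 2 < a * (qmax n + 4) ∧
      Real.log n / 20 ≤ qmax n ∧ (qmax n : ℝ) ≤ Real.log n / 16 ∧
      3 / (10 * a) * Real.log n < qmax n := by
  obtain ⟨ha8, ha9⟩ := a_bounds
  set l := Real.log n with hl
  set x := 1 / (2 * a) * l with hx
  have hax : 2 * a * x = l := by rw [hx]; field_simp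
  have hx0 : 0 ≤ x := by positivity
  have h1 := Nat.floor_le (show 0 ≤ x / 2 by positivity)
  have h2 := Nat.lt_floor_add_one (x / 2)
  have hx20 : 20 ≤ x := by nlinarith
  have h3 : 1 ≤ ⌊x / 2⌋₊ := by
    rw [Nat.one_le_floor_iff]; linarith
  have h4 : (qmax n : ℝ) = 2 * ⌊x / 2⌋₊ - 2 := by
    have : qmax n + 2 = 2 * ⌊x / 2⌋₊ := by
      unfold qmax floorEven
      rw [← hl, ← hx]; omega
    have h5 : ((qmax n + 2 : ℕ) : ℝ) = ((2 * ⌊x / 2⌋₊ : ℕ) : ℝ) := by rw [this]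
    push_cast at h5; linarith
  have h5 : (qmax n : ℝ) ≤ x - 2 := by linarith
  have h6 : x - 4 < qmax n := by linarith
  refine ⟨?_, ?_, ?_, ?_, ?_⟩
  · nlinarith
  · nlinarith
  · nlinarith
  · nlinarith
  · have : 3 / (10 * a) * l = 3 / 5 * x := by rw [hx]; field_simp; norm_num
    rw [this]; linarith

lemma rpow_three_halves {x : ℝ} (hx : 0 ≤ x) : x ^ (3 / 2 : ℝ) = x * √x := by
  rw [show (3 / 2 : ℝ) = 1 + 1 / 2 by norm_num, Real.rpow_add_of_nonneg hx (by norm_num)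
    (by norm_num), Real.rpow_one, Real.sqrt_eq_rpow]

lemma sqrt_eq_exp {n : ℕ} (hn : 0 < n) : √(n : ℝ) = Real.exp (Real.log n / 2) := by
  have hn' : (0 : ℝ) < n := by exact_mod_cast hn
  rw [← Real.log_sqrt hn'.le, Real.exp_log (by positivity)]

lemma pos_of_log {n : ℕ} (hn : 1000 ≤ Real.log n) : 0 < n := by
  rcases Nat.eq_zero_or_pos n with h | h
  · subst h; norm_num at hn
  · exact h

lemma thr_eq {n : ℕ} (hn : 0 < n) (q : ℕ) : thr n q = Real.exp (a * q - Real.log n / 2) := by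
  rw [thr, sqrt_eq_exp hn, ← Real.exp_sub]

lemma thr_pos {n : ℕ} (hn : 0 < n) (q : ℕ) : 0 < thr n q := by
  rw [thr_eq hn]; exact Real.exp_pos _

lemma thr_add_two {n : ℕ} (hn : 0 < n) (q : ℕ) : thr n (q + 2) = Real.exp (2 * a) * thr n q := by
  rw [thr_eq hn, thr_eq hn, ← Real.exp_add]
  congr 1; push_cast; ring

lemma thr_mono {n : ℕ} (hn : 0 < n) {p q : ℕ} (h : p ≤ q) : thr n p ≤ thr n q := by
  rw [thr_eq hn, thr_eq hn, Real.exp_le_exp]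
  have : (p : ℝ) ≤ q := by exact_mod_cast h
  have := a_bounds.1
  nlinarith

/-- The cut-off `qmax n` keeps `thr n (q + 2)` bounded for `q ≤ qmax n`. -/
lemma thr_mul_le {n : ℕ} (hn : 1000 ≤ Real.log n) {q : ℕ} (hq : q ≤ qmax n) :
    Real.exp (2 * a) * thr n q ≤ 1 ∧ thr n q ≤ 1 / 100 := by
  obtain ⟨ha8, ha9⟩ := a_bounds
  obtain ⟨h1, -⟩ := qmax_bounds hn
  have hq' : (q : ℝ) ≤ qmax n := by exact_mod_cast hq
  have h2 : Real.exp (2 * a) * thr n q ≤ 1 := by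
    rw [thr_eq (pos_of_log hn), ← Real.exp_add, Real.exp_le_one_iff]
    nlinarith
  refine ⟨h2, ?_⟩
  have h3 : (100 : ℝ) ≤ Real.exp (2 * a) := by
    calc (100 : ℝ) ≤ (2 : ℝ) ^ 7 := by norm_num
      _ ≤ Real.exp 1 ^ 7 := by gcongr; linarith [Real.exp_one_gt_d9]
      _ = Real.exp 7 := by rw [← Real.exp_nat_mul]; norm_num
      _ ≤ _ := by rw [Real.exp_le_exp]; linarith
  have := thr_pos (pos_of_log hn) q
  nlinarith

lemma delta_of_lt {n q : ℕ} (h : q < qmax n) :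
    delta n q = 10 * Real.exp (2 * a) * thr n q / (q * √(q : ℝ)) := by
  rw [delta, if_pos h, rpow_three_halves (by positivity), thr, mul_add, Real.exp_add, mul_comm 2 a]
  field_simp

lemma delta_qmax (n : ℕ) : delta n (qmax n) = 25 / (qmax n * √(qmax n : ℝ)) := by
  rw [delta, if_neg (lt_irrefl _), if_pos rfl, rpow_three_halves (by positivity)]

lemma delta_nonneg (n q : ℕ) : 0 ≤ delta n q := by
  unfold delta
  split_ifs <;> positivity

lemma delta_last (n : ℕ) : delta n (qmax n + 2) = 4 * √(2 * Real.log n) := by simp [delta]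

/-- For an error `D / q ^ (3/2)`, the noise is amplified by `e ^ (√2 D / q)` and the mean of `psiHat`
grows by at least the order of `√2 D`. -/
lemma lam_mul {q : ℕ} (hq : 0 < q) (D : ℝ) :
    q * lam q * (D / (q * √(q : ℝ))) = √2 * D / q ∧
      q ^ 2 * (lam q * (D / (q * √(q : ℝ)))) = √2 * D := by
  have hq' : (0 : ℝ) < q := by exact_mod_cast hq
  have hs : √(q : ℝ) ^ 2 = q := Real.sq_sqrt hq'.le
  have hs0 : 0 < √(q : ℝ) := by positivity
  rw [lam, Real.sqrt_div (by norm_num)]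
  constructor
  · field_simp
    rw [hs]
  · field_simp
    rw [hs]

/-- The condition of `thetaCheb_mem_Icc` when the contamination `k / n` is below the threshold. Here the
quadratic growth `T_q (1 + 2 t) ≥ 1 + 2 q² t` is enough. -/
lemma excess_of_small {n k q : ℕ} {D : ℝ} (hn : 0 < n) (hq : 0 < q) (hx : thr n q ≤ 1 / 100)
    (hk : (k : ℝ) / n ≤ thr n q) (hD : 5 * thr n q ≤ D) (hDq : √2 * D / q ≤ 1) :
    1 + thr n q * (1 + Real.exp (q * lam q * (D / (q * √(q : ℝ))))) <
      ((n : ℝ) - k) / n * (Polynomial.Chebyshev.T ℝ (q : ℤ)).eval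
        (2 * Real.exp (lam q * (D / (q * √(q : ℝ)))) - 1) - k / n := by
  have hn' : (0 : ℝ) < n := by exact_mod_cast hn
  obtain ⟨e1, e2⟩ := lam_mul hq D
  set d := D / (q * √(q : ℝ)) with hd
  have hx0 := thr_pos hn q
  have hd0 : 0 ≤ d := by rw [hd]; have : 0 ≤ D := by linarith
                         positivity
  have h2 : (1.4 : ℝ) ≤ √2 := by rw [Real.le_sqrt' (by norm_num)]; norm_num
  have hexp : Real.exp (q * lam q * d) ≤ 3 := by
    rw [e1]
    calc _ ≤ Real.exp 1 := Real.exp_le_exp.2 hDq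
      _ ≤ 3 := by linarith [Real.exp_one_lt_d9]
  have ht : 0 ≤ Real.exp (lam q * d) - 1 := by
    have := Real.one_le_exp (mul_nonneg (lam_nonneg q) hd0); linarith
  have hT := (le_eval_T_one_add q ht).1
  have e3 : 1 + 2 * (Real.exp (lam q * d) - 1) = 2 * Real.exp (lam q * d) - 1 := by ring
  rw [e3] at hT
  have h4 : lam q * d ≤ Real.exp (lam q * d) - 1 := by linarith [Real.add_one_le_exp (lam q * d)]
  have h5 : √2 * D ≤ q ^ 2 * (Real.exp (lam q * d) - 1) := by
    rw [← e2]; gcongr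
  set Tv := (Polynomial.Chebyshev.T ℝ (q : ℤ)).eval (2 * Real.exp (lam q * d) - 1)
  have hD0 : 0 ≤ D := by linarith
  have h6 : 1 + 2.8 * D ≤ Tv := by
    have : 1.4 * D ≤ √2 * D := by gcongr
    linarith
  have e4 : ((n : ℝ) - k) / n = 1 - k / n := by field_simp
  rw [e4]
  set κ := (k : ℝ) / n
  set x := thr n q
  have h7 : (1 - x) * (1 + 2.8 * D) ≤ (1 - κ) * Tv := by
    apply mul_le_mul <;> linarith
  have h8 : x * Real.exp (q * lam q * d) ≤ x * 3 := by gcongr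
  have h9 : x * D ≤ 1 / 100 * D := by gcongr
  linarith

/-- The square of `bigD` multiplies `logOdds n k ^ 2 / q ^ (3/2)` in the error bound when the contamination
exceeds the noise level. It is so large that `(bigD - 3) * logOdds n k ≥ 3` as soon as
`logOdds n k ≥ e ^ (-18) / 2`. -/
def bigD : ℝ := 6 * Real.exp 18 + 3

/-- `log (1 + √(k / (n - k)))`, the numerator of the rate before squaring. -/
def logOdds (n k : ℕ) : ℝ := Real.log (1 + √((k : ℝ) / ((n : ℝ) - k)))

lemma logOdds_nonneg (n k : ℕ) : 0 ≤ logOdds n k :=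
  Real.log_nonneg (by linarith [Real.sqrt_nonneg ((k : ℝ) / ((n : ℝ) - k))])

lemma exp_neg_two_logOdds_le {n k : ℕ} (hk : k < n) :
    Real.exp (-(2 * logOdds n k)) ≤ ((n : ℝ) - k) / n := by
  have hk' : (k : ℝ) < n := by exact_mod_cast hk
  have h0 : 0 < (n : ℝ) - k := by linarith
  have hn : 0 < (n : ℝ) := lt_of_le_of_lt (by positivity) hk'
  set s := √((k : ℝ) / ((n : ℝ) - k)) with hs
  have hs0 : 0 ≤ s := Real.sqrt_nonneg _
  have hs2 : s ^ 2 = k / (n - k) := Real.sq_sqrt (by positivity)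
  have h1 : Real.exp (2 * logOdds n k) = (1 + s) ^ 2 := by
    rw [logOdds, ← hs, two_mul, Real.exp_add, Real.exp_log (by positivity)]; ring
  have h2 : (n : ℝ) / (n - k) = 1 + s ^ 2 := by rw [hs2]; field_simp; ring
  rw [Real.exp_neg, h1, inv_le_comm₀ (by positivity) (by positivity), inv_div, h2]
  nlinarith

/-- The condition of `thetaCheb_mem_Icc` when the contamination exceeds the threshold: the
exponential growth of `T_q` beats both the loss of the factor `(n - k) / n` and the noise. -/
lemma excess_of_large {n k q : ℕ} (hk : k < n) (hq : 0 < q) (hx : thr n q ≤ 1)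
    (hL : Real.exp (-18) / 2 ≤ logOdds n k) (hLq : 2 * bigD ^ 2 * logOdds n k ≤ q) :
    1 + thr n q * (1 + Real.exp (q * lam q * (bigD ^ 2 * logOdds n k ^ 2 / (q * √(q : ℝ))))) <
      ((n : ℝ) - k) / n * (Polynomial.Chebyshev.T ℝ (q : ℤ)).eval
        (2 * Real.exp (lam q * (bigD ^ 2 * logOdds n k ^ 2 / (q * √(q : ℝ)))) - 1) - k / n := by
  have hk' : (k : ℝ) < n := by exact_mod_cast hk
  have hn : 0 < (n : ℝ) := lt_of_le_of_lt (by positivity) hk'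
  have hq' : (0 : ℝ) < q := by exact_mod_cast hq
  set L := logOdds n k with hLdef
  set D := bigD with hDdef
  have hexp18 := Real.exp_pos 18
  have hD3 : 3 < D := by rw [hDdef, bigD]; linarith
  have hL0 : 0 ≤ L := logOdds_nonneg n k
  have hDL : 3 ≤ (D - 3) * L := by
    have h1 : D - 3 = 6 * Real.exp 18 := by rw [hDdef, bigD]; ring
    have h2 : Real.exp 18 * Real.exp (-18) = 1 := by rw [← Real.exp_add]; norm_num
    rw [h1]
    calc (3 : ℝ) = 6 * Real.exp 18 * (Real.exp (-18) / 2) := by linarith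
      _ ≤ _ := by gcongr
  obtain ⟨e1, e2⟩ := lam_mul hq (D ^ 2 * L ^ 2)
  set d := D ^ 2 * L ^ 2 / (q * √(q : ℝ)) with hd
  have hd0 : 0 ≤ d := by positivity
  have h2 : (1 : ℝ) ≤ √2 := by rw [Real.le_sqrt' (by norm_num)]; norm_num
  have h2' : √2 ≤ (2 : ℝ) := by rw [Real.sqrt_le_left (by norm_num)]; norm_num
  have hnoise : Real.exp (q * lam q * d) ≤ Real.exp L := by
    rw [e1, Real.exp_le_exp, div_le_iff₀ hq']
    calc √2 * (D ^ 2 * L ^ 2) ≤ 2 * (D ^ 2 * L ^ 2) := by gcongr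
      _ = L * (2 * D ^ 2 * L) := by ring
      _ ≤ _ := by gcongr
  set t := Real.exp (lam q * d) - 1 with ht
  have h4 : lam q * d ≤ t := by rw [ht]; linarith [Real.add_one_le_exp (lam q * d)]
  have ht0 : 0 ≤ t := le_trans (mul_nonneg (lam_nonneg q) hd0) h4
  have hT := (le_eval_T_one_add q ht0).2
  have e3 : 1 + 2 * t = 2 * Real.exp (lam q * d) - 1 := by rw [ht]; ring
  rw [e3] at hT
  -- `√t` is at least `y = D L / q`, and `(1 + 2 y) ^ q ≥ e ^ (D L)`
  set y := D * L / q with hy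
  have hy0 : 0 ≤ y := by positivity
  have hyt : y ≤ √t := by
    refine Real.le_sqrt_of_sq_le ?_
    refine le_trans ?_ h4
    have h5 : (q : ℝ) ^ 2 * y ^ 2 ≤ q ^ 2 * (lam q * d) := by
      rw [e2, hy]
      have : (q : ℝ) ^ 2 * (D * L / q) ^ 2 = D ^ 2 * L ^ 2 := by field_simp
      rw [this]
      exact le_mul_of_one_le_left (by positivity) h2
    exact le_of_mul_le_mul_left h5 (by positivity)
  have hy1 : y ≤ 1 := by
    rw [hy, div_le_one hq']
    refine le_trans ?_ hLq
    gcongr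
    nlinarith
  have hgrow : Real.exp (D * L) ≤ (1 + 2 * √t) ^ q := by
    have h6 : Real.exp y ≤ 1 + 2 * √t := by
      have h7 : |Real.exp y - 1 - y| ≤ y ^ 2 := Real.abs_exp_sub_one_sub_id_le (by rwa [abs_of_nonneg hy0])
      have := (abs_le.1 h7).2
      nlinarith
    calc Real.exp (D * L) = Real.exp y ^ q := by
          rw [← Real.exp_nat_mul]; congr 1; rw [hy]; field_simp
      _ ≤ _ := by gcongr
  set Tv := (Polynomial.Chebyshev.T ℝ (q : ℤ)).eval (2 * Real.exp (lam q * d) - 1)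
  have hfrac := exp_neg_two_logOdds_le hk
  rw [← hLdef] at hfrac
  have hTv : Real.exp (D * L) / 2 ≤ Tv := by linarith
  have h8 : Real.exp (-(2 * L)) * (Real.exp (D * L) / 2) ≤ ((n : ℝ) - k) / n * Tv := by
    apply mul_le_mul hfrac hTv (by positivity)
    exact div_nonneg (by linarith) hn.le
  have h9 : Real.exp (-(2 * L)) * Real.exp (D * L) = Real.exp ((D - 3) * L) * Real.exp L := by
    rw [← Real.exp_add, ← Real.exp_add]; congr 1; ring
  have h10 : (9 : ℝ) ≤ Real.exp ((D - 3) * L) := by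
    calc (9 : ℝ) ≤ 2.5 ^ 3 := by norm_num
      _ ≤ Real.exp 1 ^ 3 := by gcongr; linarith [Real.exp_one_gt_d9]
      _ = Real.exp 3 := by rw [← Real.exp_nat_mul]; norm_num
      _ ≤ _ := Real.exp_le_exp.2 hDL
  have h11 : 1 ≤ Real.exp L := Real.one_le_exp hL0
  have h12 : (k : ℝ) / n < 1 := by rwa [div_lt_one hn]
  have h13 : thr n q * (1 + Real.exp (q * lam q * d)) ≤ 1 * (1 + Real.exp L) := by gcongr
  have h14 : 9 * Real.exp L ≤ Real.exp ((D - 3) * L) * Real.exp L := by gcongr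
  linarith

end GOSC
end

noncomputable section
namespace GOSC
open MeasureTheory ProbabilityTheory

/-! ### The rate -/

lemma half_sqrt_le_logOdds {n k : ℕ} (hk : k < n) : √((k : ℝ) / n) / 2 ≤ logOdds n k := by
  have hk' : (k : ℝ) < n := by exact_mod_cast hk
  have hn : 0 < (n : ℝ) := lt_of_le_of_lt (by positivity) hk'
  set s := √((k : ℝ) / n)
  have hs0 : 0 ≤ s := Real.sqrt_nonneg _
  have hs1 : s ≤ 1 := Real.sqrt_le_one.2 ((div_le_one hn).2 hk'.le)
  have h1 : Real.log (1 + s) ≤ logOdds n k := by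
    unfold logOdds
    have : s ≤ √((k : ℝ) / (n - k)) := by
      apply Real.sqrt_le_sqrt
      have : 0 < (n : ℝ) - k := by linarith
      gcongr
      linarith [(Nat.cast_nonneg k : (0 : ℝ) ≤ k)]
    gcongr
  refine le_trans ?_ h1
  have h2 := Real.one_sub_inv_le_log_of_pos (show 0 < 1 + s by linarith)
  refine le_trans ?_ h2
  have : 1 - (1 + s)⁻¹ = s / (1 + s) := by field_simp; ring
  rw [this]
  gcongr
  linarith

lemma div_four_le_logOdds_sq {n k : ℕ} (hk : k < n) : (k : ℝ) / n / 4 ≤ logOdds n k ^ 2 := by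
  have h := half_sqrt_le_logOdds hk
  have h2 : (√((k : ℝ) / n) / 2) ^ 2 ≤ logOdds n k ^ 2 := by gcongr
  rw [div_pow, Real.sq_sqrt (by positivity)] at h2
  linarith

/-- The logarithm in the denominator of the rate. -/
def logRatio (n k : ℕ) : ℝ := Real.log (1 + ((k : ℝ) / √(n : ℝ)) ^ (2 / 3 : ℝ))

lemma logRatio_pos {n k : ℕ} (hk : 1 ≤ k) (hkn : k < n) : 0 < logRatio n k := by
  have : (0 : ℝ) < k := by exact_mod_cast hk
  have : (0 : ℝ) < n := by exact_mod_cast (by omega : 0 < n)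
  refine Real.log_pos ?_
  have : 0 < ((k : ℝ) / √(n : ℝ)) ^ (2 / 3 : ℝ) := by positivity
  linarith

lemma rate_eq {n k : ℕ} (hk : 1 ≤ k) (hkn : k < n) :
    rate n k = logOdds n k ^ 2 / (logRatio n k * √(logRatio n k)) := by
  rw [← rpow_three_halves (logRatio_pos hk hkn).le]; rfl

lemma rate_pos {n k : ℕ} (hk : 1 ≤ k) (hkn : k < n) : 0 < rate n k := by
  have h1 := logRatio_pos hk hkn
  have h2 : 0 < logOdds n k ^ 2 := by
    refine lt_of_lt_of_le ?_ (div_four_le_logOdds_sq hkn)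
    have : (0 : ℝ) < k := by exact_mod_cast hk
    have : (0 : ℝ) < n := by exact_mod_cast (by omega : 0 < n)
    positivity
  rw [rate_eq hk hkn]
  positivity

lemma rate_ge_of_logRatio_le {n k : ℕ} (hk : 1 ≤ k) (hkn : k < n) {x : ℝ}
    (hx : logRatio n k ≤ x) : logOdds n k ^ 2 / (x * √x) ≤ rate n k := by
  have h1 := logRatio_pos hk hkn
  have hx0 : 0 ≤ x := h1.le.trans hx
  rw [rate_eq hk hkn]
  gcongr

/-- The rate is never better than the parametric one. -/
lemma rate_ge_inv_sqrt {n k : ℕ} (hk : 1 ≤ k) (hkn : k < n) :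
    1 / (4 * √(n : ℝ)) ≤ rate n k := by
  have hk' : (0 : ℝ) < k := by exact_mod_cast hk
  have hn' : (0 : ℝ) < n := by exact_mod_cast (by omega : 0 < n)
  set y : ℝ := ((k : ℝ) / √(n : ℝ)) ^ (2 / 3 : ℝ) with hy
  have hy0 : 0 < y := by positivity
  have h1 : logRatio n k ≤ y := by
    have := Real.log_le_sub_one_of_pos (show 0 < 1 + y by linarith)
    unfold logRatio; rw [← hy]; linarith
  refine le_trans ?_ (rate_ge_of_logRatio_le hk hkn h1)
  have h2 : y * √y = k / √(n : ℝ) := by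
    rw [← rpow_three_halves hy0.le, hy, ← Real.rpow_mul (by positivity)]
    norm_num
  rw [h2]
  have h3 := div_four_le_logOdds_sq hkn
  have h4 : 1 / (4 * √(n : ℝ)) = (k : ℝ) / n / 4 / (k / √(n : ℝ)) := by
    have : √(n : ℝ) * √(n : ℝ) = n := Real.mul_self_sqrt hn'.le
    field_simp
    nlinarith
  rw [h4]
  gcongr

/-- The index is at least of the order of the logarithm in the denominator of the rate. -/
lemma logRatio_le_of_le_exp {n k q : ℕ} (hq : 1 ≤ q) (hκ : (k : ℝ) / √(n : ℝ) ≤ Real.exp (a * q)) :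
    logRatio n k ≤ 7 * q := by
  have hq' : (1 : ℝ) ≤ q := by exact_mod_cast hq
  have h1 : ((k : ℝ) / √(n : ℝ)) ^ (2 / 3 : ℝ) ≤ Real.exp (6 * q) := by
    calc _ ≤ Real.exp (a * q) ^ (2 / 3 : ℝ) := by gcongr
      _ = Real.exp (a * q * (2 / 3)) := by rw [← Real.exp_mul]
      _ ≤ _ := by
        rw [Real.exp_le_exp]
        nlinarith [a_bounds.2]
  have h2 : 1 + Real.exp (6 * q) ≤ Real.exp (7 * q) := by
    have : Real.exp (7 * q) = Real.exp q * Real.exp (6 * q) := by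
      rw [← Real.exp_add]; congr 1; ring
    rw [this]
    have h3 := Real.add_one_le_exp (q : ℝ)
    have h4 : 1 ≤ Real.exp (6 * (q : ℝ)) := Real.one_le_exp (by positivity)
    nlinarith
  unfold logRatio
  rw [Real.log_le_iff_le_exp (by positivity)]
  linarith

lemma rate_ge_of_le_exp {n k q : ℕ} (hk : 1 ≤ k) (hkn : k < n) (hq : 1 ≤ q)
    (hκ : (k : ℝ) / √(n : ℝ) ≤ Real.exp (a * q)) :
    logOdds n k ^ 2 / (21 * (q * √(q : ℝ))) ≤ rate n k := by
  refine le_trans ?_ (rate_ge_of_logRatio_le hk hkn (logRatio_le_of_le_exp hq hκ))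
  have hq' : (0 : ℝ) < q := by exact_mod_cast hq
  have h7 : √(7 : ℝ) ≤ 3 := by rw [Real.sqrt_le_left (by norm_num)]; norm_num
  rw [Real.sqrt_mul (by norm_num)]
  refine div_le_div_of_nonneg_left (sq_nonneg _) (by positivity) ?_
  calc 7 * (q : ℝ) * (√7 * √(q : ℝ)) ≤ 7 * (q : ℝ) * (3 * √(q : ℝ)) := by gcongr
    _ = _ := by ring

lemma div_le_thr_iff {n : ℕ} (hn : 0 < n) (k q : ℕ) :
    (k : ℝ) / n ≤ thr n q ↔ (k : ℝ) / √(n : ℝ) ≤ Real.exp (a * q) := by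
  have hn' : (0 : ℝ) < n := by exact_mod_cast hn
  have hs : √(n : ℝ) * √(n : ℝ) = n := Real.mul_self_sqrt hn'.le
  have hs0 : 0 < √(n : ℝ) := by positivity
  rw [thr, le_div_iff₀ hs0]
  have : (k : ℝ) / n * √(n : ℝ) = k / √(n : ℝ) := by
    nth_rw 1 [← hs]
    rw [← div_div, div_mul_cancel₀ _ hs0.ne']
  rw [this]

/-! ### The candidates on the good event -/

/-- The event that the minimum is not far from `θ` and that, if the contamination is moderate, the rough
lower estimator lies below `θ`. -/
def mainEvent (n k : ℕ) (θ : ℝ) : Set (Fin n → ℝ) :=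
  {Y | θ - 1.9 * √(Real.log n) ≤ orderStat Y 1 ∧ orderStat Y 1 ≤ θ + √(2 * Real.log n) ∧
    ((k : ℝ) ≤ (n : ℝ) ^ (4 / 5 : ℝ) →
      thetaMed n Y ≤ θ + Real.pi ^ 2 / (144 * (qmax n : ℝ) ^ (3 / 2 : ℝ)))}

lemma three_le_of_log {n : ℕ} (hn : 1000 ≤ Real.log n) : 3 ≤ n := by
  by_contra! h
  have : Real.log n ≤ n - 1 := Real.log_le_sub_one_of_pos (by exact_mod_cast pos_of_log hn)
  have h2 : (n : ℝ) ≤ 3 := by exact_mod_cast h.le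
  linarith

lemma abs_thetaMin_sub_le {n k : ℕ} {θ : ℝ} (hn : 1000 ≤ Real.log n) {Y : Fin n → ℝ}
    (hY : Y ∈ mainEvent n k θ) : |thetaMin n Y - θ| ≤ 2 * √(2 * Real.log n) := by
  obtain ⟨h1, h2⟩ := gaussTailInv_mem (three_le_of_log hn)
  obtain ⟨h3, h4, -⟩ := hY
  set l := Real.log n
  have h5 : √(2 * l) = √2 * √l := Real.sqrt_mul (by norm_num) _
  have h6 : (1.4 : ℝ) ≤ √2 := by rw [Real.le_sqrt' (by norm_num)]; norm_num
  have h7 : (10 : ℝ) ≤ √l := by rw [Real.le_sqrt' (by norm_num)]; linarith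
  have h8 : 1.4 * √l ≤ √(2 * l) := by rw [h5]; gcongr
  unfold thetaMin
  exact abs_le.2 ⟨by linarith, by linarith⟩

lemma add_le_thetaUp {n k : ℕ} {θ d : ℝ} {Y : Fin n → ℝ} (hY : Y ∈ mainEvent n k θ)
    (hd : d ≤ 0.1 * √(Real.log n)) : θ + d ≤ thetaUp n Y := by
  have := hY.1
  unfold thetaUp
  linarith

/-- If the rough lower estimator is finite and `k / n ≤ thr n q`, then `k ≤ n ^ (4/5)`, so the median is
not much larger than `θ`. -/
lemma thetaLow_le {n k q : ℕ} {θ d : ℝ} (hn : 1000 ≤ Real.log n) {Y : Fin n → ℝ}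
    (hY : Y ∈ mainEvent n k θ) (hd : 0 ≤ d) (hk : (k : ℝ) / n ≤ thr n q ∨ q = qmax n) :
    thetaLow n q Y ≤ ((θ + d : ℝ) : EReal) := by
  have hn0 := pos_of_log hn
  have hn' : (0 : ℝ) < n := by exact_mod_cast hn0
  unfold thetaLow
  split_ifs with hq
  · rcases hk with hk | hk
    · have h1 : (k : ℝ) ≤ (n : ℝ) ^ (4 / 5 : ℝ) := by
        rw [div_le_iff₀ hn', thr_eq hn0] at hk
        refine hk.trans ?_
        nth_rw 2 [← Real.exp_log hn']
        rw [← Real.exp_add, Real.rpow_def_of_pos hn', Real.exp_le_exp]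
        have h2 : a * q ≤ 3 / 10 * Real.log n := by
          have := a_bounds.1
          calc a * q ≤ a * (3 / (10 * a) * Real.log n) := by gcongr
            _ = _ := by field_simp
        linarith
      have h2 := hY.2.2 h1
      exact_mod_cast (by linarith)
    · have := (qmax_bounds hn).2.2.2.2
      rw [hk] at hq
      linarith
  · exact bot_le

lemma fifty_le_qmax {n : ℕ} (hn : 1000 ≤ Real.log n) : (50 : ℝ) ≤ qmax n := by
  have := (qmax_bounds hn).2.2.1
  linarith

/-- The threshold `delta n q` is twice an error `D / q ^ (3/2)` that is admissible in `excess_of_small`. -/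
lemma delta_eq {n q : ℕ} (hn : 1000 ≤ Real.log n) (hqe : Even q) (hq : 2 ≤ q) (hqm : q ≤ qmax n) :
    ∃ D : ℝ, delta n q = 2 * (D / (q * √(q : ℝ))) ∧ 5 * thr n q ≤ D ∧ √2 * D / q ≤ 1 := by
  have hq' : (2 : ℝ) ≤ q := by exact_mod_cast hq
  have h2 : √2 ≤ (1.5 : ℝ) := by rw [Real.sqrt_le_left (by norm_num)]; norm_num
  rcases hqm.lt_or_eq with h | h
  · have h3 : q + 2 ≤ qmax n := by
      obtain ⟨r, hr⟩ := hqe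
      obtain ⟨s, hs⟩ := qmax_even n
      omega
    have h4 := (thr_mul_le hn h3).2
    have h5 := thr_add_two (pos_of_log hn) q
    have h0 := thr_pos (pos_of_log hn) q
    have h6 : 1 ≤ Real.exp (2 * a) := Real.one_le_exp (by linarith [a_bounds.1])
    refine ⟨5 * thr n (q + 2), ?_, ?_, ?_⟩
    · rw [delta_of_lt h, h5]; ring
    · rw [h5]; nlinarith
    · rw [div_le_one (by linarith)]
      have := thr_pos (pos_of_log hn) (q + 2)
      nlinarith
  · have h50 := fifty_le_qmax hn
    have h4 := (thr_mul_le hn hqm).2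
    refine ⟨12.5, ?_, by linarith, ?_⟩
    · rw [h, delta_qmax]; ring
    · rw [h, div_le_one (by linarith)]; linarith

lemma delta_le_two {n q : ℕ} (hn : 1000 ≤ Real.log n) (hqe : Even q) (hq : 2 ≤ q)
    (hqm : q ≤ qmax n) : delta n q ≤ 2 := by
  obtain ⟨D, h1, h2, h3⟩ := delta_eq hn hqe hq hqm
  have hq' : (2 : ℝ) ≤ q := by exact_mod_cast hq
  have hD : 0 ≤ D := by linarith [thr_pos (pos_of_log hn) q]
  have hs2 : (1 : ℝ) ≤ √2 := by rw [Real.le_sqrt' (by norm_num)]; norm_num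
  have hsq : (1 : ℝ) ≤ √(q : ℝ) := by rw [Real.le_sqrt' (by norm_num)]; linarith
  have hd1 : D / (q * √(q : ℝ)) ≤ 1 := by
    rw [div_le_one (by linarith)] at h3
    rw [div_le_one (by positivity)]
    nlinarith
  linarith

/-- While the contamination is below the noise level, `θ̂_q` is accurate up to half its threshold, so
that two such candidates pass the comparison in the selection. -/
lemma abs_candidate_sub_le {n k q : ℕ} {θ : ℝ} (hn : 1000 ≤ Real.log n) (hqe : Even q)
    (hq : 2 ≤ q) (hqm : q ≤ qmax n) {μ Y : Fin n → ℝ} (hμ : μ ∈ sparse n k)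
    (hk : (k : ℝ) / n ≤ thr n q) (hY : Y ∈ mainEvent n k θ) (hN : noise n q θ μ Y ≤ thr n q) :
    |candidate n q Y - θ| ≤ delta n q / 2 := by
  obtain ⟨D, h1, h2, h3⟩ := delta_eq hn hqe hq hqm
  have hq' : (2 : ℝ) ≤ q := by exact_mod_cast hq
  have hx0 := thr_pos (pos_of_log hn) q
  have hD : 0 ≤ D := by linarith
  have hd1 : D / (q * √(q : ℝ)) ≤ 1 := by linarith [delta_le_two hn hqe hq hqm]
  have h7 : (10 : ℝ) ≤ √(Real.log n) := by rw [Real.le_sqrt' (by norm_num)]; linarith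
  have hd0 : 0 ≤ D / (q * √(q : ℝ)) := by positivity
  have h := thetaCheb_mem_Icc (pos_of_log hn) hd0 hμ hN
    (thetaLow_le hn hY hd0 (Or.inl hk)) (add_le_thetaUp hY (by linarith))
    (excess_of_small (pos_of_log hn) (by omega) (thr_mul_le hn hqm).2 hk h2 h3)
  rw [candidate, if_neg (by omega), if_pos hqm, h1]
  exact abs_le.2 ⟨by linarith, by linarith⟩

/-- The growth of `q ^ (3/2)`, which the growth of `e ^ (a q)` outweighs. -/
lemma mul_sqrt_le_exp {p q : ℝ} (hp : 1 ≤ p) (hpq : p ≤ q) :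
    q * √q ≤ Real.exp (2 * (q - p)) * (p * √p) := by
  have h1 : 1 ≤ Real.exp (q - p) := Real.one_le_exp (by linarith)
  have h5 : q ≤ Real.exp (q - p) * p := by
    have := Real.add_one_le_exp (q - p)
    nlinarith
  have h6 : √q ≤ Real.exp (q - p) * √p := by
    rw [Real.sqrt_le_left (by positivity), mul_pow, Real.sq_sqrt (by linarith)]
    refine h5.trans ?_
    gcongr
    nlinarith
  calc q * √q ≤ (Real.exp (q - p) * p) * (Real.exp (q - p) * √p) := by gcongr
    _ = _ := by rw [two_mul, Real.exp_add]; ring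

/-- By monotonicity, the errors `delta n q / 2` and `delta n q' / 2` add up to at most `delta n q'`. -/
lemma delta_mono {n q q' : ℕ} (hn : 1000 ≤ Real.log n) (hqe : Even q) (hqe' : Even q')
    (hq : 2 ≤ q) (h : q < q') (hq' : q' ≤ qmax n + 2) : delta n q ≤ delta n q' := by
  have hq2 : (2 : ℝ) ≤ q := by exact_mod_cast hq
  have hqq : (q : ℝ) + 2 ≤ q' := by
    have : q + 2 ≤ q' := by
      obtain ⟨r, hr⟩ := hqe
      obtain ⟨s, hs⟩ := hqe'
      omega
    exact_mod_cast this
  have hqm : q ≤ qmax n := by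
    obtain ⟨r, hr⟩ := hqe
    obtain ⟨s, hs⟩ := qmax_even n
    omega
  have hx0 := thr_pos (pos_of_log hn) q
  have hn0 := pos_of_log hn
  have hg := mul_sqrt_le_exp (show (1 : ℝ) ≤ q by linarith) (show (q : ℝ) ≤ q' by linarith)
  have hq'0 : (0 : ℝ) < q' := by linarith
  have ha := a_bounds.1
  have ht : thr n q' = Real.exp (a * (q' - q)) * thr n q := by
    rw [thr_eq hn0, thr_eq hn0, ← Real.exp_add]; congr 1; ring
  rcases lt_trichotomy q' (qmax n) with h1 | h1 | h1
  · rw [delta_of_lt (h.trans h1), delta_of_lt h1, ht, div_le_div_iff₀ (by positivity) (by positivity)]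
    calc 10 * Real.exp (2 * a) * thr n q * (q' * √(q' : ℝ))
        ≤ 10 * Real.exp (2 * a) * thr n q * (Real.exp (2 * (q' - q)) * (q * √(q : ℝ))) := by gcongr
      _ ≤ 10 * Real.exp (2 * a) * thr n q * (Real.exp (a * (q' - q)) * (q * √(q : ℝ))) := by
          gcongr
          · linarith
          · linarith
      _ = _ := by ring
  · have h5 := (thr_mul_le hn h1.le).1
    rw [delta_of_lt (h1 ▸ h), h1, delta_qmax, ← h1, div_le_div_iff₀ (by positivity) (by positivity)]
    -- `e^{2 a} e^{2 (q' - q)} ≤ e^{2 a} e^{a (q' - q)}`, and `e^{2 a} thr n q' ≤ 1`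
    calc 10 * Real.exp (2 * a) * thr n q * (q' * √(q' : ℝ))
        ≤ 10 * Real.exp (2 * a) * thr n q * (Real.exp (2 * (q' - q)) * (q * √(q : ℝ))) := by gcongr
      _ ≤ 10 * Real.exp (2 * a) * thr n q * (Real.exp (a * (q' - q)) * (q * √(q : ℝ))) := by
          gcongr
          · linarith
          · linarith
      _ = 10 * (Real.exp (2 * a) * thr n q') * (q * √(q : ℝ)) := by rw [ht]; ring
      _ ≤ 10 * 1 * (q * √(q : ℝ)) := by gcongr
      _ ≤ _ := by
          have : 0 < (q : ℝ) * √(q : ℝ) := by positivity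
          linarith
  · have h2 : q' = qmax n + 2 := by
      obtain ⟨r, hr⟩ := hqe'
      obtain ⟨s, hs⟩ := qmax_even n
      omega
    rw [h2, delta_last]
    have h3 := delta_le_two hn hqe hq hqm
    have h4 : (1 : ℝ) ≤ √(2 * Real.log n) := by rw [Real.le_sqrt' (by norm_num)]; linarith
    linarith

end GOSC
end

noncomputable section
namespace GOSC
open MeasureTheory ProbabilityTheory

/-! ### The error of the adaptive estimator on the good event -/

/-- If both the contamination and the noise are below the threshold from the index `Q` on, the error has
the order of `delta n Q`. For `Q = qmax n + 2` there is no such condition. -/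
lemma abs_thetaAd_sub_le_of_good {n k Q : ℕ} {θ : ℝ} (hn : 1000 ≤ Real.log n) (hQe : Even Q)
    (hQ2 : 2 ≤ Q) (hQ : Q ≤ qmax n + 2) {μ Y : Fin n → ℝ} (hμ : μ ∈ sparse n k)
    (hk : ∀ m, Q ≤ m → m ≤ qmax n → (k : ℝ) / n ≤ thr n m) (hY : Y ∈ mainEvent n k θ)
    (hN : ∀ m, Even m → Q ≤ m → m ≤ qmax n → noise n m θ μ Y ≤ thr n m) :
    |thetaAd n Y - θ| ≤ 3 / 2 * delta n Q := by
  have hlast : ∀ m, Even m → qmax n < m → m ≤ qmax n + 2 → m = qmax n + 2 := by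
    rintro m ⟨r, hr⟩ h1 h2
    obtain ⟨s, hs⟩ := qmax_even n
    omega
  have h := abs_thetaAd_sub_le (θ := θ) (Y := Y) hQe hQ (fun m => delta n m / 2) (delta_nonneg n Q) ?_ ?_
  · linarith
  · intro m hme hQm hm
    rcases le_or_gt m (qmax n) with h | h
    · exact abs_candidate_sub_le hn hme (by omega) h hμ (hk m hQm h) hY (hN m hme hQm h)
    · rw [hlast m hme h hm, delta_last]
      have h1 : candidate n (qmax n + 2) Y = thetaMin n Y := by simp [candidate]
      rw [h1]
      linarith [abs_thetaMin_sub_le hn hY]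
  · intro m hme hQm hm
    linarith [delta_mono hn hQe hme hQ2 hQm hm]

lemma abs_thetaAd_sub_le_crude {n k : ℕ} {θ : ℝ} (hn : 1000 ≤ Real.log n) {Y : Fin n → ℝ}
    (hY : Y ∈ mainEvent n k θ) : |thetaAd n Y - θ| ≤ 6 * √(2 * Real.log n) := by
  have h1 := abs_thetaMin_sub_le hn hY
  have h2 := abs_thetaAd_sub_thetaMin_le Y
  have h3 := abs_sub_le (thetaAd n Y) (thetaMin n Y) θ
  linarith

/-- When the contamination is large, the comparison is between `θ̂_q` for `q = qmax n`, whose error is of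
the order `L² / q ^ (3/2)` with `L = logOdds n k`, and the debiased minimum. -/
lemma abs_thetaAd_sub_le_of_large {n k : ℕ} {θ : ℝ} (hn : 1000 ≤ Real.log n) {μ Y : Fin n → ℝ}
    (hμ : μ ∈ sparse n k) (hkn : k < n) (hL : Real.exp (-18) / 2 ≤ logOdds n k)
    (hLq : 2 * bigD ^ 2 * logOdds n k ≤ qmax n) (hY : Y ∈ mainEvent n k θ)
    (hN : noise n (qmax n) θ μ Y ≤ thr n (qmax n)) :
    |thetaAd n Y - θ| ≤
      delta n (qmax n) + bigD ^ 2 * logOdds n k ^ 2 / (qmax n * √(qmax n : ℝ)) := by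
  have h50 := fifty_le_qmax hn
  have hq0 : 0 < qmax n := by
    have : (0 : ℝ) < qmax n := by linarith
    exact_mod_cast this
  set d := bigD ^ 2 * logOdds n k ^ 2 / (qmax n * √(qmax n : ℝ)) with hd
  have hd0 : 0 ≤ d := by positivity
  have hD3 : 3 ≤ bigD := by unfold bigD; linarith [Real.exp_pos 18]
  have hL0 := logOdds_nonneg n k
  have hsq : √(qmax n : ℝ) ^ 2 = qmax n := Real.sq_sqrt (by linarith)
  have hs0 : 0 < √(qmax n : ℝ) := by rw [Real.sqrt_pos]; linarith
  have hd1 : d ≤ 0.1 * √(Real.log n) := by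
    have h1 : d ≤ √(qmax n : ℝ) / 36 := by
      rw [hd, div_le_iff₀ (by positivity)]
      have h2 : (2 * bigD ^ 2 * logOdds n k) ^ 2 ≤ (qmax n : ℝ) ^ 2 := by gcongr
      have h3 : (bigD ^ 2 * logOdds n k ^ 2) * 36 ≤ (2 * bigD ^ 2 * logOdds n k) ^ 2 := by
        have h9 : 9 ≤ bigD ^ 2 := by nlinarith
        have : (2 * bigD ^ 2 * logOdds n k) ^ 2 = (bigD ^ 2 * logOdds n k ^ 2) * (4 * bigD ^ 2) := by
          ring
        rw [this]
        gcongr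
        linarith
      have h4 : √(qmax n : ℝ) / 36 * (qmax n * √(qmax n : ℝ)) = (qmax n : ℝ) ^ 2 / 36 := by
        have : √(qmax n : ℝ) / 36 * (qmax n * √(qmax n : ℝ)) = √(qmax n : ℝ) ^ 2 * qmax n / 36 := by
          ring
        rw [this, hsq]; ring
      rw [h4]; linarith
    have h2 : √(qmax n : ℝ) ≤ √(Real.log n) := by
      apply Real.sqrt_le_sqrt
      linarith [(qmax_bounds hn).2.2.2.1]
    linarith
  have hcheb := thetaCheb_mem_Icc (pos_of_log hn) hd0 hμ hN
    (thetaLow_le hn hY hd0 (Or.inr rfl)) (add_le_thetaUp hY hd1)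
    (excess_of_large hkn hq0 (by linarith [(thr_mul_le hn (le_refl (qmax n))).2]) hL hLq)
  have hc1 : candidate n (qmax n) Y = thetaCheb n (qmax n) Y := by
    rw [candidate, if_neg (by omega), if_pos le_rfl]
  have hc2 : candidate n (qmax n + 2) Y = thetaMin n Y := by simp [candidate]
  have hlast : ∀ m, Even m → qmax n < m → m ≤ qmax n + 2 → m = qmax n + 2 := by
    rintro m ⟨r, hr⟩ h1 h2
    obtain ⟨s, hs⟩ := qmax_even n
    omega
  have hmin := abs_thetaMin_sub_le hn hY
  have hll : 0.1 * √(Real.log n) ≤ 2 * √(2 * Real.log n) := by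
    have : √(Real.log n) ≤ √(2 * Real.log n) := Real.sqrt_le_sqrt (by linarith)
    have := Real.sqrt_nonneg (Real.log n)
    linarith
  have h := abs_thetaAd_sub_le (θ := θ) (Y := Y) (qmax_even n) (by omega)
    (fun m => if m = qmax n then d else 2 * √(2 * Real.log n))
    (by rw [delta_qmax]; positivity) ?_ ?_
  · simpa using h
  · intro m hme h1 h2
    rcases h1.eq_or_lt with h3 | h3
    · subst h3
      rw [if_pos rfl, hc1]
      exact abs_le.2 ⟨by linarith [hcheb.1], by linarith [hcheb.2]⟩
    · rw [hlast m hme h3 h2, if_neg (by omega), hc2]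
      exact hmin
  · intro m hme h1 h2
    rw [hlast m hme h1 h2, if_pos rfl, if_neg (by omega), delta_last]
    linarith

lemma exp_neg_le_thr_qmax {n : ℕ} (hn : 1000 ≤ Real.log n) :
    Real.exp (-(4 * a)) ≤ thr n (qmax n) := by
  rw [thr_eq (pos_of_log hn), Real.exp_le_exp]
  linarith [(qmax_bounds hn).2.1]

lemma ratio_le_exp_qmax {n k : ℕ} (hn : 1000 ≤ Real.log n) (hkn : k < n) :
    (k : ℝ) / √(n : ℝ) ≤ Real.exp (a * ((qmax n + 4 : ℕ) : ℝ)) := by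
  have hn0 := pos_of_log hn
  have hn' : (0 : ℝ) < n := by exact_mod_cast hn0
  have hk' : (k : ℝ) ≤ n := by exact_mod_cast hkn.le
  have hs : √(n : ℝ) * √(n : ℝ) = n := Real.mul_self_sqrt hn'.le
  calc (k : ℝ) / √(n : ℝ) ≤ n / √(n : ℝ) := by gcongr
    _ = √(n : ℝ) := by rw [Real.div_sqrt]
    _ ≤ _ := by
      rw [sqrt_eq_exp hn0, Real.exp_le_exp]
      push_cast
      linarith [(qmax_bounds hn).2.1]

/-- The logarithm in the denominator of the rate is at most of the order of `qmax n`. -/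
lemma rate_ge_qmax {n k : ℕ} (hn : 1000 ≤ Real.log n) (hk : 1 ≤ k) (hkn : k < n) :
    logOdds n k ^ 2 / (63 * (qmax n * √(qmax n : ℝ))) ≤ rate n k := by
  refine le_trans ?_ (rate_ge_of_le_exp hk hkn (by omega) (ratio_le_exp_qmax hn hkn))
  have h50 := fifty_le_qmax hn
  have h1 : √((qmax n + 4 : ℕ) : ℝ) ≤ 1.5 * √(qmax n : ℝ) := by
    rw [Real.sqrt_le_left (by positivity), mul_pow, Real.sq_sqrt (by positivity)]
    push_cast; linarith
  have h2 : ((qmax n + 4 : ℕ) : ℝ) ≤ 2 * qmax n := by push_cast; linarith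
  refine div_le_div_of_nonneg_left (sq_nonneg _) (by positivity) ?_
  calc 21 * (((qmax n + 4 : ℕ) : ℝ) * √((qmax n + 4 : ℕ) : ℝ))
      ≤ 21 * (2 * qmax n * (1.5 * √(qmax n : ℝ))) := by gcongr
    _ = _ := by ring

/-- The threshold at the first index for which the contamination is below the noise level has the
order of the rate. -/
lemma delta_le_rate {n k Q : ℕ} (hn : 1000 ≤ Real.log n) (hk : 1 ≤ k) (hkn : k < n)
    (hQ2 : 2 ≤ Q) (hQ : Q ≤ qmax n) (hkQ : (k : ℝ) / n ≤ thr n Q)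
    (hmin : Q = 2 ∨ thr n (Q - 2) < (k : ℝ) / n) :
    delta n Q ≤ 3000 * Real.exp (6 * a) * rate n k := by
  have hn0 := pos_of_log hn
  have hn' : (0 : ℝ) < n := by exact_mod_cast hn0
  have ha := a_bounds.1
  have h50 := fifty_le_qmax hn
  have hQ' : (2 : ℝ) ≤ Q := by exact_mod_cast hQ2
  have hsQ : 1 ≤ √(Q : ℝ) := by rw [Real.le_sqrt' (by norm_num)]; linarith
  have hr := rate_pos hk hkn
  have h46 : Real.exp (4 * a) ≤ Real.exp (6 * a) := Real.exp_le_exp.2 (by linarith)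
  by_cases hQ2' : Q = 2
  · have hlt : 2 < qmax n := by
      have : (2 : ℝ) < qmax n := by linarith
      exact_mod_cast this
    have h1 := rate_ge_inv_sqrt hk hkn
    rw [hQ2', delta_of_lt hlt]
    have h2 : thr n 2 = Real.exp (2 * a) * (1 / √(n : ℝ)) := by
      rw [thr, mul_comm 2 a]; push_cast; ring
    have h3 : 1 / √(n : ℝ) ≤ 4 * rate n k := by
      have : 1 / (4 * √(n : ℝ)) = 1 / √(n : ℝ) / 4 := by rw [div_div, mul_comm]
      linarith
    calc 10 * Real.exp (2 * a) * thr n 2 / (((2 : ℕ) : ℝ) * √((2 : ℕ) : ℝ))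
        ≤ 10 * Real.exp (2 * a) * thr n 2 := by
          apply div_le_self
          · have := thr_pos hn0 2
            positivity
          · have : 1 ≤ √((2 : ℕ) : ℝ) := by rw [Real.le_sqrt' (by norm_num)]; norm_num
            push_cast at *
            linarith
      _ = 10 * Real.exp (4 * a) * (1 / √(n : ℝ)) := by
          rw [h2, show 4 * a = 2 * a + 2 * a by ring, Real.exp_add]; ring
      _ ≤ 10 * Real.exp (6 * a) * (4 * rate n k) := by gcongr
      _ ≤ _ := by
          have : 0 < Real.exp (6 * a) * rate n k := by positivity
          linarith
  · have h1 := hmin.resolve_left hQ2'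
    have hκ := rate_ge_of_le_exp hk hkn (by omega) ((div_le_thr_iff hn0 k Q).1 hkQ)
    have h2 := div_four_le_logOdds_sq hkn
    have hκ2 : (k : ℝ) / n / (Q * √(Q : ℝ)) ≤ 84 * rate n k := by
      have h3 : (k : ℝ) / n / 4 / (21 * (Q * √(Q : ℝ))) ≤ rate n k := le_trans (by gcongr) hκ
      have h4 : (k : ℝ) / n / 4 / (21 * (Q * √(Q : ℝ))) = (k : ℝ) / n / (Q * √(Q : ℝ)) / 84 := by
        field_simp; norm_num
      linarith
    rcases hQ.lt_or_eq with h | h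
    · rw [delta_of_lt h]
      have h3 : thr n Q = Real.exp (2 * a) * thr n (Q - 2) := by
        rw [← thr_add_two hn0]; congr 1; omega
      have h5 : thr n Q ≤ Real.exp (2 * a) * (k / n) := by rw [h3]; gcongr
      calc 10 * Real.exp (2 * a) * thr n Q / (Q * √(Q : ℝ))
          ≤ 10 * Real.exp (2 * a) * (Real.exp (2 * a) * (k / n)) / (Q * √(Q : ℝ)) := by gcongr
        _ = 10 * Real.exp (4 * a) * (k / n / (Q * √(Q : ℝ))) := by
            rw [show 4 * a = 2 * a + 2 * a by ring, Real.exp_add]; ring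
        _ ≤ 10 * Real.exp (6 * a) * (84 * rate n k) := by gcongr
        _ ≤ _ := by
            have : 0 < Real.exp (6 * a) * rate n k := by positivity
            linarith
    · have h3 : thr n Q = Real.exp (2 * a) * thr n (Q - 2) := by
        rw [← thr_add_two hn0]; congr 1; omega
      have h4 : 1 ≤ Real.exp (6 * a) * (k / n) := by
        have h5 := exp_neg_le_thr_qmax hn
        rw [← h, h3] at h5
        have h6 : Real.exp (6 * a) = Real.exp (4 * a) * Real.exp (2 * a) := by
          rw [← Real.exp_add]; congr 1; ring
        have h7 : Real.exp (4 * a) * Real.exp (-(4 * a)) = 1 := by rw [← Real.exp_add]; simp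
        calc 1 = Real.exp (4 * a) * Real.exp (-(4 * a)) := h7.symm
          _ ≤ Real.exp (4 * a) * (Real.exp (2 * a) * thr n (Q - 2)) := by gcongr
          _ ≤ Real.exp (4 * a) * (Real.exp (2 * a) * (k / n)) := by gcongr
          _ = _ := by rw [h6]; ring
      have h5 : delta n Q = 25 / (Q * √(Q : ℝ)) := by rw [h, delta_qmax]
      rw [h5]
      calc 25 / (Q * √(Q : ℝ)) = 25 * 1 / (Q * √(Q : ℝ)) := by ring
        _ ≤ 25 * (Real.exp (6 * a) * (k / n)) / (Q * √(Q : ℝ)) := by gcongr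
        _ = 25 * Real.exp (6 * a) * (k / n / (Q * √(Q : ℝ))) := by ring
        _ ≤ 25 * Real.exp (6 * a) * (84 * rate n k) := by gcongr
        _ ≤ _ := by
            have : 0 < Real.exp (6 * a) * rate n k := by positivity
            linarith

/-- For every `k` there is an index `Q` such that the error has the order of the rate if all noise
terms from `Q` on are small; if only those from `m + 2 > Q` on are small, it is still at most of
the order of `delta n (m + 2)`. -/
lemma exists_oracle : ∃ C : ℝ, 0 < C ∧ ∀ n k : ℕ, 1000 ≤ Real.log n → 1 ≤ k → k < n →
    ∃ Q, Even Q ∧ 2 ≤ Q ∧ Q ≤ qmax n ∧ (k : ℝ) / √(n : ℝ) ≤ Real.exp (a * ((Q + 4 : ℕ) : ℝ)) ∧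
      ∀ (θ : ℝ) (μ : Fin n → ℝ), μ ∈ sparse n k → ∀ Y ∈ mainEvent n k θ,
        ((∀ m, Even m → Q ≤ m → m ≤ qmax n → noise n m θ μ Y ≤ thr n m) →
          |thetaAd n Y - θ| ≤ C * rate n k) ∧
        ∀ m, Even m → Q ≤ m → m ≤ qmax n →
          (∀ m', Even m' → m + 2 ≤ m' → m' ≤ qmax n → noise n m' θ μ Y ≤ thr n m') →
          |thetaAd n Y - θ| ≤ 3 / 2 * delta n (m + 2) := by
  refine ⟨4500 * Real.exp (6 * a) + 63 * (100 * Real.exp 36 + bigD ^ 2) + 10584 * bigD ^ 4,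
    by positivity, fun n k hn hk hkn => ?_⟩
  have hn0 := pos_of_log hn
  have hr := rate_pos hk hkn
  have h50 := fifty_le_qmax hn
  have hq2 : 2 ≤ qmax n := by
    have : (2 : ℝ) ≤ qmax n := by linarith
    exact_mod_cast this
  rcases le_or_gt ((k : ℝ) / n) (thr n (qmax n)) with hcase | hcase
  · -- `Q` is the first even index at which the contamination is below the threshold
    classical
    have hex : ∃ Q, Even Q ∧ 2 ≤ Q ∧ (k : ℝ) / n ≤ thr n Q := ⟨qmax n, qmax_even n, hq2, hcase⟩
    obtain ⟨hQe, hQ2, hkQ⟩ := Nat.find_spec hex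
    have hQm : Nat.find hex ≤ qmax n := Nat.find_min' hex ⟨qmax_even n, hq2, hcase⟩
    have hmin : Nat.find hex = 2 ∨ thr n (Nat.find hex - 2) < (k : ℝ) / n := by
      by_cases h2 : Nat.find hex = 2
      · exact Or.inl h2
      · right
        by_contra! hle
        have hlt : Nat.find hex - 2 < Nat.find hex := by omega
        refine Nat.find_min hex hlt ⟨?_, ?_, hle⟩
        · obtain ⟨r, hr⟩ := hQe
          exact ⟨r - 1, by omega⟩
        · obtain ⟨r, hr⟩ := hQe
          omega
    set Q := Nat.find hex
    have hδ := delta_le_rate hn hk hkn hQ2 hQm hkQ hmin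
    have hkm : ∀ m, Q ≤ m → m ≤ qmax n → (k : ℝ) / n ≤ thr n m := fun m h1 _ =>
      hkQ.trans (thr_mono hn0 h1)
    refine ⟨Q, hQe, hQ2, hQm, ?_, fun θ μ hμ Y hY => ⟨fun hN => ?_, fun m hme hQm' hm hN => ?_⟩⟩
    · refine ((div_le_thr_iff hn0 k Q).1 hkQ).trans (Real.exp_le_exp.2 ?_)
      push_cast
      nlinarith [a_bounds.1]
    · refine (abs_thetaAd_sub_le_of_good hn hQe hQ2 (by omega) hμ hkm hY hN).trans ?_
      have h1 : 0 ≤ 63 * (100 * Real.exp 36 + bigD ^ 2) * rate n k := by positivity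
      have h2 : 0 ≤ 10584 * bigD ^ 4 * rate n k := by positivity
      linarith
    · exact abs_thetaAd_sub_le_of_good hn (by simpa [parity_simps] using hme) (by omega) (by omega)
        hμ (fun m' h1 h2 => hkm m' (by omega) h2) hY hN
  · -- the contamination exceeds every threshold, and `Q = qmax n`
    have hrate := rate_ge_qmax hn hk hkn
    have hq0 : (0 : ℝ) < qmax n := by linarith
    have hs0 : 0 < √(qmax n : ℝ) := by positivity
    have hsq : √(qmax n : ℝ) ^ 2 = qmax n := Real.sq_sqrt hq0.le
    have hkn36 : Real.exp (-36) ≤ (k : ℝ) / n := by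
      refine le_trans ?_ ((exp_neg_le_thr_qmax hn).trans hcase.le)
      rw [Real.exp_le_exp]; linarith [a_bounds.2]
    have hL : Real.exp (-18) / 2 ≤ logOdds n k := by
      refine le_trans ?_ (half_sqrt_le_logOdds hkn)
      have : Real.exp (-18) ≤ √((k : ℝ) / n) := by
        refine Real.le_sqrt_of_sq_le (le_trans (le_of_eq ?_) hkn36)
        rw [← Real.exp_nat_mul]; norm_num
      linarith
    refine ⟨qmax n, qmax_even n, hq2, le_rfl, ratio_le_exp_qmax hn hkn,
      fun θ μ hμ Y hY => ⟨fun hN => ?_, fun m hme h1 h2 _ => ?_⟩⟩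
    · rcases le_or_gt (2 * bigD ^ 2 * logOdds n k) (qmax n : ℝ) with hLq | hLq
      · refine (abs_thetaAd_sub_le_of_large hn hμ hkn hL hLq hY
          (hN _ (qmax_even n) le_rfl le_rfl)).trans ?_
        rw [delta_qmax]
        have h1 : 25 ≤ 100 * Real.exp 36 * logOdds n k ^ 2 := by
          have h2 := div_four_le_logOdds_sq hkn
          have h3 : Real.exp 36 * Real.exp (-36) = 1 := by rw [← Real.exp_add]; norm_num
          have h4 : Real.exp 36 * (Real.exp (-36) / 4) ≤ Real.exp 36 * logOdds n k ^ 2 := by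
            gcongr
            linarith
          linarith
        have h5 : 25 / (qmax n * √(qmax n : ℝ)) + bigD ^ 2 * logOdds n k ^ 2 / (qmax n * √(qmax n : ℝ))
            ≤ 63 * (100 * Real.exp 36 + bigD ^ 2) *
              (logOdds n k ^ 2 / (63 * (qmax n * √(qmax n : ℝ)))) := by
          calc _ = (25 + bigD ^ 2 * logOdds n k ^ 2) / (qmax n * √(qmax n : ℝ)) := by ring
            _ ≤ (100 * Real.exp 36 * logOdds n k ^ 2 + bigD ^ 2 * logOdds n k ^ 2) /
                (qmax n * √(qmax n : ℝ)) := by gcongr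
            _ = _ := by field_simp
        have h6 : 63 * (100 * Real.exp 36 + bigD ^ 2) *
              (logOdds n k ^ 2 / (63 * (qmax n * √(qmax n : ℝ)))) ≤
            63 * (100 * Real.exp 36 + bigD ^ 2) * rate n k := by gcongr
        have h7 : 0 ≤ 4500 * Real.exp (6 * a) * rate n k := by positivity
        have h8 : 0 ≤ 10584 * bigD ^ 4 * rate n k := by positivity
        linarith
      · -- so few observations are uncontaminated that `√(log n)` has the order of the rate
        refine (abs_thetaAd_sub_le_crude hn hY).trans ?_
        have hD3 : 0 < bigD := by unfold bigD; positivity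
        have h1 : √(2 * Real.log n) ≤ 7 * √(qmax n : ℝ) := by
          rw [Real.sqrt_le_left (by positivity), mul_pow, hsq]
          linarith [(qmax_bounds hn).2.2.1]
        have h2 : √(qmax n : ℝ) ≤ 252 * bigD ^ 4 * rate n k := by
          have h3 : (qmax n : ℝ) ^ 2 ≤ (2 * bigD ^ 2 * logOdds n k) ^ 2 := by gcongr
          calc √(qmax n : ℝ) = (qmax n : ℝ) ^ 2 / (qmax n * √(qmax n : ℝ)) := by
                field_simp
                rw [hsq]
            _ ≤ (2 * bigD ^ 2 * logOdds n k) ^ 2 / (qmax n * √(qmax n : ℝ)) := by gcongr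
            _ = 252 * bigD ^ 4 * (logOdds n k ^ 2 / (63 * (qmax n * √(qmax n : ℝ)))) := by
                field_simp; ring
            _ ≤ _ := by gcongr
        have h7 : 0 ≤ 4500 * Real.exp (6 * a) * rate n k := by positivity
        have h8 : 0 ≤ 63 * (100 * Real.exp 36 + bigD ^ 2) * rate n k := by positivity
        linarith
    · have h3 : m = qmax n := by omega
      rw [h3, delta_last]
      linarith [abs_thetaAd_sub_le_crude hn hY]

end GOSC
end

noncomputable section
namespace GOSC
open MeasureTheory ProbabilityTheory

/-! ### Tail and expectation of the error -/

lemma sum_Icc_half_pow_le (Q N : ℕ) : ∑ m ∈ Finset.Icc Q N, (1 / 2 : ℝ) ^ (m - Q) ≤ 2 := by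
  rw [← Finset.Ico_add_one_right_eq_Icc, Finset.sum_Ico_eq_sum_range]
  simp only [Nat.add_sub_cancel_left]
  exact sum_geometric_two_le _

lemma measurableSet_mainEvent {n : ℕ} (hn : 1 ≤ n) (k : ℕ) (θ : ℝ) :
    MeasurableSet (mainEvent n k θ) := by
  have h1 := measurable_orderStat (n := n) le_rfl hn
  have h2 := measurable_thetaMed hn
  refine (measurableSet_le measurable_const h1).inter
    ((measurableSet_le h1 measurable_const).inter ?_)
  by_cases hk : (k : ℝ) ≤ (n : ℝ) ^ (4 / 5 : ℝ)
  · simp only [hk, forall_const]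
    exact measurableSet_le h2 measurable_const
  · simp only [hk, false_imp_iff]
    exact MeasurableSet.const True

/-- The exponent `3 / 4` is larger than what is needed: `2 / 3` for the bound in probability, and `1 / 2`,
with room for a factor `√(log n)`, for the expectation. -/
lemma law_compl_mainEvent_le {n k : ℕ} (hn : 1000 ≤ Real.log n) (θ : ℝ)
    {μ : Fin n → ℝ} (hμ : μ ∈ sparse n k) {i₀ : Fin n} (h0 : μ i₀ = 0) :
    (law n θ μ).real (mainEvent n k θ)ᶜ ≤ 3 * Real.exp (-(3 / 4 * Real.log n)) := by
  have hn0 := pos_of_log hn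
  have hn' : (0 : ℝ) < n := by exact_mod_cast hn0
  set l := Real.log n with hl
  have hexp : (n : ℝ) = Real.exp l := (Real.exp_log hn').symm
  have hq50 := fifty_le_qmax hn
  have hql : (qmax n : ℝ) ≤ l / 16 := (qmax_bounds hn).2.2.2.1
  set t := Real.pi ^ 2 / (144 * (qmax n : ℝ) ^ (3 / 2 : ℝ)) with ht
  have hq3 : ((qmax n : ℝ) ^ (3 / 2 : ℝ)) ^ 2 = (qmax n : ℝ) ^ 3 := by
    rw [← Real.rpow_natCast, ← Real.rpow_mul (by positivity)]
    norm_num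
  have hq1 : (1 : ℝ) ≤ (qmax n : ℝ) ^ (3 / 2 : ℝ) := Real.one_le_rpow (by linarith) (by norm_num)
  set R := (qmax n : ℝ) ^ (3 / 2 : ℝ)
  have hpi3 := Real.pi_gt_three
  have hpi4 := Real.pi_le_four
  have htlow : 1 / (16 * R) ≤ t := by
    rw [ht, div_le_div_iff₀ (by positivity) (by positivity)]
    have h9 : 9 * R ≤ Real.pi ^ 2 * R := by
      gcongr
      nlinarith
    linarith
  have ht1 : t ≤ 1 := by
    rw [ht, div_le_one (by positivity)]
    nlinarith
  have ht0 : 0 < t := lt_of_lt_of_le (by positivity) htlow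
  have hR : R ≤ l ^ 2 / 256 := by
    have h1 : R ^ 2 ≤ (l ^ 2 / 256) ^ 2 := by
      rw [hq3]
      calc (qmax n : ℝ) ^ 3 ≤ (l / 16) ^ 3 := by gcongr
        _ = l ^ 3 / 4096 := by ring
        _ ≤ (l ^ 2 / 256) ^ 2 := by
          have : 0 ≤ l ^ 3 := by positivity
          nlinarith
    exact (abs_le_of_sq_le_sq' h1 (by positivity)).2
  set A1 : Set (Fin n → ℝ) := {Y | orderStat Y 1 < θ - 1.9 * √l}
  set A2 : Set (Fin n → ℝ) := {Y | θ + √(2 * l) < orderStat Y 1}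
  set A3 : Set (Fin n → ℝ) := {Y | (k : ℝ) ≤ (n : ℝ) ^ (4 / 5 : ℝ) ∧ θ + t < thetaMed n Y}
  have hsub : (mainEvent n k θ)ᶜ ⊆ A1 ∪ A2 ∪ A3 := by
    intro Y hY
    by_contra hcon
    simp only [A1, A2, A3, Set.mem_union, Set.mem_ofPred_eq, not_or, not_lt, not_and] at hcon
    exact hY ⟨hcon.1.1, hcon.1.2, fun h => hcon.2 h⟩
  have hb1 : (law n θ μ).real A1 ≤ Real.exp (-(3 / 4 * l)) := by
    refine (law_orderStat_one_lt hn0 θ hμ.1 (by positivity)).trans ?_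
    rw [mul_pow, Real.sq_sqrt (by linarith), hexp, ← Real.exp_add, Real.exp_le_exp]
    linarith
  have hb2 : (law n θ μ).real A2 ≤ Real.exp (-(3 / 4 * l)) := by
    refine (law_lt_orderStat_one hn0 θ h0 (Real.sqrt_nonneg _)).trans ?_
    rw [Real.sq_sqrt (by linarith), Real.exp_le_exp]
    linarith
  have hb3 : (law n θ μ).real A3 ≤ Real.exp (-(3 / 4 * l)) := by
    by_cases hk : (k : ℝ) ≤ (n : ℝ) ^ (4 / 5 : ℝ)
    · have hA3 : A3 = {Y | θ + t < thetaMed n Y} := by simp [A3, hk]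
      have hkt : (k : ℝ) ≤ n * t / 10 := by
        have h1 : (n : ℝ) ^ (4 / 5 : ℝ) = n * Real.exp (-(l / 5)) := by
          rw [Real.rpow_def_of_pos hn', ← hl]
          nth_rw 1 [hexp]
          rw [← Real.exp_add]; congr 1; ring
        have h2 : Real.exp (-(l / 5)) ≤ 1 / (16 * R) / 10 := by
          have h3 := Real.pow_div_factorial_le_exp (l / 5) (by positivity) 4
          norm_num [Nat.factorial] at h3
          have h4 : 160 * R ≤ Real.exp (l / 5) := by
            refine le_trans ?_ h3
            have : (l / 5) ^ 4 / 24 = l ^ 2 * l ^ 2 / 15000 := by ring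
            rw [this]
            have h5 : (1000 : ℝ) ^ 2 * l ^ 2 ≤ l ^ 2 * l ^ 2 := by gcongr
            linarith
          rw [Real.exp_neg, div_div, one_div]
          gcongr
          linarith
        rw [h1] at hk
        calc (k : ℝ) ≤ n * Real.exp (-(l / 5)) := hk
          _ ≤ n * (t / 10) := by
            gcongr
            linarith
          _ = _ := by ring
      rw [hA3]
      refine (law_lt_thetaMed hn0 θ hμ ht0 ht1 hkt).trans ?_
      have h5 : 1 / (256 * (qmax n : ℝ) ^ 3) ≤ t ^ 2 := by
        have : 1 / (256 * (qmax n : ℝ) ^ 3) = (1 / (16 * R)) ^ 2 := by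
          rw [← hq3]; field_simp; norm_num
        rw [this]
        gcongr
      have h6 : 25600 * (qmax n : ℝ) ^ 3 ≤ Real.exp (l / 4) := by
        have h3 := Real.pow_div_factorial_le_exp (l / 4) (by positivity) 6
        norm_num [Nat.factorial] at h3
        refine le_trans ?_ h3
        calc 25600 * (qmax n : ℝ) ^ 3 ≤ 25600 * (l / 16) ^ 3 := by gcongr
          _ = l ^ 3 * 6.25 := by ring
          _ ≤ l ^ 3 * (l ^ 3 / 2949120) := by
              gcongr
              have : (1000 : ℝ) ^ 3 ≤ l ^ 3 := by gcongr
              linarith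
          _ = _ := by ring
      calc 100 / ((n : ℝ) * t ^ 2) ≤ 100 / (n * (1 / (256 * (qmax n : ℝ) ^ 3))) := by gcongr
        _ = 25600 * (qmax n : ℝ) ^ 3 / n := by field_simp; norm_num
        _ ≤ Real.exp (l / 4) / n := by gcongr
        _ = _ := by
          nth_rw 1 [hexp]
          rw [← Real.exp_sub]; congr 1; ring
    · have hA3 : A3 = ∅ := by
        ext Y; simp [A3, hk]
      rw [hA3, measureReal_empty]
      positivity
  have h1 := measureReal_mono (μ := law n θ μ) hsub
  have h2 := measureReal_union_le (μ := law n θ μ) (A1 ∪ A2) A3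
  have h3 := measureReal_union_le (μ := law n θ μ) A1 A2
  linarith

lemma exists_eq_zero_of_sparse {n k : ℕ} (hkn : k < n) {μ : Fin n → ℝ} (hμ : μ ∈ sparse n k) :
    ∃ i, μ i = 0 := by
  by_contra! h
  have h1 : (Finset.univ.filter fun i => μ i ≠ 0) = Finset.univ :=
    Finset.filter_true_of_mem fun i _ => h i
  have h2 := hμ.2
  rw [h1] at h2
  simp at h2
  omega

/-- A union bound over the levels from `Q` on, whose failure probabilities decay geometrically. -/
lemma tail_le {n k Q : ℕ} (hn : 1000 ≤ Real.log n) (hkn : k < n) (hQ2 : 2 ≤ Q)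
    {θ r : ℝ} {μ : Fin n → ℝ} (hμ : μ ∈ sparse n k)
    (h : ∀ Y ∈ mainEvent n k θ, (∀ m, Even m → Q ≤ m → m ≤ qmax n → noise n m θ μ Y ≤ thr n m) →
      |thetaAd n Y - θ| ≤ r) :
    (law n θ μ).real {Y | r < |thetaAd n Y - θ|} ≤
      3 * Real.exp (-(3 / 4 * Real.log n)) + 2 * Real.exp (-(4 * a * Q / 3)) := by
  obtain ⟨i₀, h0⟩ := exists_eq_zero_of_sparse hkn hμ
  have hsub : {Y | r < |thetaAd n Y - θ|} ⊆ (mainEvent n k θ)ᶜ ∪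
      ⋃ m ∈ Finset.Icc Q (qmax n), {Y | thr n m < noise n m θ μ Y} := by
    intro Y hY
    by_contra hcon
    simp only [Set.mem_union, Set.mem_compl_iff, Set.mem_iUnion, Finset.mem_Icc, exists_prop,
      Set.mem_ofPred_eq, not_or, not_not, not_exists, not_and, not_lt] at hcon
    have hY' : r < |thetaAd n Y - θ| := hY
    linarith [h Y hcon.1 fun m _ h1 h2 => hcon.2 m ⟨h1, h2⟩]
  have h1 := measureReal_mono (μ := law n θ μ) hsub
  have h2 := measureReal_union_le (μ := law n θ μ) (mainEvent n k θ)ᶜ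
    (⋃ m ∈ Finset.Icc Q (qmax n), {Y | thr n m < noise n m θ μ Y})
  have h3 := measureReal_biUnion_finset_le (μ := law n θ μ) (Finset.Icc Q (qmax n))
    fun m => {Y | thr n m < noise n m θ μ Y}
  have h4 : ∑ m ∈ Finset.Icc Q (qmax n), (law n θ μ).real {Y | thr n m < noise n m θ μ Y} ≤
      2 * Real.exp (-(4 * a * Q / 3)) := by
    calc _ ≤ ∑ m ∈ Finset.Icc Q (qmax n), (1 / 2 : ℝ) ^ (m - Q) * Real.exp (-(4 * a * Q / 3)) := by
          refine Finset.sum_le_sum fun m hm => ?_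
          obtain ⟨hm1, hm2⟩ := Finset.mem_Icc.1 hm
          refine (noise_tail (pos_of_log hn) (by omega) θ hμ.1).trans ?_
          have e1 : Real.exp (-(4 * a * m / 3)) =
              Real.exp (-(4 * a / 3)) ^ (m - Q) * Real.exp (-(4 * a * Q / 3)) := by
            rw [← Real.exp_nat_mul, ← Real.exp_add, Nat.cast_sub hm1]; congr 1; ring
          rw [e1]
          gcongr
          have h5 : Real.exp (-(4 * a / 3)) ≤ Real.exp (-1) :=
            Real.exp_le_exp.2 (by linarith [a_bounds.1])
          linarith [Real.exp_neg_one_lt_d9]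
      _ ≤ _ := by
          rw [← Finset.sum_mul]
          gcongr
          exact sum_Icc_half_pow_le _ _
  linarith [law_compl_mainEvent_le hn θ hμ h0]

/-- The probability that level `m` fails outweighs the size of the error in that case. -/
lemma delta_mul_exp_le {n m : ℕ} (hn : 1000 ≤ Real.log n) (hme : Even m)
    (hm2 : 2 ≤ m) (hm : m ≤ qmax n) :
    delta n (m + 2) * Real.exp (-(4 * a * m / 3)) ≤
      28 * Real.exp (6 * a) * ((1 / 2) ^ m * (1 / √(n : ℝ))) := by
  have hn0 := pos_of_log hn
  have ha := a_bounds.1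
  have hx := thr_pos hn0 m
  have hm2' : (2 : ℝ) ≤ m := by exact_mod_cast hm2
  have hbase : Real.exp m * (thr n m * Real.exp (-(4 * a * m / 3))) ≤
      (1 / 2) ^ m * (1 / √(n : ℝ)) := by
    have h1 : Real.exp m * (thr n m * Real.exp (-(4 * a * m / 3))) =
        Real.exp (m - a * m / 3) * (1 / √(n : ℝ)) := by
      have : Real.exp (m - a * m / 3) =
          Real.exp m * (Real.exp (a * m) * Real.exp (-(4 * a * m / 3))) := by
        rw [← Real.exp_add, ← Real.exp_add]; congr 1; ring
      rw [thr, this]; ring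
    rw [h1]
    gcongr
    have h2 : Real.exp (m - a * m / 3) ≤ Real.exp (-1) ^ m := by
      rw [← Real.exp_nat_mul, Real.exp_le_exp]
      nlinarith
    refine h2.trans ?_
    gcongr
    linarith [Real.exp_neg_one_lt_d9]
  have hbound : delta n (m + 2) ≤ 28 * Real.exp (6 * a) * (Real.exp m * thr n m) := by
    have hem : 1 ≤ Real.exp (m : ℝ) := Real.one_le_exp (by positivity)
    have h46 : Real.exp (4 * a) ≤ Real.exp (6 * a) := Real.exp_le_exp.2 (by linarith)
    have hsm : 1 ≤ √((m + 2 : ℕ) : ℝ) := by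
      rw [Real.le_sqrt' (by norm_num)]; push_cast; linarith
    have hden : 1 ≤ ((m + 2 : ℕ) : ℝ) * √((m + 2 : ℕ) : ℝ) := by
      have : (1 : ℝ) ≤ ((m + 2 : ℕ) : ℝ) := by push_cast; linarith
      nlinarith
    rcases lt_trichotomy (m + 2) (qmax n) with h | h | h
    · rw [delta_of_lt h, thr_add_two hn0]
      calc _ ≤ 10 * Real.exp (2 * a) * (Real.exp (2 * a) * thr n m) :=
            div_le_self (by positivity) hden
        _ = 10 * Real.exp (4 * a) * (1 * thr n m) := by
            rw [show 4 * a = 2 * a + 2 * a by ring, Real.exp_add]; ring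
        _ ≤ 28 * Real.exp (6 * a) * (Real.exp m * thr n m) := by gcongr; norm_num
    · have h1 := exp_neg_le_thr_qmax hn
      rw [← h, thr_add_two hn0] at h1
      have h2 : 1 ≤ Real.exp (6 * a) * thr n m := by
        have h7 : Real.exp (4 * a) * Real.exp (-(4 * a)) = 1 := by rw [← Real.exp_add]; simp
        calc 1 = Real.exp (4 * a) * Real.exp (-(4 * a)) := h7.symm
          _ ≤ Real.exp (4 * a) * (Real.exp (2 * a) * thr n m) := by gcongr
          _ = _ := by
            rw [show 6 * a = 4 * a + 2 * a by ring, Real.exp_add]; ring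
      rw [h, delta_qmax, ← h]
      calc _ ≤ (25 : ℝ) := div_le_self (by norm_num) hden
        _ ≤ 28 * (Real.exp (6 * a) * thr n m) * 1 := by linarith
        _ ≤ 28 * (Real.exp (6 * a) * thr n m) * Real.exp m := by gcongr
        _ = _ := by ring
    · have hmq : m = qmax n := by
        obtain ⟨r, hr⟩ := hme
        obtain ⟨s, hs⟩ := qmax_even n
        omega
      have h1 := exp_neg_le_thr_qmax hn
      rw [← hmq] at h1
      have h2 : 1 ≤ Real.exp (6 * a) * thr n m := by
        have h7 : Real.exp (4 * a) * Real.exp (-(4 * a)) = 1 := by rw [← Real.exp_add]; simp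
        calc 1 = Real.exp (4 * a) * Real.exp (-(4 * a)) := h7.symm
          _ ≤ Real.exp (6 * a) * thr n m := by gcongr
      have h3 : √(2 * Real.log n) ≤ 7 * Real.exp m := by
        rw [Real.sqrt_le_left (by positivity), mul_pow]
        have h4 := (qmax_bounds hn).2.2.1
        rw [← hmq] at h4
        have h5 := Real.add_one_le_exp (m : ℝ)
        nlinarith
      rw [hmq, delta_last, ← hmq]
      calc 4 * √(2 * Real.log n) ≤ 4 * (7 * Real.exp m) * 1 := by linarith
        _ ≤ 4 * (7 * Real.exp m) * (Real.exp (6 * a) * thr n m) := by gcongr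
        _ = _ := by ring
  calc delta n (m + 2) * Real.exp (-(4 * a * m / 3))
      ≤ 28 * Real.exp (6 * a) * (Real.exp m * thr n m) * Real.exp (-(4 * a * m / 3)) := by gcongr
    _ = 28 * Real.exp (6 * a) * (Real.exp m * (thr n m * Real.exp (-(4 * a * m / 3)))) := by ring
    _ ≤ _ := by gcongr

lemma minExcess_nonneg {n : ℕ} (θ t : ℝ) (i₀ : Fin n) (Y : Fin n → ℝ) :
    0 ≤ minExcess θ t i₀ Y := by
  unfold minExcess; positivity

/-- The good event is split according to the last level at which the noise exceeds its threshold; by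
`delta_mul_exp_le` these levels contribute a geometric series. Off the good event, the error is that
of the minimum up to the order `√(log n)`. -/
lemma expectation_le {n k Q : ℕ} (hn : 1000 ≤ Real.log n) (hkn : k < n) (hQ2 : 2 ≤ Q)
    {θ r : ℝ} (hr : 0 ≤ r) {μ : Fin n → ℝ} (hμ : μ ∈ sparse n k)
    (h : ∀ Y ∈ mainEvent n k θ,
      ((∀ m, Even m → Q ≤ m → m ≤ qmax n → noise n m θ μ Y ≤ thr n m) →
          |thetaAd n Y - θ| ≤ r) ∧
        ∀ m, Even m → Q ≤ m → m ≤ qmax n →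
          (∀ m', Even m' → m + 2 ≤ m' → m' ≤ qmax n → noise n m' θ μ Y ≤ thr n m') →
          |thetaAd n Y - θ| ≤ 3 / 2 * delta n (m + 2)) :
    Integrable (fun Y => |thetaAd n Y - θ|) (law n θ μ) ∧
      ∫ Y, |thetaAd n Y - θ| ∂(law n θ μ) ≤ r + (84 * Real.exp (6 * a) + 23) / √(n : ℝ) := by
  obtain ⟨i₀, h0⟩ := exists_eq_zero_of_sparse hkn hμ
  have hn0 := pos_of_log hn
  have hn' : (0 : ℝ) < n := by exact_mod_cast hn0
  set l := Real.log n with hl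
  have hexp : (n : ℝ) = Real.exp l := (Real.exp_log hn').symm
  set S := (Finset.Icc Q (qmax n)).filter Even with hS
  set t := 2 * √l with ht
  have hsl : (10 : ℝ) ≤ √l := by rw [Real.le_sqrt' (by norm_num)]; linarith
  have hs2l : √l ≤ √(2 * l) := Real.sqrt_le_sqrt (by linarith)
  set B := 7 * √(2 * l) with hB
  set G : ℕ → Set (Fin n → ℝ) := fun m => {Y | thr n m < noise n m θ μ Y} with hG
  have hGm : ∀ m, MeasurableSet (G m) := fun m =>
    measurableSet_lt measurable_const (measurable_noise n m θ μ)
  have hMm := (measurableSet_mainEvent hn0 k θ).compl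
  obtain ⟨hVi, hVb⟩ := integral_minExcess θ hμ.1 h0 (t := t) (by positivity)
  have hV0 : ∀ Y : Fin n → ℝ, 0 ≤ minExcess θ t i₀ Y := minExcess_nonneg θ t i₀
  set F : (Fin n → ℝ) → ℝ := fun Y => r + (∑ m ∈ S, (G m).indicator (fun _ => 3 / 2 * delta n (m + 2)) Y)
    + ((mainEvent n k θ)ᶜ.indicator (fun _ => B) Y + minExcess θ t i₀ Y) with hF
  have hind0 : ∀ Y m, 0 ≤ (G m).indicator (fun _ => 3 / 2 * delta n (m + 2)) Y := fun Y m =>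
    Set.indicator_nonneg (fun _ _ => mul_nonneg (by norm_num) (delta_nonneg n _)) _
  have hpt : ∀ Y, |thetaAd n Y - θ| ≤ F Y := by
    intro Y
    have hsum0 : 0 ≤ ∑ m ∈ S, (G m).indicator (fun _ => 3 / 2 * delta n (m + 2)) Y :=
      Finset.sum_nonneg fun m _ => hind0 Y m
    have hv := hV0 Y
    by_cases hY : Y ∈ mainEvent n k θ
    · have hnot : Y ∉ (mainEvent n k θ)ᶜ := fun hc => hc hY
      simp only [hF, Set.indicator_of_notMem hnot]
      by_cases hall : ∀ m, Even m → Q ≤ m → m ≤ qmax n → noise n m θ μ Y ≤ thr n m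
      · linarith [(h Y hY).1 hall]
      · -- the last level at which the noise exceeds its threshold
        push Not at hall
        obtain ⟨m₁, a1, a2, a3, a4⟩ := hall
        have hne : (S.filter fun m => thr n m < noise n m θ μ Y).Nonempty :=
          ⟨m₁, Finset.mem_filter.2
            ⟨Finset.mem_filter.2 ⟨Finset.mem_Icc.2 ⟨a2, a3⟩, a1⟩, a4⟩⟩
        obtain ⟨m, hm, hmax⟩ := Finset.exists_max_image _ id hne
        simp only [hS, Finset.mem_filter, Finset.mem_Icc, id] at hm hmax
        have h1 := (h Y hY).2 m hm.1.2 hm.1.1.1 hm.1.1.2 (by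
          intro m' b1 b2 b3
          by_contra! hlt
          have := hmax m' ⟨⟨⟨by omega, b3⟩, b1⟩, hlt⟩
          omega)
        have h2 := Finset.single_le_sum (f := fun m =>
          (G m).indicator (fun _ => 3 / 2 * delta n (m + 2)) Y) (fun m _ => hind0 Y m)
          (Finset.mem_filter.2 ⟨Finset.mem_Icc.2 hm.1.1, hm.1.2⟩ : m ∈ S)
        have h3 : (G m).indicator (fun _ => 3 / 2 * delta n (m + 2)) Y = 3 / 2 * delta n (m + 2) :=
          Set.indicator_of_mem (show Y ∈ G m from hm.2) _
        simp only [h3] at h2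
        linarith
    · have hmem : Y ∈ (mainEvent n k θ)ᶜ := hY
      simp only [hF, Set.indicator_of_mem hmem]
      have h1 := abs_thetaAd_sub_thetaMin_le Y
      obtain ⟨h2, h3⟩ := gaussTailInv_mem (three_le_of_log hn)
      have h4 := abs_le.1 (abs_orderStat_one_sub_le hn0 θ (show 1 ≤ t by linarith) i₀ Y)
      have h5 : |thetaMin n Y - θ| ≤ √(2 * l) + (t + minExcess θ t i₀ Y) := by
        unfold thetaMin
        exact abs_le.2 ⟨by linarith, by linarith⟩
      have h6 := abs_sub_le (thetaAd n Y) (thetaMin n Y) θ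
      linarith
  have hi1 : ∀ m, Integrable ((G m).indicator fun _ => 3 / 2 * delta n (m + 2)) (law n θ μ) :=
    fun m => (integrable_const _).indicator (hGm m)
  have hi2 : Integrable ((mainEvent n k θ)ᶜ.indicator fun _ => B) (law n θ μ) :=
    (integrable_const _).indicator hMm
  have hi3 : Integrable (fun Y => ∑ m ∈ S, (G m).indicator (fun _ => 3 / 2 * delta n (m + 2)) Y)
      (law n θ μ) := integrable_finsetSum _ fun m _ => hi1 m
  have hFi : Integrable F (law n θ μ) :=
    ((integrable_const r).add hi3).add (hi2.add hVi)
  have hmeas : Measurable fun Y => |thetaAd n Y - θ| := ((measurable_thetaAd hn0).sub_const θ).abs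
  have hint : Integrable (fun Y => |thetaAd n Y - θ|) (law n θ μ) :=
    hFi.mono' hmeas.aestronglyMeasurable (Filter.Eventually.of_forall fun Y => by
      rw [Real.norm_eq_abs, abs_abs]; exact hpt Y)
  refine ⟨hint, (integral_mono hint hFi hpt).trans ?_⟩
  have e1 : ∫ Y, F Y ∂(law n θ μ) = r + (∑ m ∈ S, (law n θ μ).real (G m) * (3 / 2 * delta n (m + 2)))
      + ((law n θ μ).real (mainEvent n k θ)ᶜ * B + ∫ Y, minExcess θ t i₀ Y ∂(law n θ μ)) := by
    have j1 := integral_add ((integrable_const r).add hi3) (hi2.add hVi)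
    have j2 := integral_add (integrable_const r) hi3
    have j3 := integral_add hi2 hVi
    simp only [Pi.add_apply] at j1 j2 j3
    simp only [hF]
    rw [j1, j2, j3, integral_finsetSum _ fun m _ => hi1 m, integral_indicator_const _ hMm]
    simp only [integral_indicator_const _ (hGm _), smul_eq_mul, integral_const, probReal_univ, one_mul]
  rw [e1]
  have hsn : 0 < √(n : ℝ) := by positivity
  have b1 : ∑ m ∈ S, (law n θ μ).real (G m) * (3 / 2 * delta n (m + 2)) ≤
      84 * Real.exp (6 * a) / √(n : ℝ) := by
    calc _ ≤ ∑ m ∈ S, (1 / 2 : ℝ) ^ (m - Q) * (42 * Real.exp (6 * a) / √(n : ℝ)) := by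
          refine Finset.sum_le_sum fun m hm => ?_
          simp only [hS, Finset.mem_filter, Finset.mem_Icc] at hm
          have h1 := noise_tail hn0 (show 0 < m by omega) θ hμ.1
          have h2 := delta_mul_exp_le hn hm.2 (by omega) hm.1.2
          have h3 : (1 / 2 : ℝ) ^ m ≤ (1 / 2) ^ (m - Q) :=
            pow_le_pow_of_le_one (by norm_num) (by norm_num) (by omega)
          have h4 : (law n θ μ).real (G m) * delta n (m + 2) ≤
              28 * Real.exp (6 * a) * ((1 / 2) ^ (m - Q) * (1 / √(n : ℝ))) := by
            calc _ ≤ Real.exp (-(4 * a * m / 3)) * delta n (m + 2) :=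
                  mul_le_mul_of_nonneg_right h1 (delta_nonneg n _)
              _ ≤ 28 * Real.exp (6 * a) * ((1 / 2) ^ m * (1 / √(n : ℝ))) := by
                  rw [mul_comm]; exact h2
              _ ≤ _ := by gcongr
          calc _ = 3 / 2 * ((law n θ μ).real (G m) * delta n (m + 2)) := by ring
            _ ≤ 3 / 2 * (28 * Real.exp (6 * a) * ((1 / 2) ^ (m - Q) * (1 / √(n : ℝ)))) := by gcongr
            _ = _ := by ring
      _ ≤ ∑ m ∈ Finset.Icc Q (qmax n), (1 / 2 : ℝ) ^ (m - Q) * (42 * Real.exp (6 * a) / √(n : ℝ)) :=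
          Finset.sum_le_sum_of_subset_of_nonneg (Finset.filter_subset _ _)
            fun _ _ _ => by positivity
      _ ≤ 2 * (42 * Real.exp (6 * a) / √(n : ℝ)) := by
          rw [← Finset.sum_mul]
          gcongr
          exact sum_Icc_half_pow_le _ _
      _ = _ := by ring
  have hinv : 1 / √(n : ℝ) = Real.exp (-(l / 2)) := by
    rw [sqrt_eq_exp hn0, Real.exp_neg, one_div]
  have b2 : (law n θ μ).real (mainEvent n k θ)ᶜ * B ≤ 21 / √(n : ℝ) := by
    have h1 := law_compl_mainEvent_le hn θ hμ h0
    have h2 : √(2 * l) ≤ Real.exp (l / 4) := by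
      rw [Real.sqrt_le_left (by positivity), ← Real.exp_nat_mul]
      have h3 := Real.pow_div_factorial_le_exp (l / 2) (by positivity) 2
      norm_num [Nat.factorial] at h3
      have h4 : (2 : ℕ) * (l / 4) = l / 2 := by push_cast; ring
      rw [h4]
      nlinarith
    calc _ ≤ 3 * Real.exp (-(3 / 4 * l)) * (7 * Real.exp (l / 4)) := by
          rw [hB]; gcongr
      _ = 21 * (Real.exp (-(3 / 4 * l)) * Real.exp (l / 4)) := by ring
      _ = 21 * (1 / √(n : ℝ)) := by
          rw [hinv, ← Real.exp_add]; congr 2; ring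
      _ = _ := by ring
  have b3 : ∫ Y, minExcess θ t i₀ Y ∂(law n θ μ) ≤ 2 / √(n : ℝ) := by
    refine hVb.trans ?_
    have h1 : t ^ 2 / 2 = 2 * l := by rw [ht, mul_pow, Real.sq_sqrt (by linarith)]; ring
    have h2 : (n : ℝ) + 1 ≤ 2 * n := by
      have : (1 : ℝ) ≤ n := by exact_mod_cast hn0
      linarith
    rw [h1]
    calc ((n : ℝ) + 1) * Real.exp (-(2 * l)) ≤ 2 * n * Real.exp (-(2 * l)) := by gcongr
      _ = 2 * Real.exp (-l) := by
          nth_rw 1 [hexp]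
          rw [mul_assoc, ← Real.exp_add]; congr 2; ring
      _ ≤ 2 * (1 / √(n : ℝ)) := by
          rw [hinv]; gcongr; linarith
      _ = _ := by ring
  have e2 : (84 * Real.exp (6 * a) + 23) / √(n : ℝ) =
    84 * Real.exp (6 * a) / √(n : ℝ) + (21 / √(n : ℝ) + 2 / √(n : ℝ)) := by ring
  rw [e2]
  linarith

theorem exists_upper_bounds : ∃ c₁ c₂ c₃ : ℝ, 0 < c₁ ∧ 0 < c₂ ∧ 0 < c₃ ∧
    ∀ n k : ℕ, 1000 ≤ Real.log n → 1 ≤ k → k < n → ∀ (θ : ℝ) (μ : Fin n → ℝ), μ ∈ sparse n k →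
      (law n θ μ).real {Y | c₁ * rate n k < |thetaAd n Y - θ|} ≤
        c₂ * (√(n : ℝ) / max (k : ℝ) √(n : ℝ)) ^ (4 / 3 : ℝ) *
          Real.log (max (k : ℝ) (2 * √(n : ℝ)) / √(n : ℝ)) ^ 3 ∧
      Integrable (fun Y => |thetaAd n Y - θ|) (law n θ μ) ∧
      ∫ Y, |thetaAd n Y - θ| ∂(law n θ μ) ≤ c₃ * rate n k := by
  obtain ⟨C, hC, hor⟩ := exists_oracle
  have hlog2 : 0 < Real.log 2 := Real.log_pos (by norm_num)
  refine ⟨C, (3 + 2 * Real.exp (16 * a / 3)) / Real.log 2 ^ 3,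
    C + 4 * (84 * Real.exp (6 * a) + 23), hC, by positivity, by positivity, ?_⟩
  intro n k hn hk hkn θ μ hμ
  have hn0 := pos_of_log hn
  have hn' : (0 : ℝ) < n := by exact_mod_cast hn0
  have hn1 : (1 : ℝ) ≤ n := by exact_mod_cast hn0
  have hk0 : (0 : ℝ) ≤ k := by positivity
  have hkn' : (k : ℝ) ≤ n := by exact_mod_cast hkn.le
  have hs0 : 0 < √(n : ℝ) := by positivity
  have hr := rate_pos hk hkn
  obtain ⟨Q, -, hQ2, hQm, hQk, hQ⟩ := hor n k hn hk hkn
  refine ⟨?_, ?_⟩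
  · refine (tail_le hn hkn hQ2 hμ fun Y hY => (hQ θ μ hμ Y hY).1).trans ?_
    set M := max (k : ℝ) √(n : ℝ) with hM
    have hM0 : 0 < M := lt_max_of_lt_right hs0
    have h1 : Real.exp (-(3 / 4 * Real.log n)) ≤ (√(n : ℝ) / M) ^ (4 / 3 : ℝ) := by
      have h2 : 1 / √(n : ℝ) ≤ √(n : ℝ) / M := by
        rw [div_le_div_iff₀ hs0 hM0, one_mul, Real.mul_self_sqrt hn'.le]
        refine max_le hkn' ?_
        rw [Real.sqrt_le_left hn'.le]
        nlinarith
      calc _ ≤ Real.exp (-(Real.log n / 2) * (4 / 3)) := by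
            rw [Real.exp_le_exp]; linarith
        _ = (1 / √(n : ℝ)) ^ (4 / 3 : ℝ) := by
            rw [sqrt_eq_exp hn0, one_div, ← Real.exp_neg, ← Real.exp_mul]
        _ ≤ _ := by gcongr
    have h3 : Real.exp (-(4 * a * Q / 3)) ≤
        Real.exp (16 * a / 3) * (√(n : ℝ) / M) ^ (4 / 3 : ℝ) := by
      have h4 : Real.exp (-(a * ((Q + 4 : ℕ) : ℝ))) ≤ √(n : ℝ) / M := by
        rw [Real.exp_neg, ← one_div, div_le_div_iff₀ (Real.exp_pos _) hM0, one_mul]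
        refine max_le ?_ ?_
        · rw [div_le_iff₀ hs0] at hQk
          linarith
        · have : 1 ≤ Real.exp (a * ((Q + 4 : ℕ) : ℝ)) :=
            Real.one_le_exp (mul_nonneg (by linarith [a_bounds.1]) (by positivity))
          nlinarith
      calc Real.exp (-(4 * a * Q / 3)) =
            Real.exp (16 * a / 3) * Real.exp (-(a * ((Q + 4 : ℕ) : ℝ))) ^ (4 / 3 : ℝ) := by
            rw [← Real.exp_mul, ← Real.exp_add]; congr 1; push_cast; ring
        _ ≤ _ := by gcongr
    set R := (√(n : ℝ) / M) ^ (4 / 3 : ℝ)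
    have hR0 : 0 ≤ R := by positivity
    -- the logarithmic factor of the claim is only needed to be bounded below
    have h5 : Real.log 2 ≤ Real.log (max (k : ℝ) (2 * √(n : ℝ)) / √(n : ℝ)) := by
      gcongr
      rw [le_div_iff₀ hs0]
      exact le_max_right _ _
    calc _ ≤ (3 + 2 * Real.exp (16 * a / 3)) * R := by linarith
      _ = (3 + 2 * Real.exp (16 * a / 3)) / Real.log 2 ^ 3 * R * Real.log 2 ^ 3 := by field_simp
      _ ≤ _ := by gcongr
  · obtain ⟨h1, h2⟩ := expectation_le hn hkn hQ2 (by positivity : 0 ≤ C * rate n k) hμ (hQ θ μ hμ)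
    refine ⟨h1, h2.trans ?_⟩
    have h3 := rate_ge_inv_sqrt hk hkn
    have h4 : (84 * Real.exp (6 * a) + 23) / √(n : ℝ) ≤
        4 * (84 * Real.exp (6 * a) + 23) * rate n k := by
      calc _ = 4 * (84 * Real.exp (6 * a) + 23) * (1 / (4 * √(n : ℝ))) := by field_simp
        _ ≤ _ := by gcongr
    linarith

end GOSC
end

noncomputable section
namespace GOSC
open MeasureTheory ProbabilityTheory

/-! ### Mixtures of Gaussian shifts -/

/-- The density of `N(x, 1)` with respect to `N(0, 1)`. -/
def shiftDensity (x y : ℝ) : ℝ := Real.exp (x * y - x ^ 2 / 2)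

lemma shiftDensity_pos (x y : ℝ) : 0 < shiftDensity x y := Real.exp_pos _

lemma continuous_shiftDensity (x : ℝ) : Continuous (shiftDensity x) := by
  unfold shiftDensity; fun_prop

lemma integrable_shiftDensity (x : ℝ) : Integrable (shiftDensity x) (gaussianReal 0 1) := by
  have e : shiftDensity x = fun y => Real.exp (x * y + -(x ^ 2 / 2)) := by
    ext y; rw [shiftDensity, sub_eq_add_neg]
  rw [e]
  exact (integral_exp_gaussian 0 x (-(x ^ 2 / 2))).1

lemma integral_shiftDensity (x : ℝ) : ∫ y, shiftDensity x y ∂(gaussianReal 0 1) = 1 := by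
  have h := (integral_exp_gaussian 0 x (-(x ^ 2 / 2))).2
  simp only [shiftDensity, sub_eq_add_neg]
  rw [h]
  simp

lemma integral_shiftDensity_mul (x x' : ℝ) :
    Integrable (fun y => shiftDensity x y * shiftDensity x' y) (gaussianReal 0 1) ∧
      ∫ y, shiftDensity x y * shiftDensity x' y ∂(gaussianReal 0 1) = Real.exp (x * x') := by
  have h := integral_exp_gaussian 0 (x + x') (-(x ^ 2 / 2) - x' ^ 2 / 2)
  have e : ∀ y, shiftDensity x y * shiftDensity x' y =
      Real.exp ((x + x') * y + (-(x ^ 2 / 2) - x' ^ 2 / 2)) := fun y => by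
    unfold shiftDensity
    rw [← Real.exp_add]; congr 1; ring
  simp only [e]
  refine ⟨h.1, h.2.trans ?_⟩
  congr 1; ring

lemma gaussianReal_eq_withDensity (x : ℝ) :
    gaussianReal x 1 = (gaussianReal 0 1).withDensity fun y => ENNReal.ofReal (shiftDensity x y) := by
  rw [gaussianReal_of_var_ne_zero x one_ne_zero, gaussianReal_of_var_ne_zero 0 one_ne_zero,
    ← withDensity_mul _ (measurable_gaussianPDF _ _)
      (continuous_shiftDensity x).measurable.ennreal_ofReal]
  congr 1
  ext y
  simp only [gaussianPDF, Pi.mul_apply, gaussianPDFReal, shiftDensity]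
  rw [← ENNReal.ofReal_mul (by positivity),
    mul_assoc (√(2 * Real.pi * ((1 : NNReal) : ℝ)))⁻¹, ← Real.exp_add]
  congr 3
  push_cast
  ring

/-- A product of unit Gaussians with means `x i` has the density `∏ i, shiftDensity (x i) (y i)`
with respect to the standard Gaussian measure. -/
lemma pi_gaussianReal_eq_withDensity {n : ℕ} (x : Fin n → ℝ) :
    (Measure.pi fun i => gaussianReal (x i) 1) =
      (Measure.pi fun _ : Fin n => gaussianReal 0 1).withDensity
        fun y => ENNReal.ofReal (∏ i, shiftDensity (x i) (y i)) := by
  refine Measure.pi_eq fun s hs => ?_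
  have h0 : ∀ i, 0 ≤ᵐ[(gaussianReal 0 1).restrict (s i)] fun y => shiftDensity (x i) y := fun i =>
    Filter.Eventually.of_forall fun y => (shiftDensity_pos _ _).le
  have hi : ∀ i, Integrable (shiftDensity (x i)) ((gaussianReal 0 1).restrict (s i)) := fun i =>
    (integrable_shiftDensity (x i)).restrict
  rw [withDensity_apply _ (MeasurableSet.univ_pi hs), Measure.restrict_pi_pi,
    ← ofReal_integral_eq_lintegral_ofReal (Integrable.fintype_prod hi)
      (Filter.Eventually.of_forall fun y => Finset.prod_nonneg fun i _ => (shiftDensity_pos _ _).le),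
    integral_fintype_prod_eq_prod, ENNReal.ofReal_prod_of_nonneg fun i _ =>
      integral_nonneg fun y => (shiftDensity_pos _ _).le]
  refine Finset.prod_congr rfl fun i _ => ?_
  rw [gaussianReal_eq_withDensity (x i), withDensity_apply _ (hs i),
    ofReal_integral_eq_lintegral_ofReal (hi i) (h0 i)]

lemma pi_gaussianReal_real {n : ℕ} (x : Fin n → ℝ) {A : Set (Fin n → ℝ)} (hA : MeasurableSet A) :
    (Measure.pi fun i => gaussianReal (x i) 1).real A =
      ∫ y in A, ∏ i, shiftDensity (x i) (y i) ∂(Measure.pi fun _ : Fin n => gaussianReal 0 1) := by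
  have hint : Integrable (fun y : Fin n → ℝ => ∏ i, shiftDensity (x i) (y i))
      (Measure.pi fun _ : Fin n => gaussianReal 0 1) :=
    Integrable.fintype_prod fun i => integrable_shiftDensity (x i)
  have h0 : ∀ y : Fin n → ℝ, 0 ≤ ∏ i, shiftDensity (x i) (y i) := fun y =>
    Finset.prod_nonneg fun i _ => (shiftDensity_pos _ _).le
  rw [pi_gaussianReal_eq_withDensity, measureReal_def, withDensity_apply _ hA,
    ← ofReal_integral_eq_lintegral_ofReal hint.restrict (Filter.Eventually.of_forall h0),
    ENNReal.toReal_ofReal (integral_nonneg h0)]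

section Mixture

variable {ι : Type*} [Fintype ι]

/-- The density of the mixture `∑ a, w a * N(x a, 1)` with respect to `N(0, 1)`. -/
def mixDensity (w x : ι → ℝ) (y : ℝ) : ℝ := ∑ a, w a * shiftDensity (x a) y

lemma integrable_mixDensity (w x : ι → ℝ) : Integrable (mixDensity w x) (gaussianReal 0 1) :=
  integrable_finsetSum _ fun a _ => (integrable_shiftDensity (x a)).const_mul (w a)

lemma integral_mixDensity (w x : ι → ℝ) : ∫ y, mixDensity w x y ∂(gaussianReal 0 1) = ∑ a, w a := by
  unfold mixDensity
  rw [integral_finsetSum _ fun a _ => (integrable_shiftDensity (x a)).const_mul (w a)]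
  simp only [integral_const_mul, integral_shiftDensity, mul_one]

lemma integral_mixDensity_sq (w x : ι → ℝ) :
    Integrable (fun y => mixDensity w x y ^ 2) (gaussianReal 0 1) ∧
      ∫ y, mixDensity w x y ^ 2 ∂(gaussianReal 0 1) =
        ∑ a, ∑ b, w a * w b * Real.exp (x a * x b) := by
  have e : ∀ y, mixDensity w x y ^ 2 =
      ∑ a, ∑ b, w a * w b * (shiftDensity (x a) y * shiftDensity (x b) y) := fun y => by
    rw [sq, mixDensity, Finset.sum_mul_sum]
    refine Finset.sum_congr rfl fun a _ => Finset.sum_congr rfl fun b _ => by ring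
  have hi : ∀ a b, Integrable
      (fun y => w a * w b * (shiftDensity (x a) y * shiftDensity (x b) y)) (gaussianReal 0 1) :=
    fun a b => (integral_shiftDensity_mul (x a) (x b)).1.const_mul _
  simp only [e]
  refine ⟨integrable_finsetSum _ fun a _ => integrable_finsetSum _ fun b _ => hi a b, ?_⟩
  rw [integral_finsetSum _ fun a _ => integrable_finsetSum _ fun b _ => hi a b]
  refine Finset.sum_congr rfl fun a _ => ?_
  rw [integral_finsetSum _ fun b _ => hi a b]
  refine Finset.sum_congr rfl fun b _ => ?_
  rw [integral_const_mul, (integral_shiftDensity_mul (x a) (x b)).2]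

lemma continuous_mixDensity (w x : ι → ℝ) : Continuous (mixDensity w x) :=
  continuous_finsetSum _ fun a _ => (continuous_shiftDensity (x a)).const_mul (w a)

/-- If the means are drawn independently from `∑ a, w a * δ_(x a)`, then the data are independent
with the mixture density. -/
lemma sum_prod_mul_pi_gaussianReal {n : ℕ} (w x : ι → ℝ) {A : Set (Fin n → ℝ)}
    (hA : MeasurableSet A) :
    ∑ J : Fin n → ι, (∏ i, w (J i)) * (Measure.pi fun i => gaussianReal (x (J i)) 1).real A =
      ∫ y in A, ∏ i, mixDensity w x (y i) ∂(Measure.pi fun _ : Fin n => gaussianReal 0 1) := by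
  classical
  have e : ∀ y : Fin n → ℝ, ∏ i, mixDensity w x (y i) =
      ∑ J : Fin n → ι, (∏ i, w (J i)) * ∏ i, shiftDensity (x (J i)) (y i) := fun y => by
    simp only [mixDensity]
    rw [Finset.prod_univ_sum, Fintype.piFinset_univ]
    simp only [Finset.prod_mul_distrib]
  simp only [e]
  rw [integral_finsetSum]
  · refine Finset.sum_congr rfl fun J _ => ?_
    rw [integral_const_mul, pi_gaussianReal_real _ hA]
  · intro J _
    exact ((Integrable.fintype_prod fun i => integrable_shiftDensity (x (J i))).const_mul _).restrict

end Mixture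

/-- Two product densities `F` and `G` whose one-dimensional `χ²` distance is at most `c`, with
`n * c ≤ 1/8`, are close in total variation: `F - G ≤ (3/16) F + (4/3) (F - G)² / F` pointwise, and the
last term integrates to the `χ²` distance of the products. -/
lemma setIntegral_prod_le {n : ℕ} {γ : Measure ℝ} [IsProbabilityMeasure γ] {f g : ℝ → ℝ} {c : ℝ}
    (hf : Integrable f γ) (hg : Integrable g γ) (hf1 : ∫ y, f y ∂γ = 1) (hg1 : ∫ y, g y ∂γ = 1)
    (hf0 : ∀ y, 0 < f y) (hgf : Integrable (fun y => g y ^ 2 / f y) γ)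
    (hc : ∫ y, g y ^ 2 / f y ∂γ ≤ 1 + c) (hnc : n * c ≤ 1 / 8) (A : Set (Fin n → ℝ)) :
    ∫ y in A, ∏ i, f (y i) ∂(Measure.pi fun _ : Fin n => γ) ≤
      ∫ y in A, ∏ i, g (y i) ∂(Measure.pi fun _ : Fin n => γ) + 2 / 5 := by
  set Γ := Measure.pi fun _ : Fin n => γ
  set F : (Fin n → ℝ) → ℝ := fun y => ∏ i, f (y i)
  set G : (Fin n → ℝ) → ℝ := fun y => ∏ i, g (y i)
  set H : (Fin n → ℝ) → ℝ := fun y => ∏ i, (g (y i) ^ 2 / f (y i))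
  have hF : Integrable F Γ := Integrable.fintype_prod fun _ => hf
  have hG : Integrable G Γ := Integrable.fintype_prod fun _ => hg
  have hH : Integrable H Γ := Integrable.fintype_prod fun _ => hgf
  have eF : ∫ y, F y ∂Γ = 1 := by
    rw [integral_fintype_prod_eq_pow, hf1, one_pow]
  have eG : ∫ y, G y ∂Γ = 1 := by
    rw [integral_fintype_prod_eq_pow, hg1, one_pow]
  have hH0 : 0 ≤ ∫ y, g y ^ 2 / f y ∂γ :=
    integral_nonneg fun y => div_nonneg (sq_nonneg _) (hf0 y).le
  have eH : ∫ y, H y ∂Γ ≤ 8 / 7 := by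
    rw [show ∫ y, H y ∂Γ = _ from integral_fintype_prod_eq_pow fun y => g y ^ 2 / f y,
      Fintype.card_fin]
    calc _ ≤ Real.exp c ^ n := by
          gcongr
          linarith [Real.add_one_le_exp c]
      _ = Real.exp (n * c) := (Real.exp_nat_mul c n).symm
      _ ≤ Real.exp (1 / 8) := Real.exp_le_exp.2 hnc
      _ ≤ 1 / (1 - 1 / 8) := Real.exp_bound_div_one_sub_of_interval (by norm_num) (by norm_num)
      _ = _ := by norm_num
  have hHF : ∀ y, H y = G y ^ 2 / F y := fun y => by
    simp only [H, G, F, Finset.prod_div_distrib, Finset.prod_pow]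
  have hFpos : ∀ y, 0 < F y := fun y => Finset.prod_pos fun i _ => hf0 _
  set R : (Fin n → ℝ) → ℝ := fun y => 3 / 16 * F y + 4 / 3 * ((F y - 2 * G y) + H y) with hRdef
  have hR : Integrable R Γ :=
    (hF.const_mul _).add (((hF.sub (hG.const_mul _)).add hH).const_mul _)
  have hRe : ∀ y, R y = 3 / 16 * F y + 4 / 3 * ((F y - G y) ^ 2 / F y) := fun y => by
    have := (hFpos y).ne'
    simp only [hRdef, hHF]
    field_simp
    ring
  have hR0 : ∀ y, 0 ≤ R y := fun y => by
    have := hFpos y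
    rw [hRe]; positivity
  have hle : ∀ y, F y - G y ≤ R y := fun y => by
    have h := hFpos y
    have h1 : F y * ((F y - G y) ^ 2 / F y) = (F y - G y) ^ 2 := by field_simp
    rw [hRe]
    set t := (F y - G y) ^ 2 / F y
    have ht : 0 ≤ t := by positivity
    by_contra! hcon
    nlinarith [sq_nonneg (3 / 16 * F y - 4 / 3 * t), mul_pos h h, mul_nonneg h.le ht]
  have iR : ∫ y, R y ∂Γ ≤ 2 / 5 := by
    have e : ∫ y, R y ∂Γ = 3 / 16 * ∫ y, F y ∂Γ +
        4 / 3 * ((∫ y, F y ∂Γ - 2 * ∫ y, G y ∂Γ) + ∫ y, H y ∂Γ) := by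
      have j1 := integral_add (hF.const_mul (3 / 16))
        (((hF.sub (hG.const_mul 2)).add hH).const_mul (4 / 3))
      have j2 := integral_add (hF.sub (hG.const_mul 2)) hH
      have j3 := integral_sub hF (hG.const_mul 2)
      simp only [Pi.add_apply, Pi.sub_apply, integral_const_mul] at j1 j2 j3
      simp only [hRdef]
      rw [j1, j2, j3]
    rw [e, eF, eG]
    linarith
  have h1 : ∫ y in A, (F y - G y) ∂Γ ≤ ∫ y in A, R y ∂Γ :=
    integral_mono (hF.sub hG).restrict hR.restrict hle
  have h2 : ∫ y in A, R y ∂Γ ≤ ∫ y, R y ∂Γ :=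
    setIntegral_le_integral hR (Filter.Eventually.of_forall hR0)
  rw [integral_sub hF.restrict hG.restrict] at h1
  linarith

end GOSC
end

noncomputable section
namespace GOSC
open MeasureTheory ProbabilityTheory

/-! ### A two-prior lower bound for the minimax risk -/

section TwoPriors

variable {ι : Type*} [Fintype ι]

lemma sum_prod_weights {n : ℕ} {w : ι → ℝ} (hw1 : ∑ a, w a = 1) :
    ∑ J : Fin n → ι, ∏ i, w (J i) = 1 := by
  classical
  have h := Finset.prod_univ_sum (fun _ : Fin n => (Finset.univ : Finset ι)) fun _ a => w a
  rw [Fintype.piFinset_univ] at h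
  rw [← h, hw1, Finset.prod_const_one]

/-- The variance of a sum of independent centered variables, as a finite sum. -/
lemma sum_prod_mul_sq {n : ℕ} {w : ι → ℝ} (hw0 : ∀ a, 0 ≤ w a) (hw1 : ∑ a, w a = 1) {u : ι → ℝ}
    (hu : ∑ a, w a * u a = 0) :
    ∑ J : Fin n → ι, (∏ i, w (J i)) * (∑ i, u (J i)) ^ 2 = n * ∑ a, w a * u a ^ 2 := by
  let _ : MeasurableSpace ι := ⊤
  have h1 : ∑ a, ENNReal.ofReal (w a) = 1 := by
    rw [← ENNReal.ofReal_sum_of_nonneg fun a _ => hw0 a, hw1, ENNReal.ofReal_one]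
  set P := (PMF.ofFintype (fun a => ENNReal.ofReal (w a)) h1).toMeasure with hP
  have hPr : ∀ a, P.real {a} = w a := fun a => by
    rw [measureReal_def, hP, PMF.toMeasure_apply_singleton _ _ (measurableSet_singleton a),
      PMF.ofFintype_apply, ENNReal.toReal_ofReal (hw0 a)]
  have hPi : ∀ f : ι → ℝ, ∫ a, f a ∂P = ∑ a, w a * f a := fun f => by
    rw [integral_fintype .of_finite]
    simp only [hPr, smul_eq_mul]
  have hmem : MemLp u 2 P := MemLp.of_discrete
  obtain ⟨hi, he⟩ := integral_sq_sum_sub (fun _ : Fin n => P) (fun _ => u) fun _ => hmem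
  rw [integral_fintype hi] at he
  simp only [hPi, hu, Finset.sum_const_zero, sub_zero, smul_eq_mul] at he
  have hJ : ∀ J : Fin n → ι, (Measure.pi fun _ : Fin n => P).real {J} = ∏ i, w (J i) := fun J => by
    rw [measureReal_def, ← Set.univ_pi_singleton J, Measure.pi_pi, ENNReal.toReal_prod]
    exact Finset.prod_congr rfl fun i _ => hPr _
  simp only [hJ] at he
  rw [he, variance_eq_integral hmem.aestronglyMeasurable.aemeasurable]
  simp only [hPi, hu]
  simp

/-- With independent contaminations of probability `p`, more than `k` of them occur with
probability at most `1/8`, if `k` exceeds the mean by enough standard deviations. -/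
lemma sum_prod_mul_indicator_le {n k : ℕ} {w : ι → ℝ} (hw0 : ∀ a, 0 ≤ w a) (hw1 : ∑ a, w a = 1)
    (b : ι → Prop) [DecidablePred b] {p : ℝ} (hp : ∑ a with b a, w a = p) (hk : n * p < k)
    (hv : 8 * (n * p * (1 - p)) ≤ (k - n * p) ^ 2) :
    ∑ J : Fin n → ι, (∏ i, w (J i)) *
      (if k < (Finset.univ.filter fun i => b (J i)).card then 1 else 0) ≤ 1 / 8 := by
  set u : ι → ℝ := fun a => (if b a then 1 else 0) - p with hu
  have e1 : ∑ a, w a * (if b a then 1 else 0) = p := by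
    rw [← hp, Finset.sum_filter]
    exact Finset.sum_congr rfl fun a _ => by split_ifs <;> simp
  have h1 : ∑ a, w a * u a = 0 := by
    simp only [hu, mul_sub, Finset.sum_sub_distrib, ← Finset.sum_mul, e1, hw1]
    ring
  have h2 : ∑ a, w a * u a ^ 2 = p * (1 - p) := by
    have e : ∀ a, w a * u a ^ 2 = (1 - 2 * p) * (w a * (if b a then 1 else 0)) + p ^ 2 * w a :=
      fun a => by simp only [hu]; split_ifs <;> ring
    simp only [e, Finset.sum_add_distrib, ← Finset.mul_sum, e1, hw1]
    ring
  have h3 := sum_prod_mul_sq (n := n) hw0 hw1 h1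
  rw [h2] at h3
  have hd : 0 < ((k : ℝ) - n * p) ^ 2 := by
    have : 0 < (k : ℝ) - n * p := by linarith
    positivity
  have hpt : ∀ J : Fin n → ι,
      (if k < (Finset.univ.filter fun i => b (J i)).card then (1 : ℝ) else 0) ≤
        (∑ i, u (J i)) ^ 2 / ((k : ℝ) - n * p) ^ 2 := by
    intro J
    split_ifs with hJ
    · rw [one_le_div hd]
      have e : ∑ i, u (J i) = ((Finset.univ.filter fun i => b (J i)).card : ℝ) - n * p := by
        simp only [hu, Finset.sum_sub_distrib, Finset.sum_const, Finset.card_univ, Fintype.card_fin,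
          nsmul_eq_mul, Finset.sum_boole]
      have hJ' : (k : ℝ) < ((Finset.univ.filter fun i => b (J i)).card : ℝ) := by exact_mod_cast hJ
      rw [e]
      have : 0 < (k : ℝ) - n * p := by linarith
      gcongr
    · positivity
  calc _ ≤ ∑ J : Fin n → ι, (∏ i, w (J i)) * ((∑ i, u (J i)) ^ 2 / ((k : ℝ) - n * p) ^ 2) :=
        Finset.sum_le_sum fun J _ => mul_le_mul_of_nonneg_left (hpt J)
          (Finset.prod_nonneg fun i _ => hw0 _)
    _ = (n * (p * (1 - p))) / ((k : ℝ) - n * p) ^ 2 := by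
        rw [← h3, Finset.sum_div]
        exact Finset.sum_congr rfl fun J _ => by ring
    _ ≤ 1 / 8 := by
        rw [div_le_div_iff₀ hd (by norm_num)]
        linarith

lemma pi_gaussianReal_eq_law {n : ℕ} (θ : ℝ) (x : Fin n → ℝ) :
    (Measure.pi fun i => gaussianReal (x i) 1) = law n θ fun i => x i - θ := by
  simp [law]

/-- Markov's inequality for the risk. -/
lemma mul_law_le_maxRisk {n k : ℕ} {est : (Fin n → ℝ) → ℝ} {θ t : ℝ} (ht : 0 ≤ t)
    {μ : Fin n → ℝ} (hμ : μ ∈ sparse n k) (hR : maxRisk n k est ≠ ⊤) {A : Set (Fin n → ℝ)}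
    (hest : Measurable est) (hA : ∀ Y ∈ A, t ≤ |est Y - θ|) :
    t * (law n θ μ).real A ≤ (maxRisk n k est).toReal := by
  have h1 : ∫⁻ Y, ENNReal.ofReal |est Y - θ| ∂(law n θ μ) ≤ maxRisk n k est :=
    le_iSup_of_le θ (le_iSup₂_of_le μ hμ le_rfl)
  have h2 := mul_meas_ge_le_lintegral (μ := law n θ μ)
    ((hest.sub_const θ).abs.ennreal_ofReal) (ENNReal.ofReal t)
  have h3 : law n θ μ A ≤ law n θ μ {Y | ENNReal.ofReal t ≤ ENNReal.ofReal |est Y - θ|} :=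
    measure_mono fun Y hY => ENNReal.ofReal_le_ofReal (hA Y hY)
  have h4 : ENNReal.ofReal t * law n θ μ A ≤ maxRisk n k est :=
    (mul_le_mul_right h3 _).trans (h2.trans h1)
  have h5 := ENNReal.toReal_mono hR h4
  rwa [ENNReal.toReal_mul, ENNReal.toReal_ofReal ht] at h5

/-- The risk, averaged over independent random effects. -/
lemma mul_sum_le_maxRisk {n k : ℕ} {est : (Fin n → ℝ) → ℝ} {θ t : ℝ} (ht : 0 ≤ t)
    {w x : ι → ℝ} (hw0 : ∀ a, 0 ≤ w a) (hw1 : ∑ a, w a = 1) (hx : ∀ a, w a ≠ 0 → θ ≤ x a)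
    {p : ℝ} (hp : ∑ a with x a ≠ θ, w a = p) (hk : n * p < k)
    (hv : 8 * (n * p * (1 - p)) ≤ (k - n * p) ^ 2) (hR : maxRisk n k est ≠ ⊤)
    {A : Set (Fin n → ℝ)} (hest : Measurable est) (hA : ∀ Y ∈ A, t ≤ |est Y - θ|) :
    t * (∑ J : Fin n → ι, (∏ i, w (J i)) * (Measure.pi fun i => gaussianReal (x (J i)) 1).real A) ≤
      (maxRisk n k est).toReal + t / 8 := by
  classical
  have hpt : ∀ J : Fin n → ι,
      t * ((∏ i, w (J i)) * (Measure.pi fun i => gaussianReal (x (J i)) 1).real A) ≤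
        (∏ i, w (J i)) * (maxRisk n k est).toReal + t * ((∏ i, w (J i)) *
          (if k < (Finset.univ.filter fun i => x (J i) ≠ θ).card then 1 else 0)) := by
    intro J
    have hR0 : 0 ≤ (maxRisk n k est).toReal := ENNReal.toReal_nonneg
    have hW0 : 0 ≤ ∏ i, w (J i) := Finset.prod_nonneg fun i _ => hw0 _
    rcases hW0.eq_or_lt with hW | hW
    · simp [← hW]
    have hJ : ∀ i, w (J i) ≠ 0 := fun i h => hW.ne' (Finset.prod_eq_zero (Finset.mem_univ i) h)
    split_ifs with hc
    · have h1 : (Measure.pi fun i => gaussianReal (x (J i)) 1).real A ≤ 1 := measureReal_le_one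
      have h2 : t * ((∏ i, w (J i)) * (Measure.pi fun i => gaussianReal (x (J i)) 1).real A) ≤
          t * ((∏ i, w (J i)) * 1) := by gcongr
      have h3 : 0 ≤ (∏ i, w (J i)) * (maxRisk n k est).toReal := by positivity
      linarith
    · have hμ : (fun i => x (J i) - θ) ∈ sparse n k := by
        refine ⟨fun i => sub_nonneg.2 (hx _ (hJ i)), ?_⟩
        simp only [ne_eq, sub_eq_zero]
        exact not_lt.1 hc
      have h1 := mul_law_le_maxRisk ht hμ hR hest hA
      rw [← pi_gaussianReal_eq_law θ fun i => x (J i)] at h1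
      calc _ = (∏ i, w (J i)) * (t * (Measure.pi fun i => gaussianReal (x (J i)) 1).real A) := by ring
        _ ≤ (∏ i, w (J i)) * (maxRisk n k est).toReal := by gcongr
        _ = _ := by ring
  have hsum := Finset.sum_le_sum fun J (_ : J ∈ Finset.univ) => hpt J
  rw [← Finset.mul_sum, Finset.sum_add_distrib, ← Finset.sum_mul, ← Finset.mul_sum,
    sum_prod_weights hw1, one_mul] at hsum
  have h2 := sum_prod_mul_indicator_le (n := n) hw0 hw1 (fun a => x a ≠ θ) hp hk hv
  have h3 := mul_le_mul_of_nonneg_left h2 ht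
  linarith

/-- If the means `Y i - ξ i` are i.i.d. from `∑ a, w a * δ_(x a)` (location `-θ`) or from
`∑ a, r a * δ_(x a)` (location `0`), and the two resulting laws of the data are close, then no
estimator separates the two locations. -/
theorem le_minimaxRisk_of_priors {n k : ℕ} {θ : ℝ} (hθ : 0 < θ) {w r x : ι → ℝ}
    (hw0 : ∀ a, 0 ≤ w a) (hw1 : ∑ a, w a = 1) (hr0 : ∀ a, 0 ≤ r a) (hr1 : ∑ a, r a = 1)
    (hxw : ∀ a, w a ≠ 0 → -θ ≤ x a) (hxr : ∀ a, r a ≠ 0 → 0 ≤ x a)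
    {p p' : ℝ} (hp : ∑ a with x a ≠ -θ, w a = p) (hp' : ∑ a with x a ≠ 0, r a = p')
    (hk : n * p < k) (hk' : n * p' < k)
    (hv : 8 * (n * p * (1 - p)) ≤ (k - n * p) ^ 2)
    (hv' : 8 * (n * p' * (1 - p')) ≤ (k - n * p') ^ 2)
    {o : ι} (hxo : x o = 0) (hro : 0 < r o)
    (hχ : n * ((∑ a, ∑ b, (w a - r a) * (w b - r b) * Real.exp (x a * x b)) / r o) ≤ 1 / 8) :
    ENNReal.ofReal (θ / 16) ≤ minimaxRisk n k := by
  refine le_iInf₂ fun est hest => ?_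
  by_cases hR : maxRisk n k est = ⊤
  · rw [hR]; exact le_top
  rw [ENNReal.ofReal_le_iff_le_toReal hR]
  set γ := gaussianReal 0 1
  set A : Set (Fin n → ℝ) := {Y | -(θ / 2) ≤ est Y} with hAdef
  have hA : MeasurableSet A := measurableSet_le measurable_const hest
  have b1 := mul_sum_le_maxRisk (t := θ / 2) (θ := -θ) (by positivity) hw0 hw1 hxw hp hk hv hR
    (A := A) hest fun Y hY => by
      have hY' : -(θ / 2) ≤ est Y := hY
      rw [abs_of_nonneg (by linarith)]; linarith
  have b0 := mul_sum_le_maxRisk (t := θ / 2) (θ := 0) (by positivity) hr0 hr1 hxr hp' hk' hv' hR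
    (A := Aᶜ) hest fun Y hY => by
      have hY' : est Y < -(θ / 2) := not_le.1 hY
      rw [sub_zero, abs_of_neg (by linarith)]; linarith
  -- the second mixture has the reference measure as a component, which bounds its density below
  have hfo : ∀ y, r o ≤ mixDensity r x y := fun y => by
    have h1 := Finset.single_le_sum (f := fun a => r a * shiftDensity (x a) y)
      (fun a _ => mul_nonneg (hr0 a) (shiftDensity_pos _ _).le) (Finset.mem_univ o)
    have h2 : shiftDensity (x o) y = 1 := by simp [shiftDensity, hxo]
    simp only [h2, mul_one] at h1
    exact h1
  have hf0 : ∀ y, 0 < mixDensity r x y := fun y => hro.trans_le (hfo y)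
  obtain ⟨hgi, -⟩ := integral_mixDensity_sq w x
  obtain ⟨hdi, hde⟩ := integral_mixDensity_sq (fun a => w a - r a) x
  have hd : ∀ y, mixDensity (fun a => w a - r a) x y = mixDensity w x y - mixDensity r x y := fun y => by
    simp only [mixDensity, sub_mul, Finset.sum_sub_distrib]
  have hcont : Continuous fun y => mixDensity w x y ^ 2 / mixDensity r x y :=
    ((continuous_mixDensity w x).pow 2).div (continuous_mixDensity r x) fun y => (hf0 y).ne'
  have hgf : Integrable (fun y => mixDensity w x y ^ 2 / mixDensity r x y) γ := by
    refine (hgi.div_const (r o)).mono' hcont.aestronglyMeasurable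
      (Filter.Eventually.of_forall fun y => ?_)
    have := hf0 y
    rw [Real.norm_of_nonneg (by positivity)]
    have := hfo y
    gcongr
  have hchi : ∫ y, mixDensity w x y ^ 2 / mixDensity r x y ∂γ ≤
      1 + (∑ a, ∑ b, (w a - r a) * (w b - r b) * Real.exp (x a * x b)) / r o := by
    have hle : ∀ y, mixDensity w x y ^ 2 / mixDensity r x y ≤
        (2 * mixDensity w x y - mixDensity r x y) + mixDensity (fun a => w a - r a) x y ^ 2 / r o := by
      intro y
      have h0 := hf0 y
      have h1 := hfo y
      have e : mixDensity w x y ^ 2 / mixDensity r x y = (2 * mixDensity w x y - mixDensity r x y) +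
          mixDensity (fun a => w a - r a) x y ^ 2 / mixDensity r x y := by
        rw [hd]; field_simp; ring
      rw [e]
      gcongr
    have i1 := ((integrable_mixDensity w x).const_mul 2).sub (integrable_mixDensity r x)
    refine (integral_mono hgf (i1.add (hdi.div_const (r o))) hle).trans (le_of_eq ?_)
    have j1 := integral_add i1 (hdi.div_const (r o))
    have j2 := integral_sub ((integrable_mixDensity w x).const_mul 2) (integrable_mixDensity r x)
    simp only [Pi.sub_apply, integral_const_mul, integral_div] at j1 j2
    simp only [Pi.add_apply, Pi.sub_apply]
    rw [j1, j2, integral_mixDensity, integral_mixDensity, hde, hw1, hr1]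
    norm_num
  have htv := setIntegral_prod_le (n := n) (integrable_mixDensity r x) (integrable_mixDensity w x)
    ((integral_mixDensity r x).trans hr1) ((integral_mixDensity w x).trans hw1) hf0 hgf hchi hχ A
  rw [← sum_prod_mul_pi_gaussianReal r x hA, ← sum_prod_mul_pi_gaussianReal w x hA] at htv
  have hcompl : ∑ J : Fin n → ι, (∏ i, r (J i)) * (Measure.pi fun i => gaussianReal (x (J i)) 1).real Aᶜ
      = 1 - ∑ J : Fin n → ι, (∏ i, r (J i)) * (Measure.pi fun i => gaussianReal (x (J i)) 1).real A := by
    rw [← sum_prod_weights (n := n) hr1, ← Finset.sum_sub_distrib]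
    refine Finset.sum_congr rfl fun J _ => ?_
    rw [probReal_compl_eq_one_sub hA]; ring
  rw [hcompl] at b0
  have h1 := mul_le_mul_of_nonneg_left htv (by positivity : 0 ≤ θ / 2)
  linarith

end TwoPriors

end GOSC
end

noncomputable section
namespace GOSC
open MeasureTheory ProbabilityTheory

/-! ### Extrapolation from the Chebyshev nodes -/

open Polynomial Polynomial.Chebyshev in
/-- The value at `y` of the Lagrange basis polynomial of the `j`-th extremal point of `T_q`. -/
def extWeight (q : ℕ) (y : ℝ) (j : ℕ) : ℝ :=
  (Lagrange.basis (Finset.range (q + 1)) (node q) j).eval y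

open Polynomial Polynomial.Chebyshev in
lemma sum_extWeight_mul (q : ℕ) (y : ℝ) {P : ℝ[X]} (hP : P.natDegree ≤ q) :
    ∑ j ∈ Finset.range (q + 1), extWeight q y j * P.eval (node q j) = P.eval y := by
  have hd : P.degree < (Finset.range (q + 1)).card := by
    rw [Finset.card_range]
    exact lt_of_le_of_lt degree_le_natDegree (by exact_mod_cast Nat.lt_succ_of_le hP)
  have h := Lagrange.eq_interpolate (strictAntiOn_node q).injOn hd
  conv_rhs => rw [h]
  rw [Lagrange.interpolate_apply, eval_finsetSum]
  refine Finset.sum_congr rfl fun j _ => ?_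
  rw [eval_mul, eval_C, mul_comm, extWeight]

open Polynomial Polynomial.Chebyshev in
lemma extWeight_eq (q : ℕ) (y : ℝ) (j : ℕ) :
    extWeight q y j = (∏ i ∈ (Finset.range (q + 1)).erase j, (node q j - node q i))⁻¹ *
      ∏ i ∈ (Finset.range (q + 1)).erase j, (y - node q i) := by
  rw [extWeight, Lagrange.basis, eval_prod, ← Finset.prod_inv_distrib, ← Finset.prod_mul_distrib]
  refine Finset.prod_congr rfl fun i _ => ?_
  simp [Lagrange.basisDivisor]

open Polynomial.Chebyshev in
/-- To the right of the nodes the weights alternate in sign, because the nodes are in decreasing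
order. -/
lemma extWeight_sign {q j : ℕ} (hj : j ≤ q) {y : ℝ} (hy : 1 ≤ y) :
    0 ≤ (-1) ^ j * extWeight q y j := by
  have h1 := zero_lt_prod_node_sub_node hj
  have h2 : 0 ≤ ∏ i ∈ (Finset.range (q + 1)).erase j, (y - node q i) :=
    Finset.prod_nonneg fun i _ => by
      have := (node_mem_Icc (n := q) (i := i)).2
      linarith
  have h3 := inv_pos.2 h1
  rw [mul_inv, ← inv_pow, inv_neg_one] at h3
  rw [extWeight_eq, ← mul_assoc]
  exact mul_nonneg h3.le h2

open Polynomial.Chebyshev in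
lemma one_le_extWeight_zero (q : ℕ) {y : ℝ} (hy : 1 ≤ y) : 1 ≤ extWeight q y 0 := by
  rw [extWeight_eq, ← Finset.prod_inv_distrib, ← Finset.prod_mul_distrib]
  refine Finset.one_le_prod fun i hi => ?_
  obtain ⟨h0, hi⟩ := Finset.mem_erase.1 hi
  have h1 := node_lt (Nat.lt_succ_iff.1 (Finset.mem_range.1 hi)) (Nat.pos_of_ne_zero h0)
  rw [inv_mul_eq_div, one_le_div (sub_pos.2 h1)]
  rw [node_eq_one]
  linarith

open Polynomial Polynomial.Chebyshev in
lemma sum_extWeight (q : ℕ) (y : ℝ) : ∑ j ∈ Finset.range (q + 1), extWeight q y j = 1 := by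
  have h := sum_extWeight_mul q y (P := 1) (by simp)
  simpa using h

open Polynomial Polynomial.Chebyshev in
/-- `T_q` is `(-1) ^ j` at its `j`-th extremal point. -/
lemma sum_alternating_extWeight (q : ℕ) (v : ℝ) :
    ∑ j ∈ Finset.range (q + 1), (-1) ^ j * extWeight q (Real.cosh v) j = Real.cosh (q * v) := by
  have h := sum_extWeight_mul q (Real.cosh v) (P := T ℝ (q : ℤ)) (by simp [natDegree_T])
  rw [T_real_cosh] at h
  push_cast at h
  rw [← h]
  refine Finset.sum_congr rfl fun j hj => ?_
  rw [eval_T_real_node (by rw [Finset.mem_Iic]; exact Nat.lt_succ_iff.1 (Finset.mem_range.1 hj)),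
    mul_comm]

lemma sq_div_two_le_cosh_sub_one (v : ℝ) : v ^ 2 / 2 ≤ Real.cosh v - 1 := by
  have h := Real.cosh_sq' (v / 2)
  have h2 := Real.cosh_two_mul (v / 2)
  rw [show 2 * (v / 2) = v by ring] at h2
  have h3 : (v / 2) ^ 2 ≤ Real.sinh (v / 2) ^ 2 := by
    rw [sq_le_sq]
    rw [Real.abs_sinh]
    exact Real.self_le_sinh_iff.2 (abs_nonneg _)
  linarith

open Polynomial Polynomial.Chebyshev in
/-- Two probability weights on a common finite set of points of `{-θ} ∪ [0, M]`, where
`θ = M (cosh v - 1) / 2`. The first lives on `{-θ} ∪ (0, M]`, the second on `[0, M]`; with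
`p = (T - 1) / (T + 1)` and `T = cosh (q v)`, they put mass `p` outside `{-θ}` and at most `p`
outside `{0}`. Their moments agree up to the order `q`, and those of order `m` differ by at most `3 p M ^ m`.

The difference of the two is proportional to the error of extrapolating to `-θ` from the extremal
points of the Chebyshev polynomial of degree `q` on `[0, M]`. -/
theorem exists_matching_priors {q : ℕ} (hq : 1 ≤ q) {v M : ℝ} (hv0 : 0 < v) (hv1 : v ≤ 1)
    (hM : 0 < M) :
    ∃ (W R x : Option (Fin (q + 1)) → ℝ) (o : Option (Fin (q + 1))),
      (∀ a, 0 ≤ W a) ∧ ∑ a, W a = 1 ∧ (∀ a, 0 ≤ R a) ∧ ∑ a, R a = 1 ∧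
      (∀ a, W a ≠ 0 → -(M * (Real.cosh v - 1) / 2) ≤ x a) ∧ (∀ a, R a ≠ 0 → 0 ≤ x a) ∧
      ∑ a with x a ≠ -(M * (Real.cosh v - 1) / 2), W a =
        (Real.cosh (q * v) - 1) / (Real.cosh (q * v) + 1) ∧
      ∑ a with x a ≠ 0, R a = 1 - R o ∧
      x o = 0 ∧ 2 / (Real.cosh (q * v) + 1) ≤ R o ∧
      (∀ m ≤ q, ∑ a, (W a - R a) * x a ^ m = 0) ∧
      ∀ m, 1 ≤ m → |∑ a, (W a - R a) * x a ^ m| ≤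
        3 * ((Real.cosh (q * v) - 1) / (Real.cosh (q * v) + 1)) * M ^ m := by
  set y := Real.cosh v with hy
  set T := Real.cosh (q * v) with hT
  have hy1 : 1 ≤ y := Real.one_le_cosh v
  have hcv := sq_div_two_le_cosh_sub_one v
  have hy1' : 0 < y - 1 := by
    have : 0 < v ^ 2 / 2 := by positivity
    linarith
  have hT1 : 1 ≤ T := Real.one_le_cosh _
  have hyT : y ≤ T := by
    rw [hy, hT, Real.cosh_le_cosh, abs_of_pos hv0, abs_of_nonneg (by positivity)]
    have : (1 : ℝ) ≤ q := by exact_mod_cast hq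
    nlinarith
  have hy3 : y ≤ 3 := by
    have h1 : y ≤ Real.cosh 1 := by
      rw [hy, Real.cosh_le_cosh, abs_of_pos hv0, abs_one]; exact hv1
    have h2 := Real.exp_one_lt_d9
    have h3 : Real.exp (-1) ≤ 1 := Real.exp_le_one_iff.2 (by norm_num)
    rw [Real.cosh_eq] at h1
    linarith
  set θ := M * (y - 1) / 2 with hθ
  have hθ0 : 0 < θ := by positivity
  have hθM : θ ≤ M := by rw [hθ]; nlinarith
  set l := extWeight q y with hl
  set S := (1 + T) / 2 with hS
  have hS0 : 0 < S := by positivity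
  set X : ℕ → ℝ := fun j => M * (1 - node q j) / 2 with hX
  have hX0 : ∀ j, 0 ≤ X j := fun j => by
    have := (node_mem_Icc (n := q) (i := j)).2
    have : 0 ≤ 1 - node q j := by linarith
    positivity
  have hXM : ∀ j, X j ≤ M := fun j => by
    have := (node_mem_Icc (n := q) (i := j)).1
    simp only [hX]
    nlinarith
  have hXz : X 0 = 0 := by simp [hX, node_eq_one]
  have hXpos : ∀ j, j ≤ q → j ≠ 0 → 0 < X j := fun j hj hj0 => by
    have h1 := node_lt hj (Nat.pos_of_ne_zero hj0)
    rw [node_eq_one] at h1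
    have : 0 < 1 - node q j := by linarith
    positivity
  have hsum := sum_extWeight q y
  have halt := sum_alternating_extWeight q v
  rw [← hy, ← hT, ← hl] at halt
  rw [← hl] at hsum
  have hsign : ∀ j, j ≤ q → 0 ≤ (-1) ^ j * l j := fun j hj => extWeight_sign hj hy1
  have hl0 : 1 ≤ l 0 := one_le_extWeight_zero q hy1
  set We : ℕ → ℝ := fun j => if Odd j then -l j / S else 0 with hWe
  set Re : ℕ → ℝ := fun j => if Odd j then 0 else l j / S with hRe
  have hWe' : ∀ j, We j = ((-1) ^ j * l j - l j) * (1 / (2 * S)) := fun j => by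
    simp only [hWe]
    split_ifs with h
    · rw [h.neg_one_pow]; field_simp; ring
    · rw [(Nat.not_odd_iff_even.1 h).neg_one_pow]; ring
  have hRe' : ∀ j, Re j = ((-1) ^ j * l j + l j) * (1 / (2 * S)) := fun j => by
    simp only [hRe]
    split_ifs with h
    · rw [h.neg_one_pow]; ring
    · rw [(Nat.not_odd_iff_even.1 h).neg_one_pow]; field_simp; ring
  have hWs : ∑ j : Fin (q + 1), We j = (T - 1) / (T + 1) := by
    rw [Fin.sum_univ_eq_sum_range]
    simp only [hWe']
    rw [← Finset.sum_mul, Finset.sum_sub_distrib, halt, hsum, hS]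
    field_simp
    ring
  have hRs : ∑ j : Fin (q + 1), Re j = 1 := by
    rw [Fin.sum_univ_eq_sum_range]
    simp only [hRe']
    rw [← Finset.sum_mul, Finset.sum_add_distrib, halt, hsum, hS]
    field_simp
    ring
  have hWn : ∀ j, j ≤ q → 0 ≤ We j := fun j hj => by
    simp only [hWe]
    split_ifs with h
    · have := hsign j hj
      rw [h.neg_one_pow] at this
      have : 0 ≤ -l j := by linarith
      positivity
    · exact le_rfl
  have hRn : ∀ j, j ≤ q → 0 ≤ Re j := fun j hj => by
    simp only [hRe]
    split_ifs with h
    · exact le_rfl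
    · have := hsign j hj
      rw [(Nat.not_odd_iff_even.1 h).neg_one_pow, one_mul] at this
      positivity
  have hj : ∀ j : Fin (q + 1), (j : ℕ) ≤ q := fun j => Nat.lt_succ_iff.1 j.2
  have hmom : ∀ m, (1 / S - 0) * (-θ) ^ m + ∑ j : Fin (q + 1), (We j - Re j) * X j ^ m =
      ((-θ) ^ m - ∑ j ∈ Finset.range (q + 1), l j * X j ^ m) / S := fun m => by
    rw [Fin.sum_univ_eq_sum_range fun j => (We j - Re j) * X j ^ m]
    have e : ∀ j, (We j - Re j) * X j ^ m = -(l j * X j ^ m) / S := fun j => by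
      rw [hWe', hRe']; field_simp; ring
    simp only [e]
    rw [← Finset.sum_div, Finset.sum_neg_distrib]
    ring
  -- the index `none` stands for the point `-θ`, and `some j` for the `j`-th extremal point; the weights
  -- `l j` of odd index, which are negative, go to the first prior, and those of even index to the second
  refine ⟨fun a => a.elim (1 / S) fun j => We j, fun a => a.elim 0 fun j => Re j,
    fun a => a.elim (-θ) fun j => X j, some 0, ?_, ?_, ?_, ?_, ?_, ?_, ?_, ?_, ?_, ?_, ?_, ?_⟩
  · rintro (_ | j)
    · exact (by positivity : 0 ≤ 1 / S)
    · exact hWn _ (hj j)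
  · rw [Fintype.sum_option]
    simp only [Option.elim]
    rw [hWs, hS]; field_simp; ring
  · rintro (_ | j)
    · exact le_rfl
    · exact hRn _ (hj j)
  · rw [Fintype.sum_option]
    simp only [Option.elim]
    rw [hRs]; ring
  · rintro (_ | j) _
    · exact le_rfl
    · exact (by linarith : -θ ≤ 0).trans (hX0 j)
  · rintro (_ | j) h
    · exact absurd rfl h
    · exact hX0 j
  · rw [Finset.sum_filter, Fintype.sum_option]
    simp only [Option.elim, ne_eq, not_true_eq_false, if_false, zero_add]
    rw [← hWs]
    refine Finset.sum_congr rfl fun j _ => if_pos ?_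
    have := hX0 j
    intro h
    linarith
  · rw [Finset.sum_filter, Fintype.sum_option]
    have e : ∀ j : Fin (q + 1), (if X j ≠ 0 then Re j else 0) = Re j - if j = 0 then Re 0 else 0 := by
      intro j
      split_ifs with h1 h2 h2
      · exact absurd (by rw [h2]; exact hXz) h1
      · rw [sub_zero]
      · rw [h2]; simp
      · exact absurd (hXpos j (hj j) fun h => h2 (Fin.ext h)).ne' h1
    refine (congrArg₂ (· + ·) (ite_self (0 : ℝ)) (Finset.sum_congr rfl fun j _ => e j)).trans ?_
    simp only [zero_add]
    rw [Finset.sum_sub_distrib, hRs]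
    simp
  · simp [hXz]
  · simp only [Option.elim, Fin.val_zero, hRe, Nat.not_odd_zero, if_false]
    rw [hS, div_le_div_iff₀ (by positivity) (by positivity)]
    nlinarith
  · intro m hm
    rw [Fintype.sum_option]
    simp only [Option.elim]
    rw [hmom]
    have h := sum_extWeight_mul q y (P := (C (M / 2) * (1 - Polynomial.X)) ^ m) (by
      refine natDegree_pow_le.trans ?_
      have : (C (M / 2) * (1 - Polynomial.X) : ℝ[X]).natDegree ≤ 1 := by
        refine natDegree_C_mul_le _ _ |>.trans ?_
        refine (natDegree_sub_le _ _).trans ?_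
        simp
      nlinarith)
    simp only [eval_pow, eval_mul, eval_C, eval_sub, eval_one, eval_X] at h
    have e1 : M / 2 * (1 - y) = -θ := by rw [hθ]; ring
    have e2 : ∀ j, M / 2 * (1 - node q j) = X j := fun j => by simp only [hX]; ring
    simp only [e1, e2] at h
    rw [← hl] at h
    rw [h]; simp
  · intro m hm
    rw [Fintype.sum_option]
    simp only [Option.elim]
    rw [hmom, abs_div, abs_of_pos hS0, div_le_iff₀ hS0]
    have h1 : |∑ j ∈ Finset.range (q + 1), l j * X j ^ m| ≤ (T - l 0) * M ^ m := by
      have hz : ∑ j ∈ Finset.range (q + 1), (if j = 0 then l 0 else 0) = l 0 := by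
        simp
      calc _ ≤ ∑ j ∈ Finset.range (q + 1), |l j * X j ^ m| := Finset.abs_sum_le_sum_abs _ _
        _ ≤ ∑ j ∈ Finset.range (q + 1), ((-1) ^ j * l j - if j = 0 then l 0 else 0) * M ^ m := by
            refine Finset.sum_le_sum fun j hjr => ?_
            have hjq : j ≤ q := Nat.lt_succ_iff.1 (Finset.mem_range.1 hjr)
            split_ifs with h0
            · subst h0
              simp [hXz, show m ≠ 0 by omega]
            · rw [abs_mul, abs_of_nonneg (pow_nonneg (hX0 j) m), sub_zero]
              have e : |l j| = (-1) ^ j * l j := by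
                rw [← abs_of_nonneg (hsign j hjq), abs_mul, abs_neg_one_pow, one_mul]
              rw [e]
              have := hX0 j
              have := hXM j
              have := hsign j hjq
              gcongr
        _ = _ := by rw [← Finset.sum_mul, Finset.sum_sub_distrib, halt, hz]
    have h2 : |(-θ) ^ m| ≤ (T - 1) / 2 * M ^ m := by
      rw [abs_pow, abs_neg, abs_of_pos hθ0]
      obtain ⟨m', rfl⟩ : ∃ m', m = m' + 1 := ⟨m - 1, by omega⟩
      rw [pow_succ, pow_succ]
      calc θ ^ m' * θ ≤ M ^ m' * θ := by gcongr
        _ = (y - 1) / 2 * (M ^ m' * M) := by rw [hθ]; ring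
        _ ≤ _ := by gcongr
    have h3 := abs_sub ((-θ) ^ m) (∑ j ∈ Finset.range (q + 1), l j * X j ^ m)
    have h4 : 0 < M ^ m := by positivity
    have e : 3 * ((T - 1) / (T + 1)) * M ^ m * S = (T - 1) / 2 * M ^ m + (T - 1) * M ^ m := by
      rw [hS]; field_simp; ring
    rw [e]
    have h5 : (T - l 0) * M ^ m ≤ (T - 1) * M ^ m := by gcongr
    linarith

end GOSC
end

noncomputable section
namespace GOSC
open MeasureTheory ProbabilityTheory

/-! ### The minimax lower bound -/

/-- The squared `L²` distance of two Gaussian mixtures, in terms of the moments of the difference `d` of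
the mixing weights. -/
lemma hasSum_chi {ι : Type*} [Fintype ι] (d x : ι → ℝ) :
    HasSum (fun m : ℕ => (∑ a, d a * x a ^ m) ^ 2 / (m.factorial : ℝ))
      (∑ a, ∑ b, d a * d b * Real.exp (x a * x b)) := by
  have h : HasSum (fun m : ℕ => ∑ a, ∑ b, d a * d b * ((x a * x b) ^ m / (m.factorial : ℝ)))
      (∑ a, ∑ b, d a * d b * Real.exp (x a * x b)) := by
    refine hasSum_sum fun a _ => hasSum_sum fun b _ => HasSum.mul_left _ ?_
    rw [Real.exp_eq_exp_ℝ]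
    exact NormedSpace.expSeries_div_hasSum_exp (x a * x b)
  refine h.congr_fun fun m => ?_
  rw [sq, Finset.sum_mul_sum, Finset.sum_div]
  refine Finset.sum_congr rfl fun a _ => ?_
  rw [Finset.sum_div]
  refine Finset.sum_congr rfl fun b _ => ?_
  rw [mul_pow]; ring

/-- The choice of `M` makes `M ^ (2 m) / m!`, for `m ≥ q`, at most `e ^ (-5 m)`, so the series of
`hasSum_chi` is geometric. -/
lemma chi_le {ι : Type*} [Fintype ι] {d x : ι → ℝ} {q : ℕ} (hq : 1 ≤ q) {p M : ℝ}
    (hM : M ^ 2 = q / Real.exp 6) (h0 : ∀ m ≤ q, ∑ a, d a * x a ^ m = 0)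
    (h1 : ∀ m, 1 ≤ m → |∑ a, d a * x a ^ m| ≤ 3 * p * M ^ m) :
    ∑ a, ∑ b, d a * d b * Real.exp (x a * x b) ≤ 18 * p ^ 2 * Real.exp (-(4 * q)) := by
  have hq' : (1 : ℝ) ≤ q := by exact_mod_cast hq
  have hg : HasSum (fun m : ℕ => 9 * p ^ 2 * Real.exp (-(4 * q)) * (1 / 2 : ℝ) ^ m)
      (9 * p ^ 2 * Real.exp (-(4 * q)) * 2) := hasSum_geometric_two.mul_left _
  refine (hasSum_le (fun m => ?_) (hasSum_chi d x) hg).trans (le_of_eq (by ring))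
  rcases le_or_gt m q with hm | hm
  · rw [h0 m hm]
    simp only [ne_eq, OfNat.ofNat_ne_zero, not_false_eq_true, zero_pow, zero_div]
    positivity
  · have hm' : (q : ℝ) ≤ m := by exact_mod_cast hm.le
    have hfac : (0 : ℝ) < m.factorial := by exact_mod_cast m.factorial_pos
    have b1 : (∑ a, d a * x a ^ m) ^ 2 ≤ 9 * p ^ 2 * (M ^ 2) ^ m := by
      have h := h1 m (by omega)
      calc _ = |∑ a, d a * x a ^ m| ^ 2 := (sq_abs _).symm
        _ ≤ (3 * p * M ^ m) ^ 2 := by gcongr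
        _ = _ := by rw [← pow_mul, mul_comm 2 m, pow_mul]; ring
    have b2 : (M ^ 2) ^ m / (m.factorial : ℝ) ≤ Real.exp (-(4 * q)) * (1 / 2 : ℝ) ^ m := by
      have e1 := Real.pow_div_factorial_le_exp (m : ℝ) (by positivity) m
      calc (M ^ 2) ^ m / (m.factorial : ℝ) ≤ (m / Real.exp 6) ^ m / (m.factorial : ℝ) := by
            rw [hM]; gcongr
        _ = (m : ℝ) ^ m / (m.factorial : ℝ) * (Real.exp (-6)) ^ m := by
            rw [div_pow, Real.exp_neg, inv_pow]; field_simp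
        _ ≤ Real.exp m * Real.exp (-6) ^ m := by gcongr
        _ = Real.exp (-(4 * m)) * Real.exp (-1) ^ m := by
            rw [← Real.exp_nat_mul, ← Real.exp_nat_mul, ← Real.exp_add, ← Real.exp_add]
            congr 1; ring
        _ ≤ _ := by
            gcongr
            rw [Real.exp_neg, one_div]
            gcongr
            linarith [Real.add_one_le_exp (1 : ℝ)]
    calc _ ≤ 9 * p ^ 2 * (M ^ 2) ^ m / (m.factorial : ℝ) := by gcongr
      _ = 9 * p ^ 2 * ((M ^ 2) ^ m / (m.factorial : ℝ)) := by ring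
      _ ≤ 9 * p ^ 2 * (Real.exp (-(4 * q)) * (1 / 2 : ℝ) ^ m) := by gcongr
      _ = _ := by ring

/-- The normalized squared standard deviation of a binomial variable, relative to the distance from
its mean to a fixed level, grows with the success probability. -/
lemma mul_one_sub_mul_sq_le {p p' c : ℝ} (hp' : 0 ≤ p') (hpp : p' ≤ p) (hpc : p ≤ c) (hc : c ≤ 1) :
    p' * (1 - p') * (c - p) ^ 2 ≤ p * (1 - p) * (c - p') ^ 2 := by
  have e : p * (1 - p) * (c - p') ^ 2 - p' * (1 - p') * (c - p) ^ 2 =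
      (p - p') * (c * (1 - p) * (c * (1 - p')) - p * (1 - c) * (p' * (1 - c))) := by ring
  have h1 : p * (1 - c) ≤ c * (1 - p) := by linarith
  have h2 : p' * (1 - c) ≤ c * (1 - p') := by linarith
  have h3 := mul_le_mul h1 h2 (mul_nonneg hp' (by linarith)) (mul_nonneg (by linarith) (by linarith))
  have h4 := mul_nonneg (sub_nonneg.2 hpp) (sub_nonneg.2 h3)
  linarith

/-- Two point masses at distance `1 / (4 √n)` cannot be separated. -/
lemma le_minimaxRisk_parametric {n k : ℕ} (hn : 0 < n) (hk : 1 ≤ k) :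
    ENNReal.ofReal (1 / (64 * √(n : ℝ))) ≤ minimaxRisk n k := by
  have hn' : (0 : ℝ) < n := by exact_mod_cast hn
  have hk' : (0 : ℝ) < k := by exact_mod_cast hk
  set θ := 1 / (4 * √(n : ℝ)) with hθ
  have hθ0 : 0 < θ := by positivity
  have hθ2 : θ ^ 2 = 1 / (16 * n) := by
    rw [hθ, div_pow, mul_pow, Real.sq_sqrt hn'.le]; norm_num
  have h := le_minimaxRisk_of_priors (n := n) (k := k) hθ0 (w := fun b : Bool => if b then 1 else 0)
    (r := fun b : Bool => if b then 0 else 1) (x := fun b : Bool => if b then -θ else 0)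
    (p := 0) (p' := 0) (o := false)
    (by intro b; cases b <;> simp) (by simp) (by intro b; cases b <;> simp) (by simp)
    (by intro b; cases b <;> simp) (by intro b; cases b <;> simp)
    (by rw [Finset.sum_filter]; simp) (by rw [Finset.sum_filter]; simp)
    (by simpa using hk') (by simpa using hk') (by simp) (by simp)
    (by simp) (by simp) (by
      simp only [Fintype.sum_bool]
      have e1 : Real.exp (θ ^ 2) ≤ 1 / (1 - θ ^ 2) := by
        refine Real.exp_bound_div_one_sub_of_interval (by positivity) ?_
        rw [hθ2, div_lt_one (by positivity)]
        have : (1 : ℝ) ≤ n := by exact_mod_cast hn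
        linarith
      have e2 : (n : ℝ) * (Real.exp (θ ^ 2) - 1) ≤ 1 / 8 := by
        have h1 : (1 : ℝ) ≤ n := by exact_mod_cast hn
        rw [hθ2] at e1 ⊢
        have e3 : 1 / (1 - 1 / (16 * (n : ℝ))) = 1 + 1 / (16 * n - 1) := by
          have : 16 * (n : ℝ) - 1 ≠ 0 := by linarith
          field_simp
          ring
        rw [e3] at e1
        calc (n : ℝ) * (Real.exp (1 / (16 * n)) - 1) ≤ n * (1 / (16 * n - 1)) := by
              gcongr; linarith
          _ ≤ _ := by
              rw [mul_one_div, div_le_div_iff₀ (by linarith) (by norm_num)]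
              linarith
      simp only [if_true, Bool.false_eq_true, if_false, neg_mul_neg, mul_zero, zero_mul,
        Real.exp_zero]
      rw [show θ * θ = θ ^ 2 from (sq θ).symm]
      refine le_trans (le_of_eq ?_) e2
      ring)
  refine le_trans (ENNReal.ofReal_le_ofReal (le_of_eq ?_)) h
  rw [hθ]
  field_simp
  norm_num

/-- With `s² = k / (n - k)` and `κ = k / √n`, the matching priors contaminate with probability
`p = (s / (s + 2))²`. It is below the proportion `k / n = s² / (1 + s²)` by enough standard deviations;
the last bound concerns `n p² / (1 - p)`, which multiplies the `χ²` distance. -/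
lemma contamination_bounds {n s κ : ℝ} (hn : 0 < n) (hs : 0 < s) (hκ4 : 4 ≤ κ)
    (hκs : κ ^ 2 = n * (s ^ 2 / (1 + s ^ 2)) ^ 2) (hsκ : s ≤ 2 * κ) :
    (s / (s + 2)) ^ 2 < s ^ 2 / (1 + s ^ 2) ∧ s ^ 2 / (1 + s ^ 2) ≤ 1 ∧
      8 * ((s / (s + 2)) ^ 2 * (1 - (s / (s + 2)) ^ 2)) ≤
        n * (s ^ 2 / (1 + s ^ 2) - (s / (s + 2)) ^ 2) ^ 2 ∧
      n * ((s / (s + 2)) ^ 2) ^ 2 * ((2 + s) ^ 2 / (4 * (1 + s))) ≤ κ ^ 3 := by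
  refine ⟨?_, (div_le_one (by positivity)).2 (by linarith), ?_, ?_⟩
  · rw [div_pow, div_lt_div_iff₀ (by positivity) (by positivity)]
    gcongr
    nlinarith
  · have e1 : s ^ 2 / (1 + s ^ 2) - (s / (s + 2)) ^ 2 =
        s ^ 2 / (1 + s ^ 2) * ((4 * s + 3) / (s + 2) ^ 2) := by
      field_simp; ring
    have e3 : 8 * ((s / (s + 2)) ^ 2 * (1 - (s / (s + 2)) ^ 2)) =
        32 * (s ^ 2 * (1 + s)) / ((s + 2) ^ 2) ^ 2 := by
      field_simp; ring
    rw [e1, e3, mul_pow, ← mul_assoc n, ← hκs, div_pow, ← mul_div_assoc (κ ^ 2)]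
    have h1 : 2 * s ≤ κ ^ 2 := by nlinarith
    have h2 : 16 * (s * (1 + s)) ≤ (4 * s + 3) ^ 2 := by nlinarith
    have h3 : 32 * (s ^ 2 * (1 + s)) ≤ κ ^ 2 * (4 * s + 3) ^ 2 := by
      calc 32 * (s ^ 2 * (1 + s)) = 2 * s * (16 * (s * (1 + s))) := by ring
        _ ≤ κ ^ 2 * (4 * s + 3) ^ 2 := by gcongr
    gcongr
  · have e : n * ((s / (s + 2)) ^ 2) ^ 2 * ((2 + s) ^ 2 / (4 * (1 + s))) =
        n * (s ^ 2 / (1 + s ^ 2)) ^ 2 * ((1 + s ^ 2) ^ 2 / (4 * (1 + s) * (s + 2) ^ 2)) := by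
      rw [add_comm 2 s]
      field_simp
    have h1 : (1 + s ^ 2) ^ 2 / (4 * (1 + s) * (s + 2) ^ 2) ≤ (1 + s) / 4 := by
      rw [div_le_div_iff₀ (by positivity) (by norm_num)]
      have : (1 + s ^ 2) ^ 2 ≤ ((1 + s) * (s + 2)) ^ 2 := by
        gcongr
        nlinarith
      linarith
    rw [e, ← hκs]
    calc _ ≤ κ ^ 2 * κ := mul_le_mul_of_nonneg_left (by linarith) (sq_nonneg κ)
      _ = _ := by ring

/-- The lower bound from the matching priors, in terms of the degree `q` and `L = logOdds n k`. -/
lemma le_minimaxRisk_of_large {n k q : ℕ} (hk : 1 ≤ k) (hkn : k < n) (hq : 1 ≤ q)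
    (hκ : 4 * √(n : ℝ) ≤ k) (hκq : 2 * Real.log ((k : ℝ) / √(n : ℝ)) ≤ q) :
    ENNReal.ofReal (√(q / Real.exp 6) * (logOdds n k / q) ^ 2 / 64) ≤ minimaxRisk n k := by
  have hk' : (0 : ℝ) < k := by exact_mod_cast hk
  have hkn' : (k : ℝ) + 1 ≤ n := by exact_mod_cast hkn
  have hn' : (0 : ℝ) < n := by linarith
  have hsn : 0 < √(n : ℝ) := by positivity
  have hq' : (1 : ℝ) ≤ q := by exact_mod_cast hq
  set κ := (k : ℝ) / √(n : ℝ) with hκdef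
  have hκ4 : 4 ≤ κ := by rw [hκdef, le_div_iff₀ hsn]; exact hκ
  have hκ0 : 0 < κ := by linarith
  set s := √((k : ℝ) / ((n : ℝ) - k)) with hs
  have hs2 : s ^ 2 = k / (n - k) := Real.sq_sqrt (div_nonneg hk'.le (by linarith))
  have hs0 : 0 < s := Real.sqrt_pos.2 (div_pos hk' (by linarith))
  have hks : (k : ℝ) = n * (s ^ 2 / (1 + s ^ 2)) := by
    have : (n : ℝ) - k ≠ 0 := by linarith
    rw [hs2]; field_simp; rw [sub_add_cancel, div_self hn'.ne']
  have hκs : κ ^ 2 = n * (s ^ 2 / (1 + s ^ 2)) ^ 2 := by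
    rw [hκdef, div_pow, Real.sq_sqrt hn'.le, hks]; field_simp
  have hsκ : s ≤ 2 * κ := by
    have h1 : s ^ 2 * (n - k) = k := by
      rw [hs2]; field_simp [show (n : ℝ) - k ≠ 0 by linarith]
    have h2 : κ ^ 2 * n = k ^ 2 := by
      rw [hκdef, div_pow, Real.sq_sqrt hn'.le]; field_simp
    refine abs_le_of_sq_le_sq' (a := s) ?_ (by positivity) |>.2
    rcases le_or_gt (k : ℝ) (n / 2) with hc | hc
    · have h3 : s ^ 2 ≤ 1 := by
        rw [hs2, div_le_one (by linarith)]; linarith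
      nlinarith
    · have h3 : s ^ 2 ≤ k := by
        rw [hs2, div_le_iff₀ (by linarith)]; nlinarith
      have h4 : 2 * (k : ℝ) ≤ 4 * κ ^ 2 := by
        refine le_of_mul_le_mul_right ?_ hn'
        nlinarith
      linarith
  set L := logOdds n k with hL
  have hLe : Real.exp L = 1 + s := Real.exp_log (by positivity)
  have hL0 : 0 < L := Real.log_pos (by linarith)
  have hLq : L ≤ q := by
    refine le_trans ?_ hκq
    rw [← Real.exp_le_exp, hLe, two_mul, Real.exp_add, Real.exp_log hκ0]
    nlinarith
  -- with this `v`, the parameter `T = cosh (q v)` of the priors is `cosh L`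
  set v := L / q with hv
  have hv0 : 0 < v := by positivity
  have hv1 : v ≤ 1 := (div_le_one (by positivity)).2 hLq
  have hqv : q * v = L := by rw [hv]; field_simp
  set M := √(q / Real.exp 6) with hM
  have hM0 : 0 < M := by positivity
  have hM2 : M ^ 2 = q / Real.exp 6 := Real.sq_sqrt (by positivity)
  obtain ⟨W, R, x, o, hW0, hW1, hR0, hR1, hxW, hxR, hpW, hpR, hxo, hRo, hm0, hm1⟩ :=
    exists_matching_priors hq hv0 hv1 hM0
  rw [hqv] at hpW hRo hm1
  have hT : Real.cosh L = (1 + s + 1 / (1 + s)) / 2 := by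
    rw [Real.cosh_eq, Real.exp_neg, hLe, one_div]
  have hp : (Real.cosh L - 1) / (Real.cosh L + 1) = (s / (s + 2)) ^ 2 := by
    rw [hT]; field_simp; ring
  have hS : 2 / (Real.cosh L + 1) = 4 * (1 + s) / (2 + s) ^ 2 := by
    rw [hT]; field_simp; ring
  rw [hp] at hpW hm1
  rw [hS] at hRo
  set p := (s / (s + 2)) ^ 2 with hpdef
  set c := s ^ 2 / (1 + s ^ 2) with hc
  obtain ⟨hpc, hc1, hvar, hnp⟩ := contamination_bounds hn' hs0 hκ4 hκs hsκ
  rw [← hpdef] at hpc hvar hnp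
  rw [← hc] at hpc hc1 hvar
  have hp0 : 0 ≤ p := by positivity
  have h1p : 1 - p = 4 * (1 + s) / (2 + s) ^ 2 := by rw [hpdef]; field_simp; ring
  have hRo1 : R o ≤ 1 := by
    rw [← hR1]; exact Finset.single_le_sum (fun a _ => hR0 a) (Finset.mem_univ o)
  have hp'0 : 0 ≤ 1 - R o := by linarith
  have hp'p : 1 - R o ≤ p := by linarith
  have hvar' : 8 * ((1 - R o) * (1 - (1 - R o))) ≤ n * (c - (1 - R o)) ^ 2 := by
    have h1 := mul_one_sub_mul_sq_le hp'0 hp'p hpc.le hc1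
    have h2 : 0 < (c - p) ^ 2 := by
      have : 0 < c - p := by linarith
      positivity
    rw [← mul_le_mul_iff_left₀ h2]
    calc 8 * ((1 - R o) * (1 - (1 - R o))) * (c - p) ^ 2
        = 8 * ((1 - R o) * (1 - (1 - R o)) * (c - p) ^ 2) := by ring
      _ ≤ 8 * (p * (1 - p) * (c - (1 - R o)) ^ 2) := by gcongr
      _ = 8 * (p * (1 - p)) * (c - (1 - R o)) ^ 2 := by ring
      _ ≤ n * (c - p) ^ 2 * (c - (1 - R o)) ^ 2 := by gcongr
      _ = _ := by ring
  have hRo0 : 0 < R o := lt_of_lt_of_le (by positivity) hRo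
  have hchi := chi_le hq hM2 hm0 hm1
  have hκexp : Real.exp (-(4 * q)) ≤ 1 / κ ^ 8 := by
    rw [Real.exp_neg, ← one_div]
    have h1 : κ ^ 8 ≤ Real.exp (4 * q) := by
      rw [← Real.exp_log hκ0, ← Real.exp_nat_mul, Real.exp_le_exp]
      push_cast
      linarith
    gcongr
  have hθ : 0 < M * (Real.cosh v - 1) / 2 := by
    have h1 := sq_div_two_le_cosh_sub_one v
    have h2 : 0 < Real.cosh v - 1 := lt_of_lt_of_le (by positivity) h1
    positivity
  have hmain := le_minimaxRisk_of_priors (n := n) (k := k) hθ hW0 hW1 hR0 hR1 hxW hxR hpW hpR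
    (by rw [hks]; gcongr) (by rw [hks]; gcongr; linarith)
    (by
      rw [hks]
      calc 8 * (n * p * (1 - p)) = n * (8 * (p * (1 - p))) := by ring
        _ ≤ n * (n * (c - p) ^ 2) := by gcongr
        _ = _ := by ring)
    (by
      rw [hks]
      calc 8 * (n * (1 - R o) * (1 - (1 - R o))) = n * (8 * ((1 - R o) * (1 - (1 - R o)))) := by ring
        _ ≤ n * (n * (c - (1 - R o)) ^ 2) := by gcongr
        _ = _ := by ring)
    hxo hRo0 (by
      have hinv : 1 / R o ≤ (2 + s) ^ 2 / (4 * (1 + s)) := by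
        rw [div_le_div_iff₀ hRo0 (by positivity)]
        rw [div_le_iff₀ (by positivity)] at hRo
        linarith
      calc _ ≤ n * (18 * p ^ 2 * Real.exp (-(4 * q)) / R o) := by gcongr
        _ = 18 * (n * p ^ 2 * (1 / R o)) * Real.exp (-(4 * q)) := by ring
        _ ≤ 18 * (n * p ^ 2 * ((2 + s) ^ 2 / (4 * (1 + s)))) * (1 / κ ^ 8) := by gcongr
        _ ≤ 18 * κ ^ 3 * (1 / κ ^ 8) := by gcongr
        _ = 18 / κ ^ 5 := by field_simp
        _ ≤ 18 / 4 ^ 5 := by gcongr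
        _ ≤ 1 / 8 := by norm_num)
  refine le_trans (ENNReal.ofReal_le_ofReal ?_) hmain
  have h1 := mul_le_mul_of_nonneg_left (sq_div_two_le_cosh_sub_one v) hM0.le
  linarith

theorem exists_lower_bound : ∃ c : ℝ, 0 < c ∧ ∀ n k : ℕ, 64 ≤ n → 1 ≤ k → k < n →
    ENNReal.ofReal (c * rate n k) ≤ minimaxRisk n k := by
  refine ⟨1 / (640 * Real.exp 3), by positivity, fun n k hn hk hkn => ?_⟩
  have hk' : (0 : ℝ) < k := by exact_mod_cast hk
  have hkn' : (k : ℝ) + 1 ≤ n := by exact_mod_cast hkn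
  have hn' : (64 : ℝ) ≤ n := by exact_mod_cast hn
  have hsn : 0 < √(n : ℝ) := by positivity
  have hsn2 : √(n : ℝ) ^ 2 = n := Real.sq_sqrt (by linarith)
  set κ := (k : ℝ) / √(n : ℝ) with hκdef
  have hκ0 : 0 < κ := by positivity
  have hρ := logRatio_pos hk hkn
  have hexp3 : 20 ≤ Real.exp 3 := by
    have h1 := Real.exp_one_gt_d9
    have h2 : Real.exp 3 = Real.exp 1 ^ 3 := by rw [← Real.exp_nat_mul]; norm_num
    rw [h2]
    calc (20 : ℝ) ≤ 2.718 ^ 3 := by norm_num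
      _ ≤ _ := by gcongr; linarith
  have hv0 : 0 < κ ^ (2 / 3 : ℝ) := by positivity
  have hv3 : (κ ^ (2 / 3 : ℝ)) ^ (3 / 2 : ℝ) = κ := by
    rw [← Real.rpow_mul hκ0.le]; norm_num
  rcases lt_or_ge (k : ℝ) (4 * √(n : ℝ)) with hs | hl
  · -- the rate has the order `1 / √n` here
    refine le_trans (ENNReal.ofReal_le_ofReal ?_) (le_minimaxRisk_parametric (by omega) hk)
    have hκ4 : κ ≤ 4 := by rw [hκdef, div_le_iff₀ hsn]; exact hs.le
    set V := κ ^ (2 / 3 : ℝ) with hV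
    have hV4 : V ≤ 4 := by
      calc V ≤ 4 ^ (2 / 3 : ℝ) := by rw [hV]; gcongr
        _ ≤ 4 ^ (1 : ℝ) := Real.rpow_le_rpow_of_exponent_le (by norm_num) (by norm_num)
        _ = 4 := by norm_num
    have hρV : V / 5 ≤ logRatio n k := by
      have h1 := Real.one_sub_inv_le_log_of_pos (show 0 < 1 + V by linarith)
      refine le_trans ?_ h1
      have e : 1 - (1 + V)⁻¹ = V / (1 + V) := by field_simp; ring
      rw [e]
      gcongr
      linarith
    have hden : κ / 12 ≤ logRatio n k * √(logRatio n k) := by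
      rw [← rpow_three_halves hρ.le]
      calc κ / 12 ≤ (V / 5) ^ (3 / 2 : ℝ) := by
            rw [Real.div_rpow hv0.le (by norm_num), hv3, rpow_three_halves (by norm_num)]
            have h5 : √5 ≤ 2.4 := by rw [Real.sqrt_le_left (by norm_num)]; norm_num
            gcongr
            linarith
        _ ≤ _ := by gcongr
    have hnum : logOdds n k ^ 2 ≤ 2 * k / n := by
      have h1 : logOdds n k ≤ √((k : ℝ) / (n - k)) := by
        have h2 := Real.log_le_sub_one_of_pos
          (show 0 < 1 + √((k : ℝ) / (n - k)) by positivity)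
        unfold logOdds
        linarith
      have h8 : 8 ≤ √(n : ℝ) := by
        rw [Real.le_sqrt' (by norm_num)]; linarith
      have h2 : (k : ℝ) ≤ n / 2 := by nlinarith
      calc logOdds n k ^ 2 ≤ (√((k : ℝ) / (n - k))) ^ 2 := by
            gcongr
            exact logOdds_nonneg n k
        _ = (k : ℝ) / (n - k) := Real.sq_sqrt (div_nonneg hk'.le (by linarith))
        _ ≤ k / ((n : ℝ) / 2) := by
            gcongr
            linarith
        _ = _ := by field_simp
    have hr : rate n k ≤ 24 / √(n : ℝ) := by
      rw [rate_eq hk hkn]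
      calc _ ≤ (2 * k / n) / (κ / 12) := by gcongr
        _ = 24 * √(n : ℝ) / n := by rw [hκdef]; field_simp; norm_num
        _ = 24 * √(n : ℝ) / √(n : ℝ) ^ 2 := by rw [hsn2]
        _ = _ := by field_simp
    have hr0 := rate_pos hk hkn
    calc 1 / (640 * Real.exp 3) * rate n k ≤ 1 / (640 * 20) * (24 / √(n : ℝ)) := by gcongr
      _ ≤ 1 / (64 * √(n : ℝ)) := by
          rw [div_mul_div_comm, div_le_div_iff₀ (by positivity) (by positivity)]
          linarith
  · have hκ4 : 4 ≤ κ := by rw [hκdef, le_div_iff₀ hsn]; exact hl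
    set q := ⌈2 * Real.log κ⌉₊ with hq
    have hlog : 1 ≤ Real.log κ := by
      rw [Real.le_log_iff_exp_le hκ0]
      linarith [Real.exp_one_lt_d9]
    have hq1 : 1 ≤ q := Nat.one_le_ceil_iff.2 (by linarith)
    have hqle : 2 * Real.log κ ≤ q := Nat.le_ceil _
    have hqup : (q : ℝ) ≤ 3 * Real.log κ := by
      have := Nat.ceil_lt_add_one (show 0 ≤ 2 * Real.log κ by linarith)
      linarith
    have hq' : (1 : ℝ) ≤ q := by exact_mod_cast hq1
    refine le_trans (ENNReal.ofReal_le_ofReal ?_) (le_minimaxRisk_of_large hk hkn hq1 hl hqle)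
    have hqρ : (q : ℝ) ≤ 9 / 2 * logRatio n k := by
      have h1 : 2 / 3 * Real.log κ ≤ logRatio n k := by
        rw [← Real.log_rpow hκ0]
        unfold logRatio
        gcongr
        linarith
      linarith
    have hqq : q * √(q : ℝ) ≤ 10 * (logRatio n k * √(logRatio n k)) := by
      have h1 : √(q : ℝ) ≤ √(9 / 2) * √(logRatio n k) := by
        rw [← Real.sqrt_mul (by norm_num)]
        exact Real.sqrt_le_sqrt hqρ
      have h2 : √(9 / 2 : ℝ) ≤ 20 / 9 := by rw [Real.sqrt_le_left (by norm_num)]; norm_num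
      calc q * √(q : ℝ) ≤ (9 / 2 * logRatio n k) * (20 / 9 * √(logRatio n k)) := by
            gcongr
            exact h1.trans (by gcongr)
        _ = _ := by ring
    have hsq : √(q / Real.exp 6) = √(q : ℝ) / Real.exp 3 := by
      rw [Real.sqrt_div (by positivity)]
      congr 1
      rw [show Real.exp 6 = Real.exp 3 ^ 2 by rw [← Real.exp_nat_mul]; norm_num,
        Real.sqrt_sq (Real.exp_pos 3).le]
    have hsqq : √(q : ℝ) ^ 2 = q := Real.sq_sqrt (by positivity)
    have hsq0 : 0 < √(q : ℝ) := by positivity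
    rw [hsq, rate_eq hk hkn]
    calc 1 / (640 * Real.exp 3) * (logOdds n k ^ 2 / (logRatio n k * √(logRatio n k)))
        = logOdds n k ^ 2 / (64 * Real.exp 3) / (10 * (logRatio n k * √(logRatio n k))) := by
          field_simp; ring
      _ ≤ logOdds n k ^ 2 / (64 * Real.exp 3) / (q * √(q : ℝ)) := by gcongr
      _ = _ := by
          have e : (q : ℝ) * √(q : ℝ) * (√(q : ℝ)) = q ^ 2 := by
            rw [mul_assoc, ← sq, hsqq, sq]
          field_simp
          rw [hsqq]

end GOSC
end

/-! ### Adaptivity -/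

open GOSC MeasureTheory in
lemma GOSC.maxRisk_thetaAd_le {n k : ℕ} {r : ℝ}
    (h : ∀ (θ : ℝ) (μ : Fin n → ℝ), μ ∈ sparse n k →
      Integrable (fun Y => |thetaAd n Y - θ|) (law n θ μ) ∧
        ∫ Y, |thetaAd n Y - θ| ∂(law n θ μ) ≤ r) :
    maxRisk n k (thetaAd n) ≤ ENNReal.ofReal r := by
  refine iSup_le fun θ => iSup₂_le fun μ hμ => ?_
  obtain ⟨h1, h2⟩ := h θ μ hμ
  rw [← ofReal_integral_eq_lintegral_ofReal h1 (Filter.Eventually.of_forall fun _ => abs_nonneg _)]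
  exact ENNReal.ofReal_le_ofReal h2

theorem mainTheorem3 :
    ∃ c₁ c₂ c₃ c₄ : ℝ, 0 < c₁ ∧ 0 < c₂ ∧ 0 < c₃ ∧ 0 < c₄ ∧ ∃ n₀ : ℕ,
      ∀ n : ℕ, n₀ ≤ n →
        Measurable (GOSC.thetaAd n) ∧
        ∀ k : ℕ, 1 ≤ k → k < n →
          (∀ (θ : ℝ) (μ : Fin n → ℝ), μ ∈ GOSC.sparse n k →
            (GOSC.law n θ μ).real {Y | c₁ * GOSC.rate n k < |GOSC.thetaAd n Y - θ|} ≤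
                c₂ * (√(n : ℝ) / max (k : ℝ) √(n : ℝ)) ^ (4 / 3 : ℝ) *
                  Real.log (max (k : ℝ) (2 * √(n : ℝ)) / √(n : ℝ)) ^ 3 ∧
            MeasureTheory.Integrable (fun Y => |GOSC.thetaAd n Y - θ|) (GOSC.law n θ μ) ∧
            ∫ Y, |GOSC.thetaAd n Y - θ| ∂(GOSC.law n θ μ) ≤ c₃ * GOSC.rate n k) ∧
          GOSC.maxRisk n k (GOSC.thetaAd n) ≤ ENNReal.ofReal c₄ * GOSC.minimaxRisk n k := by
  obtain ⟨c₁, c₂, c₃, h1, h2, h3, hup⟩ := GOSC.exists_upper_bounds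
  obtain ⟨c, hc, hlow⟩ := GOSC.exists_lower_bound
  -- `log n ≥ 1000` is what the bounds on the tuning constants need
  refine ⟨c₁, c₂, c₃, c₃ / c, h1, h2, h3, by positivity, max 64 ⌈Real.exp 1000⌉₊, fun n hn => ?_⟩
  have hn64 : 64 ≤ n := (le_max_left _ _).trans hn
  have hexp : Real.exp 1000 ≤ n := Nat.ceil_le.1 ((le_max_right _ _).trans hn)
  have hlog : 1000 ≤ Real.log n := (Real.le_log_iff_exp_le ((Real.exp_pos _).trans_le hexp)).2 hexp
  refine ⟨GOSC.measurable_thetaAd (by omega), fun k hk hkn => ⟨hup n k hlog hk hkn, ?_⟩⟩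
  calc GOSC.maxRisk n k (GOSC.thetaAd n) ≤ ENNReal.ofReal (c₃ * GOSC.rate n k) :=
        GOSC.maxRisk_thetaAd_le fun θ μ hμ => (hup n k hlog hk hkn θ μ hμ).2
    _ = ENNReal.ofReal (c₃ / c) * ENNReal.ofReal (c * GOSC.rate n k) := by
        rw [← ENNReal.ofReal_mul (by positivity)]
        congr 1
        field_simp
    _ ≤ _ := by
        gcongr
        exact hlow n k hn64 hk hkn
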